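/- Let $\Delta^\vee\subset\mathbb R^d$ be a reflexive polytope: the convex hull of finitely many points of $\mathbb Z^d$, containing the origin in its interior, such that the vertices of the dual polytope $\Delta=\{m\in(\mathbb R^d)^*:\langle m,n\rangle\le 1\text{ for all }n\in\Delta^\vee\}$ lie in $(\mathbb Z^d)^*$. Let $\lambda\in\mathbb Z^{\Delta\cap(\mathbb Z^d)^*}$ and $\nu\in\mathbb Z^{\Delta^\vee\cap\mathbb Z^d}$ be height vectors that induce central coherent triangulations of $\Delta$ and $\Delta^\vee$. Here the coherent subdivision induced by a height vector is the projection of the upper hull of the lifted lattice points; it is a central triangulation if all its cells are simplices and its maximal cells have the origin as a vertex. Let $S$ and $T$ be the restrictions of these triangulations to the boundaries $\partial\Delta$ and $\partial\Delta^\vee$, and let $\operatorname{bsd}$ denote barycentric subdivision. Put $$|\Sigma|=\{(m,n)\in\Delta\times\Delta^\vee:\langle m,n\rangle=1\},$$ and let $\Sigma$ be the restriction of $\operatorname{bsd}(S)\times\operatorname{bsd}(T)$ to $|\Sigma|$, i.e. the collection of all cells of $\operatorname{bsd}(S)\times\operatorname{bsd}(T)$ that are contained in $|\Sigma|$. Then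 $\Sigma$ is a polytopal complex with underlying set $|\Sigma|$. It is combinatorially isomorphic to the boundary complex of a $d$-dimensional polytope $P\subset\mathbb R^d$, i.e. there is an inclusion-preserving bijection, with inclusion-preserving inverse, between the nonempty cells of $\Sigma$ and the nonempty proper faces of $P$. Moreover, $|\Sigma|$ is homeomorphic to the sphere $S^{d-1}$. -/

import Mathlib

/-- The point of `ℝ^d` with the given integer coordinates. -/
def latticePoint {d : ℕ} (z : Fin d → ℤ) : Fin d → ℝ := fun i => (z i : ℝ)

/-- A (convex) polytope: the convex hull of finitely many points. -/
def IsConvexPolytope {E : Type*} [AddCommGroup E] [Module ℝ E] (P : Set E) : Prop :=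
  ∃ V : Finset E, P = convexHull ℝ (V : Set E)

/-- A lattice polytope: the convex hull of finitely many points of `ℤ^d`. -/
def IsLatticePolytope {d : ℕ} (P : Set (Fin d → ℝ)) : Prop :=
  ∃ V : Finset (Fin d → ℤ), P = convexHull ℝ (latticePoint '' (V : Set (Fin d → ℤ)))

/-- The dual polytope `{m ∈ (ℝ^d)^* : ⟨m, n⟩ ≤ 1 for all n ∈ P}`. Throughout, `(ℝ^d)^*` is written
in coordinates with respect to the dual basis, so that the pairing is `m ⬝ᵥ n` and the dual
lattice is `ℤ^d`. -/
def dualPolytope {d : ℕ} (P : Set (Fin d → ℝ)) : Set (Fin d → ℝ) :=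
  {m | ∀ n ∈ P, m ⬝ᵥ n ≤ 1}

/-- A reflexive polytope: a lattice polytope with the origin in its interior, such that the
vertices of the dual polytope are lattice points as well. -/
structure IsReflexivePolytope {d : ℕ} (P : Set (Fin d → ℝ)) : Prop where
  isLatticePolytope : IsLatticePolytope P
  zero_mem_interior : (0 : Fin d → ℝ) ∈ interior P
  dual_vertices : (dualPolytope P).extremePoints ℝ ⊆ Set.range latticePoint

/-- The (nonempty) cells of the coherent (= regular) subdivision of a lattice polytope `P` induced
by heights `h` on its lattice points (only the values of `h` on `P ∩ ℤ^d` matter): the projections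
of the faces of the upper hull of the points `(z, h z)`, that is, the convex hulls of the sets of
lattice points at which an affine function `x ↦ c ⬝ᵥ x + b` that dominates `h` on `P ∩ ℤ^d`
agrees with `h`. -/
def coherentSubdivision {d : ℕ} (P : Set (Fin d → ℝ)) (h : (Fin d → ℤ) → ℤ) :
    Set (Set (Fin d → ℝ)) :=
  {C | C.Nonempty ∧ ∃ (c : Fin d → ℝ) (b : ℝ),
    (∀ z, latticePoint z ∈ P → (h z : ℝ) ≤ c ⬝ᵥ latticePoint z + b) ∧
    C = convexHull ℝ (latticePoint ''
      {z | latticePoint z ∈ P ∧ (h z : ℝ) = c ⬝ᵥ latticePoint z + b})}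

/-- `V` is the vertex set of a (nonempty) simplex. -/
def IsSimplexVertexSet {d : ℕ} (V : Finset (Fin d → ℝ)) : Prop :=
  V.Nonempty ∧ AffineIndependent ℝ ((↑) : V → (Fin d → ℝ))

/-- The heights `h` induce a central coherent triangulation of `P`: all cells of the coherent
subdivision are simplices, and the maximal ones have the origin as a vertex. -/
structure InducesCentralTriangulation {d : ℕ} (P : Set (Fin d → ℝ)) (h : (Fin d → ℤ) → ℤ) :
    Prop where
  simplex : ∀ C ∈ coherentSubdivision P h,
    ∃ V : Finset (Fin d → ℝ), IsSimplexVertexSet V ∧ C = convexHull ℝ (V : Set (Fin d → ℝ))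
  central : ∀ C, Maximal (· ∈ coherentSubdivision P h) C → 0 ∈ C.extremePoints ℝ

/-- The restriction of the triangulation induced by `h` to the boundary of `P`. A simplex is
represented by its set of vertices. -/
def boundaryTriangulation {d : ℕ} (P : Set (Fin d → ℝ)) (h : (Fin d → ℤ) → ℤ) :
    Set (Finset (Fin d → ℝ)) :=
  {V | IsSimplexVertexSet V ∧ convexHull ℝ (V : Set (Fin d → ℝ)) ∈ coherentSubdivision P h ∧
    convexHull ℝ (V : Set (Fin d → ℝ)) ⊆ frontier P}

/-- The cells of the barycentric subdivision of a simplicial complex `K`: the convex hulls of the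
barycenters of the members of a nonempty chain of simplices of `K`. -/
def barycentricSubdivision {d : ℕ} (K : Set (Finset (Fin d → ℝ))) : Set (Set (Fin d → ℝ)) :=
  {c | ∃ L : Finset (Finset (Fin d → ℝ)), L.Nonempty ∧ (L : Set (Finset (Fin d → ℝ))) ⊆ K ∧
    IsChain (· ⊆ ·) (L : Set (Finset (Fin d → ℝ))) ∧
    c = convexHull ℝ ((fun V => V.centroid ℝ id) '' (L : Set (Finset (Fin d → ℝ))))}

/-- The set `|Σ| = {(m, n) ∈ Δ × Δ^∨ : ⟨m, n⟩ = 1}`, where `Q` is `Δ^∨` and `Δ` is its dual. -/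
def sigmaSupport {d : ℕ} (Q : Set (Fin d → ℝ)) : Set ((Fin d → ℝ) × (Fin d → ℝ)) :=
  {p | p.1 ∈ dualPolytope Q ∧ p.2 ∈ Q ∧ p.1 ⬝ᵥ p.2 = 1}

/-- The set of (nonempty) cells of `Σ`: the cells of `bsd(S) × bsd(T)` that are contained
in `|Σ|`, where `S` and `T` are the triangulations of the boundaries of `Δ` (the dual of `Q`) and
`Δ^∨ = Q` that are induced by `lam` and `nu`. -/
def sigmaComplex {d : ℕ} (Q : Set (Fin d → ℝ)) (lam nu : (Fin d → ℤ) → ℤ) :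
    Set (Set ((Fin d → ℝ) × (Fin d → ℝ))) :=
  {c | ∃ c₁ ∈ barycentricSubdivision (boundaryTriangulation (dualPolytope Q) lam),
    ∃ c₂ ∈ barycentricSubdivision (boundaryTriangulation Q nu),
      c = c₁ ×ˢ c₂ ∧ c ⊆ sigmaSupport Q}

/-- A (finite) polytopal complex, given by the set of its nonempty cells. Faces of a polytope are
its exposed subsets (Mathlib counts the empty set and the polytope itself among them). -/
structure IsPolytopalComplex {E : Type*} [AddCommGroup E] [Module ℝ E] [TopologicalSpace E]
    (K : Set (Set E)) : Prop where
  finite : K.Finite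
  nonempty : ∀ c ∈ K, c.Nonempty
  polytope : ∀ c ∈ K, IsConvexPolytope c
  face_mem : ∀ c ∈ K, ∀ F, F.Nonempty → IsExposed ℝ c F → F ∈ K
  inter_face : ∀ c ∈ K, ∀ c' ∈ K, IsExposed ℝ c (c ∩ c')

/-- The boundary complex of a polytope: the set of its nonempty proper faces. -/
def boundaryComplex {E : Type*} [AddCommGroup E] [Module ℝ E] [TopologicalSpace E]
    (P : Set E) : Set (Set E) :=
  {F | F.Nonempty ∧ F ≠ P ∧ IsExposed ℝ P F}

/-! The sphere. Every open ray from the origin contains `m + n` for exactly one `(m, n)` of |Σ|.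
Uniqueness is monotonicity: if `m + n = t (m' + n')`, then `(m - t m') ⬝ᵥ (n - t n')` is minus a
square and is also at least `(1 - t) ^ 2`. Existence is a nearest-point projection: for `x ≠ 0`, the
point of the cone over `Q × {1}` nearest to `(x, 0)` is some `β (n, 1)`, and `m = x / β - n` is the
partner of `n`. Normalising `m + n` is therefore a continuous bijection from a compact space to the
sphere.

The polytope. A cell of Σ is a product of the barycentric simplices of a chain C in S and a chain D
in T such that `m ⬝ᵥ n = 1` for all vertices m of C and n of D. It remains to build a polytope whose
proper faces are indexed, with inclusions, by these compatible pairs. It is the Minkowski sum of the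
hulls of points `p σ` (σ in S) and `q τ` (τ in T). The face of such a sum in direction u is the sum
of the two faces in direction u, so only the maximisers of u among the `p σ` and among the `q τ`
matter.

The `q τ` are the barycenters of T, moved slightly along their rays so that the boundary of their
hull becomes bsd(T). This uses the convex function given by the heights, refined by the strictly
concave term `-|τ| ^ 2` (`exists_barycentric_functional`).

The `p σ` start from functionals `c σ` that touch the convex function of S exactly on σ. They are
pushed outwards by weights that drop steeply with the cardinality of σ. In a direction from the open
cone over ρ the maximisers then form a chain of faces of ρ, and every chain with top ρ occurs
(`exists_dual_points`).

Compatibility comes from duality. If u lies in the open cone over ρ and is maximal at the barycenter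
of τ, a multiple of u lies in Δ and equals 1 on τ, which forces `m ⬝ᵥ n = 1` on ρ × τ. Compactness
carries this over to small perturbations. Conversely, a compatible pair is exposed by a point of the
cone over the top of C, found by solving a triangular system, plus a small multiple of the
functional that selects D (`exists_minkowski_points`). -/

open Set

/-! ### Functionals on finite convex hulls and on simplices -/

/-- The continuous linear functional `x ↦ u ⬝ᵥ x`. -/
noncomputable def dotCLM {d : ℕ} (u : Fin d → ℝ) : (Fin d → ℝ) →L[ℝ] ℝ :=
  LinearMap.toContinuousLinearMap (dotProductEquiv ℝ (Fin d) u)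

@[simp] theorem dotCLM_apply {d : ℕ} (u x : Fin d → ℝ) : dotCLM u x = u ⬝ᵥ x := rfl

theorem exists_eq_dotCLM {d : ℕ} (f : (Fin d → ℝ) →ₗ[ℝ] ℝ) : ∃ u : Fin d → ℝ, ∀ x, f x = u ⬝ᵥ x := by
  obtain ⟨u, hu⟩ := (dotProductEquiv ℝ (Fin d)).surjective f
  exact ⟨u, fun x => by rw [← hu]; rfl⟩

theorem mem_convexHull_image_finset {ι F : Type*} [AddCommGroup F] [Module ℝ F]
    (I : Finset ι) (f : ι → F) (x : F) :
    x ∈ convexHull ℝ (f '' (I : Set ι)) ↔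
      ∃ c : ι → ℝ, (∀ i ∈ I, 0 ≤ c i) ∧ ∑ i ∈ I, c i = 1 ∧ ∑ i ∈ I, c i • f i = x := by
  classical
  constructor
  · intro hx
    have : Convex ℝ {x : F | ∃ c : ι → ℝ, (∀ i ∈ I, 0 ≤ c i) ∧ ∑ i ∈ I, c i = 1 ∧
        ∑ i ∈ I, c i • f i = x} := by
      rintro _ ⟨c, h0, h1, rfl⟩ _ ⟨c', h0', h1', rfl⟩ a b ha hb hab
      refine ⟨fun i => a * c i + b * c' i, fun i hi => ?_, ?_, ?_⟩
      · have := h0 i hi; have := h0' i hi; positivity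
      · rw [Finset.sum_add_distrib, ← Finset.mul_sum, ← Finset.mul_sum, h1, h1']; simpa using hab
      · simp only [add_smul, mul_smul, Finset.sum_add_distrib, Finset.smul_sum]
    refine convexHull_min ?_ this hx
    rintro _ ⟨i, hi, rfl⟩
    have hi' : i ∈ I := hi
    refine ⟨fun j => if j = i then 1 else 0, fun j _ => by dsimp only; split_ifs <;> simp, ?_, ?_⟩
    · simp [hi']
    · simp [hi']
  · rintro ⟨c, h0, h1, rfl⟩
    exact (convex_convexHull ℝ _).sum_mem h0 h1
      fun i hi => subset_convexHull ℝ _ (mem_image_of_mem f hi)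

/-- The defect `M - l x` is the average of the nonnegative defects of the generators. If it
vanishes, all the weight sits on generators of defect zero, which lie in `J`. -/
theorem mem_convexHull_image_of_le {ι F : Type*} [AddCommGroup F] [Module ℝ F]
    {I J : Finset ι} {f : ι → F} {l : F →ₗ[ℝ] ℝ} {M : ℝ}
    (hle : ∀ i ∈ I, l (f i) ≤ M) (heq : ∀ i ∈ I, l (f i) = M → i ∈ J)
    {x : F} (hx : x ∈ convexHull ℝ (f '' (I : Set ι))) :
    l x ≤ M ∧ (l x = M → x ∈ convexHull ℝ (f '' ((J : Set ι) ∩ I))) := by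
  classical
  obtain ⟨c, h0, h1, rfl⟩ := (mem_convexHull_image_finset I f x).1 hx
  have key : l (∑ i ∈ I, c i • f i) = M - ∑ i ∈ I, c i * (M - l (f i)) := by
    simp only [map_sum, map_smul, smul_eq_mul, mul_sub, Finset.sum_sub_distrib, ← Finset.sum_mul, h1]
    ring
  have hnn : ∀ i ∈ I, 0 ≤ c i * (M - l (f i)) := fun i hi =>
    mul_nonneg (h0 i hi) (sub_nonneg.2 (hle i hi))
  refine ⟨by rw [key]; linarith [Finset.sum_nonneg hnn], fun h => ?_⟩
  have hz : ∑ i ∈ I, c i * (M - l (f i)) = 0 := by linarith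
  have hz' := (Finset.sum_eq_zero_iff_of_nonneg hnn).1 hz
  have hc : ∀ i ∈ I, i ∉ I.filter (· ∈ J) → c i = 0 := by
    intro i hi hiJ
    rcases mul_eq_zero.1 (hz' i hi) with h | h
    · exact h
    · exact absurd (Finset.mem_filter.2 ⟨hi, heq i hi (by linarith)⟩) hiJ
  have hcoe : ((J : Set ι) ∩ I) = ((I.filter (· ∈ J) : Finset ι) : Set ι) := by
    ext i; simp [and_comm]
  rw [hcoe, mem_convexHull_image_finset]
  refine ⟨c, fun i hi => h0 i (Finset.mem_filter.1 hi).1, ?_, ?_⟩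
  · rw [← h1]
    exact Finset.sum_subset (Finset.filter_subset _ _) hc
  · exact Finset.sum_subset (Finset.filter_subset _ _) fun i hi h => by rw [hc i hi h, zero_smul]

/-- The face of the hull of a finite family on which a functional is maximal is the hull of the
members on which it is maximal. -/
theorem setOf_isMax_convexHull_image {ι F : Type*} [AddCommGroup F] [Module ℝ F]
    {I J : Finset ι} (f : ι → F) (l : F →ₗ[ℝ] ℝ) (hne : J.Nonempty)
    (hJ : ∀ i, i ∈ J ↔ i ∈ I ∧ ∀ j ∈ I, l (f j) ≤ l (f i)) :
    {x | x ∈ convexHull ℝ (f '' (I : Set ι)) ∧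
      ∀ y ∈ convexHull ℝ (f '' (I : Set ι)), l y ≤ l x} = convexHull ℝ (f '' (J : Set ι)) := by
  obtain ⟨i₀, hi₀⟩ := hne
  have h₀ := (hJ i₀).1 hi₀
  have hJI : (J : Set ι) ∩ I = J := inter_eq_left.2 fun i hi => ((hJ i).1 hi).1
  have hface : ∀ x ∈ convexHull ℝ (f '' (I : Set ι)), l x ≤ l (f i₀) ∧
      (l x = l (f i₀) → x ∈ convexHull ℝ (f '' (J : Set ι))) := fun x hx => by
    have := mem_convexHull_image_of_le (J := J) (l := l) (M := l (f i₀)) h₀.2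
      (fun i hi h => (hJ i).2 ⟨hi, fun j hj => h ▸ h₀.2 j hj⟩) hx
    rwa [hJI] at this
  ext x
  constructor
  · rintro ⟨hx, hmax⟩
    exact (hface x hx).2 (le_antisymm (hface x hx).1
      (hmax _ (subset_convexHull ℝ _ (mem_image_of_mem f h₀.1))))
  · intro hx
    have hxI : x ∈ convexHull ℝ (f '' (I : Set ι)) :=
      convexHull_mono (image_mono fun i hi => ((hJ i).1 hi).1) hx
    refine ⟨hxI, fun y hy => ?_⟩
    have : ∀ i ∈ J, (-l) (f i) ≤ -l (f i₀) := fun i hi => by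
      simpa using ((hJ i).1 hi).2 i₀ h₀.1
    have h2 := (mem_convexHull_image_of_le (J := J) (l := -l) this (fun i hi _ => hi) hx).1
    have h3 := (hface y hy).1
    simp at h2
    linarith

/-- Extend `V` to an affine basis and add up the barycentric coordinates of the basis points outside
`W`. The result cuts out the face spanned by `W ∩ V`. -/
theorem exists_affine_eq_zero_one {d : ℕ} {V : Finset (Fin d → ℝ)}
    (hV : AffineIndependent ℝ ((↑) : V → (Fin d → ℝ))) (W : Finset (Fin d → ℝ)) :
    ∃ (c : Fin d → ℝ) (b : ℝ), (∀ v ∈ V, v ∈ W → c ⬝ᵥ v + b = 0) ∧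
      ∀ v ∈ V, v ∉ W → c ⬝ᵥ v + b = 1 := by
  classical
  have hV' : AffineIndependent ℝ (fun p : (V : Set (Fin d → ℝ)) => (p : Fin d → ℝ)) := hV
  obtain ⟨t, hVt, hti, htop⟩ := exists_subset_affineIndependent_affineSpan_eq_top hV'
  let B : AffineBasis t ℝ (Fin d → ℝ) := ⟨_, hti, by simpa using htop⟩
  have : Fintype t := (B.finite_set).fintype
  let g : (Fin d → ℝ) →ᵃ[ℝ] ℝ := ∑ i : t, (if (i : Fin d → ℝ) ∈ W then 0 else 1 : ℝ) • B.coord i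
  have hg : ∀ v (hv : v ∈ t), g v = if v ∈ W then 0 else 1 := by
    intro v hv
    have : ∀ i, B.coord i v = if i = ⟨v, hv⟩ then 1 else 0 := fun i => B.coord_apply i ⟨v, hv⟩
    have h2 : g v = ∑ i : t, (if (i : Fin d → ℝ) ∈ W then 0 else 1 : ℝ) * B.coord i v := by
      simp only [g]
      induction (Finset.univ : Finset t) using Finset.induction_on with
      | empty => simp
      | insert a s ha ih =>
        rw [Finset.sum_insert ha, Finset.sum_insert ha, ← ih]
        rfl
    rw [h2]
    simp only [this, mul_ite, mul_one, mul_zero, Finset.sum_ite_eq', Finset.mem_univ, if_true]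
  obtain ⟨c, hc⟩ := exists_eq_dotCLM g.linear
  have hdec : ∀ x, c ⬝ᵥ x + g 0 = g x := fun x => by
    rw [← hc]
    have := congrFun g.decomp x
    simpa using this.symm
  exact ⟨c, g 0, fun v hv hW => by rw [hdec, hg v (hVt hv), if_pos hW],
    fun v hv hW => by rw [hdec, hg v (hVt hv), if_neg hW]⟩

theorem affine_nonneg_of_mem_convexHull {d : ℕ} {V W : Finset (Fin d → ℝ)} {c : Fin d → ℝ} {b : ℝ}
    (h0 : ∀ v ∈ V, v ∈ W → c ⬝ᵥ v + b = 0) (h1 : ∀ v ∈ V, v ∉ W → c ⬝ᵥ v + b = 1)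
    {x : Fin d → ℝ} (hx : x ∈ convexHull ℝ (V : Set (Fin d → ℝ))) :
    0 ≤ c ⬝ᵥ x + b ∧ (c ⬝ᵥ x + b = 0 → x ∈ convexHull ℝ (W : Set (Fin d → ℝ))) := by
  have := mem_convexHull_image_of_le (I := V) (J := W) (f := id) (l := (-dotCLM c).toLinearMap)
    (M := b) (fun v hv => ?_) (fun v hv h => ?_) (by simpa using hx)
  · simp only [image_id, ContinuousLinearMap.coe_coe, neg_apply,
      dotCLM_apply] at this
    exact ⟨by linarith [this.1], fun h => convexHull_mono inter_subset_left (this.2 (by linarith))⟩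
  · by_cases hW : v ∈ W
    · simp; linarith [h0 v hv hW]
    · simp; linarith [h1 v hv hW]
  · by_contra hW
    simp at h; linarith [h1 v hv hW]

/-- The vertices of a simplex belong to every generating subset. -/
theorem AffineIndependent.mem_of_mem_convexHull {d : ℕ} {V : Finset (Fin d → ℝ)}
    (hV : AffineIndependent ℝ ((↑) : V → (Fin d → ℝ))) {v : Fin d → ℝ} (hv : v ∈ V)
    {X : Set (Fin d → ℝ)} (hX : X ⊆ convexHull ℝ (V : Set (Fin d → ℝ)))
    (hvX : v ∈ convexHull ℝ X) : v ∈ X := by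
  classical
  obtain ⟨c, b, h0, h1⟩ := exists_affine_eq_zero_one hV {v}
  by_contra hvn
  have hpos : X ⊆ {x | -b < dotCLM c x} := by
    intro x hx
    have := affine_nonneg_of_mem_convexHull h0 h1 (hX hx)
    rcases this.1.lt_or_eq with h | h
    · simp only [mem_ofPred_eq, dotCLM_apply]; linarith
    · have := this.2 h.symm
      simp at this
      exact absurd (this ▸ hx) hvn
  have := convexHull_min hpos (convex_halfSpace_gt (dotCLM c).isLinear (-b)) hvX
  simp only [mem_ofPred_eq, dotCLM_apply] at this
  linarith [h0 v hv (by simp)]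

/-! ### The homeomorphism with the sphere -/

/-- With `y = m - t m'` the hypothesis says `n - t n' = -y`. Expanding `y ⬝ᵥ (-y)` gives `1 - t (m
⬝ᵥ n') - t (m' ⬝ᵥ n) + t ^ 2 ≥ (1 - t) ^ 2`, because both mixed pairings are at most 1. Hence `t =
1` and `y = 0`. -/
theorem eq_of_mem_sigmaSupport_of_add_eq_smul_add {d : ℕ} {Q : Set (Fin d → ℝ)}
    {p q : (Fin d → ℝ) × (Fin d → ℝ)} (hp : p ∈ sigmaSupport Q) (hq : q ∈ sigmaSupport Q)
    {t : ℝ} (ht : 0 ≤ t) (h : p.1 + p.2 = t • (q.1 + q.2)) : p = q := by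
  obtain ⟨m, n⟩ := p
  obtain ⟨m', n'⟩ := q
  obtain ⟨hm, hn, hmn⟩ := hp
  obtain ⟨hm', hn', hmn'⟩ := hq
  dsimp only at *
  have h1 := hm n' hn'
  have h2 := hm' n hn
  have e : n - t • n' = -(m - t • m') := by
    rw [smul_add] at h
    have : n = t • m' + t • n' - m := by rw [← h]; abel
    rw [this]; abel
  have e2 : (m - t • m') ⬝ᵥ (n - t • n') = 1 - t * (m ⬝ᵥ n') - t * (m' ⬝ᵥ n) + t ^ 2 := by
    simp only [sub_dotProduct, dotProduct_sub, smul_dotProduct, dotProduct_smul, smul_eq_mul,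
      hmn, hmn']
    ring
  have hnn : 0 ≤ (m - t • m') ⬝ᵥ (m - t • m') := dotProduct_self_star_nonneg _
  rw [e, dotProduct_neg] at e2
  have ht1 : t = 1 := by nlinarith [sq_nonneg (1 - t)]
  subst ht1
  have hz : (m - (1 : ℝ) • m') ⬝ᵥ (m - (1 : ℝ) • m') = 0 := by nlinarith
  have hmm := dotProduct_self_eq_zero.1 hz
  rw [hmm, neg_zero] at e
  rw [one_smul, sub_eq_zero] at e hmm
  rw [e, hmm]

/-- The squared distance from `(x, 0)` to the ray through `(n, 1)` is `|x| ^ 2 - (x ⬝ᵥ n) ^ 2 / (1 +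
n ⬝ᵥ n)` when `x ⬝ᵥ n ≥ 0`, so the maximiser below is the projection of `(x, 0)` to the cone over `Q
× {1}`. Its optimality condition says that `x / β - n` lies in the dual polytope and pairs to 1 with
`n`. -/
theorem exists_mem_sigmaSupport_add_eq_smul {d : ℕ} {Q : Set (Fin d → ℝ)} (hc : IsCompact Q)
    (hconv : Convex ℝ Q) (h0 : (0 : Fin d → ℝ) ∈ interior Q) {x : Fin d → ℝ} (hx : x ≠ 0) :
    ∃ p ∈ sigmaSupport Q, ∃ t : ℝ, 0 < t ∧ p.1 + p.2 = t • x := by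
  have hxx : 0 < x ⬝ᵥ x := by
    have : 0 ≤ x ⬝ᵥ x := dotProduct_self_star_nonneg _
    exact this.lt_of_ne' fun h => hx (dotProduct_self_eq_zero.1 h)
  have hpos : ∀ n : Fin d → ℝ, 0 < 1 + n ⬝ᵥ n := fun n => by
    have : 0 ≤ n ⬝ᵥ n := dotProduct_self_star_nonneg _
    linarith
  -- a small multiple of `x` lies in `Q`
  obtain ⟨s, hs, hsQ⟩ : ∃ s : ℝ, 0 < s ∧ s • x ∈ Q := by
    have hcont : Filter.Tendsto (fun s : ℝ => s • x) (nhds 0) (nhds 0) := by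
      have : Continuous fun s : ℝ => s • x := by fun_prop
      simpa using this.tendsto 0
    have := hcont.eventually (mem_interior_iff_mem_nhds.1 h0)
    obtain ⟨ε, hε, hball⟩ := Metric.eventually_nhds_iff.1 this
    refine ⟨ε / 2, by positivity, hball ?_⟩
    rw [Real.dist_eq, sub_zero, abs_of_pos (by positivity)]; linarith
  have hxc : Continuous fun n : Fin d → ℝ => x ⬝ᵥ n := (dotCLM x).continuous
  have hnc : Continuous fun n : Fin d → ℝ => n ⬝ᵥ n := continuous_id.dotProduct continuous_id
  obtain ⟨n, ⟨hnQ, hn0⟩, hmax⟩ := (hc.inter_right (isClosed_Ici.preimage hxc : IsClosed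
    ((fun n => x ⬝ᵥ n) ⁻¹' Ici 0))).exists_isMaxOn ⟨s • x, hsQ, by
      simp only [mem_preimage, mem_Ici, dotProduct_smul, smul_eq_mul]; positivity⟩
    (f := fun n => (x ⬝ᵥ n) ^ 2 / (1 + n ⬝ᵥ n))
    ((hxc.pow 2).div (continuous_const.add hnc) fun n => (hpos n).ne').continuousOn
  have hn0' : 0 ≤ x ⬝ᵥ n := hn0
  set a := x ⬝ᵥ n with ha
  have ha0 : 0 < a := by
    refine hn0'.lt_of_ne' fun h => ?_
    have := hmax (a := s • x) ⟨hsQ, by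
      simp only [mem_preimage, mem_Ici, dotProduct_smul, smul_eq_mul]; positivity⟩
    simp only [← ha, h, mem_ofPred_eq, ne_eq, OfNat.ofNat_ne_zero, not_false_eq_true, zero_pow,
      zero_div] at this
    have h2 : 0 < (x ⬝ᵥ (s • x)) ^ 2 / (1 + (s • x) ⬝ᵥ (s • x)) := by
      have : 0 < x ⬝ᵥ (s • x) := by rw [dotProduct_smul, smul_eq_mul]; positivity
      have := hpos (s • x)
      positivity
    linarith
  have hN := hpos n
  set N := n ⬝ᵥ n with hNdef
  have hvar : ∀ n' ∈ Q, (x ⬝ᵥ (n' - n)) * (1 + N) ≤ a * (n ⬝ᵥ (n' - n)) := by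
    intro n' hn'
    set b := x ⬝ᵥ (n' - n) with hb
    set B := n ⬝ᵥ (n' - n) with hB
    set c := (n' - n) ⬝ᵥ (n' - n) with hcc
    by_contra! hlt
    -- After cross-multiplication, the increment of the objective from `n` to `n + s (n' - n)` is
    -- `s` times the second expression. Its value at `s = 0` is positive when the first-order
    -- condition fails.
    have hev : ∀ᶠ s : ℝ in nhdsWithin 0 (Ioi 0), 0 < a + s * b ∧
        0 < 2 * a * (b * (1 + N) - a * B) + s * (b ^ 2 * (1 + N) - a ^ 2 * c) ∧ s < 1 ∧ 0 < s := by
      have c1 : Continuous fun s : ℝ => a + s * b := by fun_prop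
      have c2 : Continuous fun s : ℝ =>
        2 * a * (b * (1 + N) - a * B) + s * (b ^ 2 * (1 + N) - a ^ 2 * c) := by fun_prop
      have t1 := (c1.tendsto 0).eventually (lt_mem_nhds (a := 0) (by simpa using ha0))
      have t2 := (c2.tendsto 0).eventually (lt_mem_nhds (a := 0) (by
        have : 0 < b * (1 + N) - a * B := by linarith
        simp only [zero_mul, add_zero]; positivity))
      filter_upwards [nhdsWithin_le_nhds t1, nhdsWithin_le_nhds t2,
        nhdsWithin_le_nhds (gt_mem_nhds (zero_lt_one' ℝ)), self_mem_nhdsWithin] with s h1 h2 h3 h4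
      exact ⟨h1, h2, h3, h4⟩
    obtain ⟨s, h1, h2, h3, h4⟩ := hev.exists
    have hmem : n + s • (n' - n) ∈ Q := hconv.add_smul_sub_mem hnQ hn' ⟨h4.le, h3.le⟩
    have hx' : x ⬝ᵥ (n + s • (n' - n)) = a + s * b := by
      rw [dotProduct_add, dotProduct_smul, smul_eq_mul]
    have hn2 : (n + s • (n' - n)) ⬝ᵥ (n + s • (n' - n)) = N + 2 * s * B + s ^ 2 * c := by
      simp only [add_dotProduct, dotProduct_add, smul_dotProduct, dotProduct_smul, smul_eq_mul,
        dotProduct_comm (n' - n) n, ← hB, ← hcc, ← hNdef]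
      ring
    have := hmax (a := n + s • (n' - n)) ⟨hmem, by
      simp only [mem_preimage, mem_Ici, hx']; exact h1.le⟩
    have hp := hpos (n + s • (n' - n))
    simp only [mem_ofPred_eq, hx', hn2, ← ha, ← hNdef] at this hp
    rw [div_le_div_iff₀ hp hN] at this
    nlinarith [mul_pos h4 h2]
  set β := a / (1 + N) with hβ
  have hβ0 : 0 < β := by positivity
  have haβ : a = β * (1 + N) := by rw [hβ]; field_simp
  refine ⟨(β⁻¹ • x - n, n), ⟨fun n' hn' => ?_, hnQ, ?_⟩, β⁻¹, by positivity, by simp⟩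
  · have h := hvar n' hn'
    simp only [dotProduct_sub, ← ha, ← hNdef] at h
    rw [sub_dotProduct, smul_dotProduct, smul_eq_mul]
    have h' : x ⬝ᵥ n' ≤ β * (1 + n ⬝ᵥ n') := by
      rw [haβ] at h
      have : (x ⬝ᵥ n') * (1 + N) ≤ β * (1 + n ⬝ᵥ n') * (1 + N) := by linarith
      exact le_of_mul_le_mul_right this hN
    have : β⁻¹ * (x ⬝ᵥ n') ≤ 1 + n ⬝ᵥ n' := by
      rw [inv_mul_le_iff₀ hβ0]; exact h'
    linarith
  · dsimp only
    rw [sub_dotProduct, smul_dotProduct, smul_eq_mul, ← ha, haβ, ← hNdef]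
    field_simp; ring

theorem isClosed_dualPolytope {d : ℕ} (Q : Set (Fin d → ℝ)) : IsClosed (dualPolytope Q) := by
  have : dualPolytope Q = ⋂ n ∈ Q, {m | m ⬝ᵥ n ≤ 1} := by ext; simp [dualPolytope]
  rw [this]
  refine isClosed_biInter fun n _ => isClosed_le ?_ continuous_const
  exact continuous_id.dotProduct continuous_const

theorem isCompact_dualPolytope {d : ℕ} {Q : Set (Fin d → ℝ)}
    (h0 : (0 : Fin d → ℝ) ∈ interior Q) : IsCompact (dualPolytope Q) := by
  refine Metric.isCompact_of_isClosed_isBounded (isClosed_dualPolytope Q) ?_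
  obtain ⟨ε, hε, hball⟩ := Metric.mem_nhds_iff.1 (mem_interior_iff_mem_nhds.1 h0)
  refine (Metric.isBounded_closedBall (x := (0 : Fin d → ℝ)) (r := (ε / 2)⁻¹)).subset ?_
  intro m hm
  rw [mem_closedBall_zero_iff, pi_norm_le_iff_of_nonneg (by positivity)]
  intro i
  have key : ∀ s : ℝ, |s| = ε / 2 → m i * s ≤ 1 := by
    intro s hs
    have := hm (Pi.single i s) (hball (by
      rw [mem_ball_zero_iff, Pi.norm_single, Real.norm_eq_abs, hs]; linarith))
    simpa using this
  have h1 := key (ε / 2) (abs_of_pos (by positivity))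
  have h2 := key (-(ε / 2)) (by rw [abs_neg]; exact abs_of_pos (by positivity))
  have hi : (ε / 2)⁻¹ * (ε / 2) = 1 := inv_mul_cancel₀ (by positivity)
  rw [Real.norm_eq_abs, abs_le]
  constructor
  · refine le_of_mul_le_mul_right (a := ε / 2) ?_ (by positivity)
    rw [neg_mul, hi]; linarith
  · refine le_of_mul_le_mul_right (a := ε / 2) ?_ (by positivity)
    rw [hi]; linarith

/-- The sum `m + n` never vanishes, since `m = -n` would make the pairing nonpositive. Its
normalisation is a continuous bijection from a compact to a Hausdorff space. -/
theorem nonempty_homeomorph_sigmaSupport_sphere {d : ℕ} {Q : Set (Fin d → ℝ)} (hc : IsCompact Q)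
    (hconv : Convex ℝ Q) (h0 : (0 : Fin d → ℝ) ∈ interior Q) :
    Nonempty (sigmaSupport Q ≃ₜ Metric.sphere (0 : EuclideanSpace ℝ (Fin d)) 1) := by
  have hcpt : IsCompact (sigmaSupport Q) := by
    have : sigmaSupport Q = (dualPolytope Q ×ˢ Q) ∩ {p | p.1 ⬝ᵥ p.2 = 1} := by
      ext p; simp [sigmaSupport, and_assoc]
    rw [this]
    refine ((isCompact_dualPolytope h0).prod hc).inter_right (isClosed_eq ?_ continuous_const)
    exact continuous_fst.dotProduct continuous_snd
  have : CompactSpace (sigmaSupport Q) := isCompact_iff_compactSpace.1 hcpt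
  have hne : ∀ p ∈ sigmaSupport Q, WithLp.toLp 2 (p.1 + p.2) ≠ 0 := by
    intro p hp h
    have h' : p.1 + p.2 = 0 := (WithLp.toLp_eq_zero 2).1 h
    have h1 := hp.2.2
    rw [eq_neg_of_add_eq_zero_left h', neg_dotProduct] at h1
    have : 0 ≤ p.2 ⬝ᵥ p.2 := dotProduct_self_star_nonneg _
    linarith
  let ψ : sigmaSupport Q → Metric.sphere (0 : EuclideanSpace ℝ (Fin d)) 1 := fun p =>
    ⟨‖WithLp.toLp 2 (p.1.1 + p.1.2)‖⁻¹ • WithLp.toLp 2 (p.1.1 + p.1.2), by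
      rw [mem_sphere_zero_iff_norm, norm_smul, norm_inv, norm_norm,
        inv_mul_cancel₀ (norm_ne_zero_iff.2 (hne p p.2))]⟩
  have hψc : Continuous ψ := by
    refine Continuous.subtype_mk ?_ _
    have h1 : Continuous fun p : sigmaSupport Q => WithLp.toLp 2 (p.1.1 + p.1.2) := by fun_prop
    exact (h1.norm.inv₀ fun p => norm_ne_zero_iff.2 (hne p p.2)).smul h1
  have hinj : Function.Injective ψ := by
    intro p q hpq
    have h := congrArg Subtype.val hpq
    simp only [ψ] at h
    have hp := norm_pos_iff.2 (hne p p.2)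
    have hq := norm_pos_iff.2 (hne q q.2)
    refine Subtype.ext (eq_of_mem_sigmaSupport_of_add_eq_smul_add p.2 q.2
      (t := ‖WithLp.toLp 2 (p.1.1 + p.1.2)‖ * ‖WithLp.toLp 2 (q.1.1 + q.1.2)‖⁻¹) (by positivity) ?_)
    have h2 := congrArg (fun z => ‖WithLp.toLp 2 (p.1.1 + p.1.2)‖ • z) h
    simp only [smul_smul, mul_inv_cancel₀ hp.ne', one_smul] at h2
    simpa using congrArg WithLp.ofLp h2
  have hsurj : Function.Surjective ψ := by
    rintro ⟨x, hx⟩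
    have hx1 : ‖x‖ = 1 := by simpa using hx
    obtain ⟨p, hp, t, ht, hpt⟩ := exists_mem_sigmaSupport_add_eq_smul hc hconv h0 (x := x.ofLp)
      (fun h => by
        have : x = 0 := by simpa using h
        simp [this] at hx1)
    refine ⟨⟨p, hp⟩, Subtype.ext ?_⟩
    have : WithLp.toLp 2 (p.1 + p.2) = t • x := by rw [hpt]; simp
    simp only [ψ, this, norm_smul, hx1, mul_one, Real.norm_eq_abs, abs_of_pos ht, smul_smul,
      inv_mul_cancel₀ ht.ne', one_smul]
  exact ⟨Continuous.homeoOfEquivCompactToT2 (f := Equiv.ofBijective ψ ⟨hinj, hsurj⟩) hψc⟩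

/-! ### Lattice bodies and polar duality -/

/-- A compact convex neighbourhood of the origin that is the hull of its lattice points. -/
structure IsLatticeBody {d : ℕ} (A : Set (Fin d → ℝ)) : Prop where
  isCompact : IsCompact A
  convex : Convex ℝ A
  zero_mem_interior : (0 : Fin d → ℝ) ∈ interior A
  subset_hull : A ⊆ convexHull ℝ (latticePoint '' {z | latticePoint z ∈ A})

theorem finite_latticePoint_mem {d : ℕ} {A : Set (Fin d → ℝ)} (hA : IsCompact A) :
    {z : Fin d → ℤ | latticePoint z ∈ A}.Finite := by
  obtain ⟨R, hR⟩ := hA.isBounded.exists_norm_le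
  refine (Set.finite_Icc (fun _ : Fin d => -⌈R⌉) (fun _ => ⌈R⌉)).subset fun z hz => ?_
  have h : ∀ i, |(z i : ℝ)| ≤ ⌈R⌉ := fun i =>
    ((norm_le_pi_norm (latticePoint z) i).trans (hR _ hz)).trans (Int.le_ceil R)
  refine ⟨fun i => ?_, fun i => ?_⟩
  · have := (abs_le.1 (h i)).1; exact_mod_cast this
  · have := (abs_le.1 (h i)).2; exact_mod_cast this

theorem latticePoint_injective {d : ℕ} : Function.Injective (latticePoint (d := d)) := by
  intro z w h
  funext i
  have := congrFun h i
  simpa [latticePoint] using this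

theorem convex_dualPolytope {d : ℕ} (Q : Set (Fin d → ℝ)) : Convex ℝ (dualPolytope Q) := by
  intro m hm m' hm' a b ha hb hab n hn
  have h1 := hm n hn
  have h2 := hm' n hn
  rw [add_dotProduct, smul_dotProduct, smul_dotProduct, smul_eq_mul, smul_eq_mul]
  nlinarith

theorem zero_mem_interior_dualPolytope {d : ℕ} {Q : Set (Fin d → ℝ)} (hQ : IsCompact Q) :
    (0 : Fin d → ℝ) ∈ interior (dualPolytope Q) := by
  obtain ⟨R, hR⟩ := hQ.isBounded.exists_norm_le
  have hev : ∀ᶠ m : Fin d → ℝ in nhds 0, ∑ i, |m i| * |R| < 1 := by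
    have hc : Continuous fun m : Fin d → ℝ => ∑ i, |m i| * |R| := by fun_prop
    exact (hc.tendsto 0).eventually (gt_mem_nhds (by simp))
  refine mem_interior_iff_mem_nhds.2 (Filter.mem_of_superset hev fun m hm n hn => ?_)
  refine (Finset.sum_le_sum fun i _ => ?_).trans (le_of_lt hm)
  calc m i * n i ≤ |m i * n i| := le_abs_self _
    _ = |m i| * |n i| := abs_mul _ _
    _ ≤ |m i| * |R| := by
        exact mul_le_mul_of_nonneg_left (((norm_le_pi_norm n i).trans (hR n hn)).trans
          (le_abs_self R)) (abs_nonneg _)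

/-- A boundary point of a convex neighbourhood of the origin has a supporting functional. -/
theorem exists_mem_dualPolytope_eq_one {d : ℕ} {A : Set (Fin d → ℝ)} (hconv : Convex ℝ A)
    (h0 : (0 : Fin d → ℝ) ∈ interior A) {x : Fin d → ℝ} (hx : x ∉ interior A) :
    ∃ m ∈ dualPolytope A, 1 ≤ m ⬝ᵥ x ∧ (x ∈ A → m ⬝ᵥ x = 1) := by
  obtain ⟨f, hf⟩ := geometric_hahn_banach_open_point hconv.interior isOpen_interior hx
  obtain ⟨u, hu⟩ := exists_eq_dotCLM f.toLinearMap
  have hu' : ∀ y, f y = u ⬝ᵥ y := hu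
  have hpos : 0 < u ⬝ᵥ x := by have := hf 0 h0; simpa [hu'] using this
  have hmem : (u ⬝ᵥ x)⁻¹ • u ∈ dualPolytope A := by
    intro y hy
    have hcl : A ⊆ {y | f y ≤ f x} := by
      refine subset_closure.trans ?_
      rw [← hconv.closure_interior_eq_closure_of_nonempty_interior ⟨0, h0⟩]
      exact closure_minimal (fun y hy => (hf y hy).le) (isClosed_le f.continuous continuous_const)
    have := hcl hy
    simp only [mem_ofPred_eq, hu'] at this
    rw [smul_dotProduct, smul_eq_mul, inv_mul_le_iff₀ hpos, mul_one]
    exact this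
  have h1 : ((u ⬝ᵥ x)⁻¹ • u) ⬝ᵥ x = 1 := by
    rw [smul_dotProduct, smul_eq_mul, inv_mul_cancel₀ hpos.ne']
  exact ⟨_, hmem, h1.ge, fun _ => h1⟩

theorem mem_frontier_of_dotProduct_eq_one {d : ℕ} {A : Set (Fin d → ℝ)} {m x : Fin d → ℝ}
    (hm : m ∈ dualPolytope A) (hx : x ∈ A) (h : m ⬝ᵥ x = 1) : x ∈ frontier A := by
  refine ⟨subset_closure hx, fun hxi => ?_⟩
  have hc : Continuous fun s : ℝ => s • x := by fun_prop
  have hev := (hc.tendsto 1).eventually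
    (by rw [one_smul]; exact mem_interior_iff_mem_nhds.1 hxi)
  have hgt := (hev.filter_mono nhdsWithin_le_nhds).and (self_mem_nhdsWithin (s := Ioi (1 : ℝ)))
  obtain ⟨s, hs, hs1⟩ := hgt.exists
  have := hm _ hs
  rw [dotProduct_smul, h, smul_eq_mul, mul_one] at this
  exact absurd hs1 (not_lt.2 this)

theorem dualPolytope_dualPolytope {d : ℕ} {Q : Set (Fin d → ℝ)} (hQ : IsCompact Q)
    (hconv : Convex ℝ Q) (h0 : (0 : Fin d → ℝ) ∈ interior Q) :
    dualPolytope (dualPolytope Q) = Q := by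
  ext n
  constructor
  · intro hn
    by_contra hnQ
    obtain ⟨f, r, hf, hr⟩ := geometric_hahn_banach_closed_point hconv hQ.isClosed hnQ
    obtain ⟨u, hu⟩ := exists_eq_dotCLM f.toLinearMap
    have hu' : ∀ y, f y = u ⬝ᵥ y := hu
    simp only [hu'] at hf hr
    have hpos : 0 < r := by simpa using hf 0 (interior_subset h0)
    have := hn (r⁻¹ • u) fun y hy => by
      rw [smul_dotProduct, smul_eq_mul, inv_mul_le_iff₀ hpos, mul_one]
      exact (hf y hy).le
    rw [dotProduct_smul, smul_eq_mul, inv_mul_le_iff₀ hpos, mul_one, dotProduct_comm] at this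
    linarith
  · intro hn m hm
    rw [dotProduct_comm]
    exact hm n hn

theorem IsReflexivePolytope.isLatticeBody {d : ℕ} {Q : Set (Fin d → ℝ)}
    (hQ : IsReflexivePolytope Q) : IsLatticeBody Q := by
  obtain ⟨V, rfl⟩ := hQ.isLatticePolytope
  refine ⟨(V.finite_toSet.image _).isCompact_convexHull ℝ, convex_convexHull ℝ _,
    hQ.zero_mem_interior, convexHull_mono (image_mono fun z hz =>
      subset_convexHull ℝ _ (mem_image_of_mem _ hz))⟩

theorem IsReflexivePolytope.isLatticeBody_dualPolytope {d : ℕ} {Q : Set (Fin d → ℝ)}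
    (hQ : IsReflexivePolytope Q) : IsLatticeBody (dualPolytope Q) := by
  have hc := isCompact_dualPolytope hQ.zero_mem_interior
  refine ⟨hc, convex_dualPolytope Q, zero_mem_interior_dualPolytope hQ.isLatticeBody.isCompact, ?_⟩
  have hfin : (latticePoint '' {z | latticePoint z ∈ dualPolytope Q}).Finite :=
    (finite_latticePoint_mem hc).image _
  calc dualPolytope Q = closure (convexHull ℝ ((dualPolytope Q).extremePoints ℝ)) :=
        (closure_convexHull_extremePoints hc (convex_dualPolytope Q)).symm
    _ ⊆ closure (convexHull ℝ (latticePoint '' {z | latticePoint z ∈ dualPolytope Q})) := by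
        refine closure_mono (convexHull_mono fun x hx => ?_)
        obtain ⟨z, rfl⟩ := hQ.dual_vertices hx
        exact ⟨z, (extremePoints_subset hx : latticePoint z ∈ dualPolytope Q), rfl⟩
    _ = _ := (hfin.isCompact_convexHull ℝ).isClosed.closure_eq

/-! ### Coherent subdivisions -/

/-- The lattice points at which the affine function `x ↦ c ⬝ᵥ x + b` agrees with the heights. -/
def contactSet {d : ℕ} (A : Set (Fin d → ℝ)) (h : (Fin d → ℤ) → ℤ) (c : Fin d → ℝ) (b : ℝ) :
    Set (Fin d → ℤ) :=
  {z | latticePoint z ∈ A ∧ (h z : ℝ) = c ⬝ᵥ latticePoint z + b}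

theorem finite_coherentSubdivision {d : ℕ} {A : Set (Fin d → ℝ)} (hA : IsCompact A)
    (h : (Fin d → ℤ) → ℤ) : (coherentSubdivision A h).Finite := by
  refine ((finite_latticePoint_mem hA).finite_subsets.image
    fun E => convexHull ℝ (latticePoint '' E)).subset ?_
  rintro C ⟨-, c, b, -, rfl⟩
  exact ⟨_, fun z hz => hz.1, rfl⟩

/-- Take the highest point `(x, t)` over `x` in the hull `G` of the lifted lattice points. A
hyperplane supporting the region `H` below `G` at this point is the graph of a dominating affine
function, and `x` lies in the hull of its contact points. -/
theorem exists_mem_coherentSubdivision_of_mem_interior {d : ℕ} {A : Set (Fin d → ℝ)}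
    (hA : IsLatticeBody A) (h : (Fin d → ℤ) → ℤ) {x : Fin d → ℝ} (hx : x ∈ interior A) :
    ∃ C ∈ coherentSubdivision A h, x ∈ C := by
  classical
  set I : Finset (Fin d → ℤ) := (finite_latticePoint_mem hA.isCompact).toFinset with hI
  have hIcoe : (I : Set (Fin d → ℤ)) = {z | latticePoint z ∈ A} := Set.Finite.coe_toFinset _
  have hImem : ∀ z, z ∈ I ↔ latticePoint z ∈ A := fun z => Set.Finite.mem_toFinset _
  let g : (Fin d → ℤ) → (Fin d → ℝ) × ℝ := fun z => (latticePoint z, (h z : ℝ))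
  set G := convexHull ℝ (g '' (I : Set (Fin d → ℤ))) with hG
  have hGc : IsCompact G := (I.finite_toSet.image g).isCompact_convexHull ℝ
  have hfst : ∀ y ∈ A, ∃ s, (y, s) ∈ G := by
    intro y hy
    have hy' := hA.subset_hull hy
    have : latticePoint '' {z | latticePoint z ∈ A} =
        (LinearMap.fst ℝ (Fin d → ℝ) ℝ) '' (g '' (I : Set (Fin d → ℤ))) := by
      rw [← image_comp, hIcoe]; rfl
    rw [this, ← LinearMap.image_convexHull] at hy'
    obtain ⟨⟨y', s⟩, hs, rfl⟩ := hy'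
    exact ⟨s, hs⟩
  obtain ⟨b₀, hb₀⟩ : ∃ b₀ : ℝ, ∀ p ∈ G, b₀ ≤ p.2 := by
    obtain ⟨b₀, hb₀⟩ := (hGc.image continuous_snd).bddBelow
    exact ⟨b₀, fun p hp => hb₀ (mem_image_of_mem _ hp)⟩
  have hxA := interior_subset hx
  obtain ⟨t, htG, htmax⟩ : ∃ t, (x, t) ∈ G ∧ ∀ s, (x, s) ∈ G → s ≤ t := by
    obtain ⟨s, hs⟩ := hfst x hxA
    obtain ⟨⟨x', t⟩, ⟨h1, h2⟩, h3⟩ := (hGc.inter_right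
      (isClosed_singleton.preimage continuous_fst : IsClosed (Prod.fst ⁻¹' {x}))).exists_isMaxOn
      ⟨(x, s), hs, rfl⟩ (continuous_snd (X := Fin d → ℝ) (Y := ℝ)).continuousOn
    obtain rfl : x' = x := h2
    exact ⟨t, h1, fun s hs => h3 ⟨hs, rfl⟩⟩
  set H : Set ((Fin d → ℝ) × ℝ) := {p | ∃ s, p.2 ≤ s ∧ (p.1, s) ∈ G} with hH
  have hHconv : Convex ℝ H := by
    rintro ⟨y, r⟩ ⟨s, hs, hsG⟩ ⟨y', r'⟩ ⟨s', hs', hsG'⟩ a b ha hb hab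
    refine ⟨a * s + b * s', ?_, (convex_convexHull ℝ _) hsG hsG' ha hb hab⟩
    simp only [Prod.smul_mk, Prod.mk_add_mk, smul_eq_mul] at *
    gcongr
  have hopen : interior A ×ˢ Iio b₀ ⊆ interior H := by
    refine interior_maximal ?_ (isOpen_interior.prod isOpen_Iio)
    rintro ⟨y, r⟩ ⟨hy, hr⟩
    obtain ⟨s, hs⟩ := hfst y (interior_subset hy)
    exact ⟨s, (le_of_lt hr).trans (hb₀ _ hs), hs⟩
  have hnot : (x, t) ∉ interior H := by
    intro hxt
    have hc : Continuous fun r : ℝ => (x, r) := by fun_prop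
    have hev := ((hc.tendsto t).eventually (mem_interior_iff_mem_nhds.1 hxt)).filter_mono
      (nhdsWithin_le_nhds (s := Ioi t))
    obtain ⟨r, ⟨s, hrs, hs⟩, hr⟩ := (hev.and self_mem_nhdsWithin).exists
    exact absurd (htmax s hs) (not_le.2 (lt_of_lt_of_le hr hrs))
  obtain ⟨f, hf⟩ := geometric_hahn_banach_open_point hHconv.interior isOpen_interior hnot
  obtain ⟨l, hl⟩ := exists_eq_dotCLM (f.toLinearMap ∘ₗ LinearMap.inl ℝ (Fin d → ℝ) ℝ)
  set s := f (0, 1) with hs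
  have hfdec : ∀ y r, f (y, r) = l ⬝ᵥ y + r * s := by
    intro y r
    have h1 : (y, r) = (y, (0 : ℝ)) + r • ((0 : Fin d → ℝ), (1 : ℝ)) := by ext <;> simp
    rw [h1, map_add, map_smul, ← hl]; rfl
  have hle : ∀ p ∈ H, f p ≤ f (x, t) := by
    have hcl : H ⊆ {p | f p ≤ f (x, t)} := by
      refine subset_closure.trans ?_
      rw [← hHconv.closure_interior_eq_closure_of_nonempty_interior
        ⟨(x, b₀ - 1), hopen ⟨hx, by simp⟩⟩]
      exact closure_minimal (fun y hy => (hf y hy).le) (isClosed_le f.continuous continuous_const)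
    exact fun p hp => hcl hp
  -- The hyperplane is not vertical: since `x` is interior, a point straight below `(x, t)` lies in
  -- the interior of `H`, strictly on the negative side.
  have hspos : 0 < s := by
    have h1 := hf _ (hopen (a := (x, b₀ - 1)) ⟨hx, by simp⟩)
    have h2 : b₀ ≤ t := hb₀ _ htG
    rw [hfdec, hfdec] at h1
    by_contra! hcon
    nlinarith
  have hlez : ∀ z ∈ I, f (g z) ≤ f (x, t) := fun z hz => hle _
    ⟨_, le_rfl, subset_convexHull ℝ _ (mem_image_of_mem g hz)⟩
  have hbd : ∀ z, f (x, t) - f (g z) =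
      s * ((-(s⁻¹ • l)) ⬝ᵥ latticePoint z + (s⁻¹ * (l ⬝ᵥ x) + t) - h z) := by
    intro z
    simp only [g, hfdec, neg_dotProduct, smul_dotProduct, smul_eq_mul]
    field_simp
    ring
  have hx' := (mem_convexHull_image_of_le (J := I.filter fun z => f (g z) = f (x, t))
    (l := f.toLinearMap) hlez (fun i hi hi' => Finset.mem_filter.2 ⟨hi, hi'⟩) htG).2 rfl
  have hsub : x ∈ convexHull ℝ
      (latticePoint '' contactSet A h (-(s⁻¹ • l)) (s⁻¹ * (l ⬝ᵥ x) + t)) := by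
    have := mem_image_of_mem (LinearMap.fst ℝ (Fin d → ℝ) ℝ) hx'
    rw [LinearMap.image_convexHull, ← image_comp] at this
    refine convexHull_mono (image_mono ?_) this
    rintro z ⟨hz, hzI⟩
    refine ⟨(hImem z).1 hzI, ?_⟩
    have h1 := hbd z
    rw [(Finset.mem_filter.1 hz).2, sub_self, zero_eq_mul] at h1
    rcases h1 with h1 | h1
    · exact absurd h1 hspos.ne'
    · linarith
  refine ⟨_, ⟨⟨x, hsub⟩, -(s⁻¹ • l), s⁻¹ * (l ⬝ᵥ x) + t, fun z hz => ?_, rfl⟩, hsub⟩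
  have h1 := hbd z
  have h2 := hlez z ((hImem z).2 hz)
  have h3 : 0 ≤ (-(s⁻¹ • l)) ⬝ᵥ latticePoint z + (s⁻¹ * (l ⬝ᵥ x) + t) - h z := by
    by_contra! hcon
    have := mul_neg_of_pos_of_neg hspos hcon
    linarith
  linarith

/-- The union of the finitely many compact cells is closed and contains the interior, whose closure
contains `A`. -/
theorem exists_mem_coherentSubdivision {d : ℕ} {A : Set (Fin d → ℝ)}
    (hA : IsLatticeBody A) (h : (Fin d → ℤ) → ℤ) {x : Fin d → ℝ} (hx : x ∈ A) :
    ∃ C ∈ coherentSubdivision A h, x ∈ C := by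
  have hclosed : IsClosed (⋃₀ coherentSubdivision A h) := by
    rw [sUnion_eq_biUnion]
    refine (finite_coherentSubdivision hA.isCompact h).isClosed_biUnion ?_
    rintro C ⟨-, c, b, -, rfl⟩
    exact ((((finite_latticePoint_mem hA.isCompact).subset fun z hz => hz.1).image
      _).isCompact_convexHull ℝ).isClosed
  have : A ⊆ ⋃₀ coherentSubdivision A h := by
    refine subset_closure.trans ?_
    rw [← hA.convex.closure_interior_eq_closure_of_nonempty_interior ⟨0, hA.zero_mem_interior⟩]
    exact closure_minimal (fun y hy => exists_mem_coherentSubdivision_of_mem_interior hA h hy)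
      hclosed
  exact this hx

theorem IsSimplexVertexSet.subset_of_convexHull_eq {d : ℕ} {V : Finset (Fin d → ℝ)}
    (hV : IsSimplexVertexSet V) {X : Set (Fin d → ℝ)}
    (h : convexHull ℝ (V : Set (Fin d → ℝ)) = convexHull ℝ X) : (V : Set (Fin d → ℝ)) ⊆ X := by
  intro v hv
  exact hV.2.mem_of_mem_convexHull hv (h ▸ subset_convexHull ℝ X) (h ▸ subset_convexHull ℝ _ hv)

/-- Let ℓ and ℓ' be the affine functions of the two cells. On `V'` one has `ℓ' = h ≤ ℓ`, while at a
vertex `v` of `V` one has `ℓ = h ≤ ℓ'`. So `v` is in the hull of those vertices of `V'` where both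
agree with `h`. These lie in the cell of `V`, and `v`, being a vertex of it, is one of them. -/
theorem subset_of_convexHull_subset_of_mem_coherentSubdivision {d : ℕ} {A : Set (Fin d → ℝ)}
    {h : (Fin d → ℤ) → ℤ} {V V' : Finset (Fin d → ℝ)} (hV : IsSimplexVertexSet V)
    (hV' : IsSimplexVertexSet V')
    (hC : convexHull ℝ (V : Set (Fin d → ℝ)) ∈ coherentSubdivision A h)
    (hC' : convexHull ℝ (V' : Set (Fin d → ℝ)) ∈ coherentSubdivision A h)
    (hsub : convexHull ℝ (V : Set (Fin d → ℝ)) ⊆ convexHull ℝ (V' : Set (Fin d → ℝ))) :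
    V ⊆ V' := by
  classical
  obtain ⟨-, c, b, hdom, hE⟩ := hC
  obtain ⟨-, c', b', hdom', hE'⟩ := hC'
  intro v hv
  have hvE := hV.subset_of_convexHull_eq hE hv
  obtain ⟨z, ⟨hzA, hz⟩, rfl⟩ := hvE
  have hV'E := hV'.subset_of_convexHull_eq hE'
  have key := mem_convexHull_image_of_le (I := V') (f := id)
    (J := V'.filter fun e => (c' - c) ⬝ᵥ e = b - b')
    (l := (dotCLM (c' - c)).toLinearMap) (M := b - b') (fun e he => by
      obtain ⟨w, ⟨hwA, hw⟩, rfl⟩ := hV'E he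
      have := hdom w hwA
      simp only [id, ContinuousLinearMap.coe_coe, dotCLM_apply, sub_dotProduct]
      linarith) (fun e he h => Finset.mem_filter.2 ⟨he, h⟩)
    (by rw [image_id]; exact hsub (subset_convexHull ℝ _ hv))
  have hzle := hdom' z hzA
  have hmem := key.2 (le_antisymm key.1 (by
    simp only [ContinuousLinearMap.coe_coe, dotCLM_apply, sub_dotProduct]; linarith))
  rw [image_id] at hmem
  have := hV.2.mem_of_mem_convexHull hv (fun e he => ?_) hmem
  · exact this.2
  · obtain ⟨he1, he2⟩ := he
    have he3 := (Finset.mem_filter.1 (Finset.mem_coe.1 he1)).2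
    obtain ⟨w, ⟨hwA, hw⟩, rfl⟩ := hV'E he2
    rw [hE]
    refine subset_convexHull ℝ _ ⟨w, ⟨hwA, ?_⟩, rfl⟩
    rw [sub_dotProduct] at he3
    linarith

/-- Tilt the affine function of the cell by a small multiple of one that is 0 on `W` and 1 on the
remaining vertices. At the finitely many lattice points off contact the positive gap absorbs the
tilt. On the cell the tilt is nonnegative and vanishes only on the face spanned by `W`. -/
theorem exists_contactSet_of_subset {d : ℕ} {A : Set (Fin d → ℝ)} (hA : IsCompact A)
    {h : (Fin d → ℤ) → ℤ} {V W : Finset (Fin d → ℝ)} (hV : IsSimplexVertexSet V)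
    (hC : convexHull ℝ (V : Set (Fin d → ℝ)) ∈ coherentSubdivision A h) (hW : W ⊆ V) :
    ∃ (c : Fin d → ℝ) (b : ℝ),
      (∀ z, latticePoint z ∈ A → (h z : ℝ) ≤ c ⬝ᵥ latticePoint z + b) ∧
      convexHull ℝ (W : Set (Fin d → ℝ)) = convexHull ℝ (latticePoint '' contactSet A h c b) := by
  obtain ⟨-, c, b, hdom, hE⟩ := hC
  obtain ⟨a, a₀, ha0, ha1⟩ := exists_affine_eq_zero_one hV.2 W
  have hev : ∀ᶠ t : ℝ in nhdsWithin 0 (Ioi 0), ∀ z ∈ {z | latticePoint z ∈ A},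
      (h z : ℝ) < c ⬝ᵥ latticePoint z + b →
        t * |a ⬝ᵥ latticePoint z + a₀| < c ⬝ᵥ latticePoint z + b - h z := by
    rw [Filter.eventually_all_finite (finite_latticePoint_mem hA)]
    intro z _
    by_cases hz : (h z : ℝ) < c ⬝ᵥ latticePoint z + b
    · have hc : Continuous fun t : ℝ => t * |a ⬝ᵥ latticePoint z + a₀| := by fun_prop
      filter_upwards [nhdsWithin_le_nhds ((hc.tendsto 0).eventually
        (gt_mem_nhds (show (0 : ℝ) * |a ⬝ᵥ latticePoint z + a₀| < c ⬝ᵥ latticePoint z + b - h z by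
          simpa using hz)))] with t ht _
      exact ht
    · exact Filter.Eventually.of_forall fun t h' => absurd h' hz
  obtain ⟨t, ht, ht0⟩ := (hev.and self_mem_nhdsWithin).exists
  have ht0' : 0 < t := ht0
  have hval : ∀ z, (c + t • a) ⬝ᵥ latticePoint z + (b + t * a₀) =
      c ⬝ᵥ latticePoint z + b + t * (a ⬝ᵥ latticePoint z + a₀) := fun z => by
    rw [add_dotProduct, smul_dotProduct, smul_eq_mul]; ring
  have hin : ∀ z, latticePoint z ∈ A → (h z : ℝ) = c ⬝ᵥ latticePoint z + b →
      0 ≤ a ⬝ᵥ latticePoint z + a₀ ∧ (a ⬝ᵥ latticePoint z + a₀ = 0 →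
        latticePoint z ∈ convexHull ℝ (W : Set (Fin d → ℝ))) := fun z hzA hz =>
    affine_nonneg_of_mem_convexHull ha0 ha1
      (hE ▸ subset_convexHull ℝ _ ⟨z, ⟨hzA, hz⟩, rfl⟩)
  refine ⟨c + t • a, b + t * a₀, fun z hz => ?_, ?_⟩
  · rw [hval]
    rcases (hdom z hz).lt_or_eq with hlt | heq
    · have h1 := ht z hz hlt
      have h2 := neg_abs_le (a ⬝ᵥ latticePoint z + a₀)
      nlinarith
    · have h1 := (hin z hz heq).1
      rw [heq]
      nlinarith [mul_nonneg ht0'.le h1]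
  · refine subset_antisymm (convexHull_min (fun w hw => ?_) (convex_convexHull ℝ _))
      (convexHull_min ?_ (convex_convexHull ℝ _))
    · obtain ⟨z, ⟨hzA, hz⟩, rfl⟩ := hV.subset_of_convexHull_eq hE (hW hw)
      refine subset_convexHull ℝ _ ⟨z, ⟨hzA, ?_⟩, rfl⟩
      rw [hval, ha0 _ (hW hw) hw, mul_zero, add_zero, hz]
    · rintro _ ⟨z, ⟨hzA, hz⟩, rfl⟩
      rw [hval] at hz
      rcases (hdom z hzA).lt_or_eq with hlt | heq
      · have h1 := ht z hzA hlt
        have h2 := neg_abs_le (a ⬝ᵥ latticePoint z + a₀)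
        nlinarith
      · refine (hin z hzA heq).2 ?_
        have : t * (a ⬝ᵥ latticePoint z + a₀) = 0 := by linarith
        exact (mul_eq_zero.1 this).resolve_left ht0'.ne'

theorem convexHull_mem_coherentSubdivision_of_subset {d : ℕ} {A : Set (Fin d → ℝ)}
    (hA : IsCompact A) {h : (Fin d → ℤ) → ℤ} {V W : Finset (Fin d → ℝ)}
    (hV : IsSimplexVertexSet V)
    (hC : convexHull ℝ (V : Set (Fin d → ℝ)) ∈ coherentSubdivision A h) (hW : W ⊆ V)
    (hne : W.Nonempty) : convexHull ℝ (W : Set (Fin d → ℝ)) ∈ coherentSubdivision A h := by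
  obtain ⟨c, b, hdom, hE⟩ := exists_contactSet_of_subset hA hV hC hW
  exact ⟨hne.to_set.convexHull, c, b, hdom, hE⟩

theorem InducesCentralTriangulation.exists_zero_mem {d : ℕ} {A : Set (Fin d → ℝ)}
    (hA : IsCompact A) {h : (Fin d → ℤ) → ℤ} (hh : InducesCentralTriangulation A h)
    {C : Set (Fin d → ℝ)} (hC : C ∈ coherentSubdivision A h) :
    ∃ V : Finset (Fin d → ℝ), IsSimplexVertexSet V ∧ 0 ∈ V ∧
      convexHull ℝ (V : Set (Fin d → ℝ)) ∈ coherentSubdivision A h ∧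
      C ⊆ convexHull ℝ (V : Set (Fin d → ℝ)) := by
  obtain ⟨C', hCC', hmax⟩ := (finite_coherentSubdivision hA h).exists_le_maximal hC
  have h0 := hh.central C' hmax
  obtain ⟨V, hV, rfl⟩ := hh.simplex C' hmax.prop
  exact ⟨V, hV, extremePoints_convexHull_subset h0, hmax.prop, hCC'⟩

/-! ### The boundary complex of a central triangulation -/

theorem centroid_id_eq_smul_sum {F : Type*} [AddCommGroup F] [Module ℝ F] {V : Finset F}
    (hV : V.Nonempty) : V.centroid ℝ id = (V.card : ℝ)⁻¹ • ∑ n ∈ V, n := by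
  rw [Finset.centroid_eq_centerMass _ hV, Finset.centerMass_eq_of_sum_1]
  · simp [Finset.smul_sum]
  · exact Finset.sum_centroidWeights_eq_one_of_nonempty ℝ V hV

theorem dotProduct_sum_smul {d : ℕ} {ι : Type*} (m : Fin d → ℝ) (s : Finset ι) (t : ι → ℝ)
    (f : ι → Fin d → ℝ) : m ⬝ᵥ (∑ i ∈ s, t i • f i) = ∑ i ∈ s, t i * (m ⬝ᵥ f i) := by
  rw [dotProduct_sum]; simp only [dotProduct_smul, smul_eq_mul]

/-- The properties of the restriction `K` of a central coherent triangulation to the boundary of a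
polytope with dual `B`: it is a simplicial complex, its simplices lie in faces of the polytope, the
cones over its simplices cover the space, and there is a convex function on the space whose domains
of linearity are the cones over the maximal simplices. -/
structure IsCentralBoundaryComplex {d : ℕ} (B : Set (Fin d → ℝ)) (K : Finset (Finset (Fin d → ℝ))) :
    Prop where
  nonempty : ∀ V ∈ K, V.Nonempty
  down_closed : ∀ V ∈ K, ∀ W ⊆ V, W.Nonempty → W ∈ K
  support : ∀ V ∈ K, ∃ m ∈ B, ∀ n ∈ V, m ⬝ᵥ n = 1
  linearIndep : ∀ V ∈ K, ∀ t : (Fin d → ℝ) → ℝ, ∑ n ∈ V, t n • n = 0 → ∀ n ∈ V, t n = 0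
  cover : ∀ x ≠ 0, ∃ V ∈ K, ∃ t : (Fin d → ℝ) → ℝ, (∀ n ∈ V, 0 < t n) ∧ x = ∑ n ∈ V, t n • n
  mem_dual_iff : ∀ m, m ∈ B ↔ ∀ V ∈ K, ∀ n ∈ V, m ⬝ᵥ n ≤ 1
  convex : ∃ φ : (Fin d → ℝ) → ℝ, ∀ V ∈ K, ∃ c : Fin d → ℝ, ∀ W ∈ K, ∀ n ∈ W,
    c ⬝ᵥ n ≤ φ n ∧ (c ⬝ᵥ n = φ n ↔ n ∈ V)

section

variable {d : ℕ} {A : Set (Fin d → ℝ)} {h : (Fin d → ℤ) → ℤ}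

theorem subset_latticePoint_of_mem_boundaryTriangulation {V : Finset (Fin d → ℝ)}
    (hV : V ∈ boundaryTriangulation A h) :
    (V : Set (Fin d → ℝ)) ⊆ latticePoint '' {z | latticePoint z ∈ A} := by
  obtain ⟨hs, ⟨-, c, b, -, hE⟩, -⟩ := hV
  exact (hs.subset_of_convexHull_eq hE).trans (image_mono fun z hz => hz.1)

theorem finite_boundaryTriangulation (hA : IsCompact A) : (boundaryTriangulation A h).Finite := by
  have hfin := (finite_latticePoint_mem hA).image latticePoint
  refine ((hfin.toFinset.powerset : Finset _).finite_toSet).subset fun V hV => ?_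
  simp only [Finset.coe_powerset, Set.Finite.coe_toFinset, mem_preimage, mem_powerset_iff]
  exact subset_latticePoint_of_mem_boundaryTriangulation hV

theorem mem_boundaryTriangulation_of_subset (hA : IsCompact A) {V W : Finset (Fin d → ℝ)}
    (hV : V ∈ boundaryTriangulation A h) (hW : W ⊆ V) (hne : W.Nonempty) :
    W ∈ boundaryTriangulation A h := by
  obtain ⟨hs, hC, hf⟩ := hV
  refine ⟨⟨hne, hs.2.mono hW⟩, convexHull_mem_coherentSubdivision_of_subset hA hs hC hW hne,
    (convexHull_mono ?_).trans hf⟩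
  exact hW

/-- A functional supporting the body at the centroid is at most 1 at each vertex and at least 1 on
average, hence 1 at all of them. -/
theorem exists_support_of_mem_boundaryTriangulation (hA : IsLatticeBody A)
    {V : Finset (Fin d → ℝ)} (hV : V ∈ boundaryTriangulation A h) :
    ∃ m ∈ dualPolytope A, ∀ n ∈ V, m ⬝ᵥ n = 1 := by
  have hVA : ∀ n ∈ V, n ∈ A := fun n hn => by
    obtain ⟨z, hz, rfl⟩ := subset_latticePoint_of_mem_boundaryTriangulation hV hn
    exact hz
  obtain ⟨⟨hne, -⟩, -, hf⟩ := hV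
  have hc := hf (V.centroid_mem_convexHull hne)
  obtain ⟨m, hm, hm1, -⟩ := exists_mem_dualPolytope_eq_one hA.convex hA.zero_mem_interior hc.2
  refine ⟨m, hm, ?_⟩
  have hcard : (0 : ℝ) < V.card := by exact_mod_cast hne.card_pos
  have hid : Finset.centroid ℝ V id = (V.card : ℝ)⁻¹ • ∑ n ∈ V, n := centroid_id_eq_smul_sum hne
  rw [hid, dotProduct_smul, smul_eq_mul, dotProduct_sum, le_inv_mul_iff₀ hcard, mul_one] at hm1
  have hle : ∀ n ∈ V, 0 ≤ 1 - m ⬝ᵥ n := fun n hn => by linarith [hm n (hVA n hn)]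
  have hsum : ∑ n ∈ V, (1 - m ⬝ᵥ n) = 0 := by
    refine le_antisymm ?_ (Finset.sum_nonneg hle)
    rw [Finset.sum_sub_distrib]
    simp only [Finset.sum_const, nsmul_eq_mul, mul_one]
    linarith
  intro n hn
  linarith [(Finset.sum_eq_zero_iff_of_nonneg hle).1 hsum n hn]

theorem zero_notMem_convexHull_of_mem_boundaryTriangulation (hA : IsLatticeBody A)
    {V : Finset (Fin d → ℝ)} (hV : V ∈ boundaryTriangulation A h) :
    (0 : Fin d → ℝ) ∉ convexHull ℝ (V : Set (Fin d → ℝ)) := fun h0 =>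
  (hV.2.2 h0).2 hA.zero_mem_interior

theorem exists_smul_mem_diff_interior (hA : IsLatticeBody A) {x : Fin d → ℝ} (hx : x ≠ 0) :
    ∃ s : ℝ, 0 < s ∧ s • x ∈ A ∧ s • x ∉ interior A := by
  obtain ⟨R, hR⟩ := hA.isCompact.isBounded.exists_norm_le
  have hc : Continuous fun s : ℝ => s • x := by fun_prop
  have hx0 := norm_pos_iff.2 hx
  have hbd : ∀ s : ℝ, s • x ∈ A → s ≤ R / ‖x‖ := fun s hs => by
    have := hR _ hs
    rw [norm_smul, Real.norm_eq_abs] at this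
    rw [le_div_iff₀ hx0]
    exact (mul_le_mul_of_nonneg_right (le_abs_self s) hx0.le).trans this
  have h0A : (0 : ℝ) • x ∈ interior A := by rw [zero_smul]; exact hA.zero_mem_interior
  have hlarger : ∀ s : ℝ, s • x ∈ interior A → ∃ r > s, r • x ∈ A := fun s hs => by
    have hev := ((hc.tendsto s).eventually (mem_interior_iff_mem_nhds.1 hs)).filter_mono
      (nhdsWithin_le_nhds (s := Ioi s))
    obtain ⟨r, hr, hr'⟩ := (hev.and self_mem_nhdsWithin).exists
    exact ⟨r, hr', hr⟩
  obtain ⟨s, ⟨hs1, hs2⟩, hs3⟩ := ((isCompact_Icc (a := (0 : ℝ)) (b := R / ‖x‖)).inter_right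
    (hA.isCompact.isClosed.preimage hc)).exists_isMaxOn
    ⟨0, ⟨⟨le_rfl, hbd 0 (interior_subset h0A)⟩,
      (interior_subset h0A : (0 : ℝ) • x ∈ A)⟩⟩ continuous_id.continuousOn
  have hmax : ∀ r : ℝ, 0 ≤ r → r • x ∈ A → r ≤ s := fun r hr hrA => hs3 ⟨⟨hr, hbd r hrA⟩, hrA⟩
  refine ⟨s, ?_, hs2, fun hi => ?_⟩
  · obtain ⟨r, hr, hrA⟩ := hlarger 0 h0A
    exact lt_of_lt_of_le hr (hmax r (le_of_lt hr) hrA)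
  · obtain ⟨r, hr, hrA⟩ := hlarger s hi
    exact absurd (hmax r (hs1.1.trans (le_of_lt hr)) hrA) (not_le.2 hr)

/-- Scale `x` to the boundary and take a simplex of the triangulation that contains the scaled point
and has 0 as a vertex. A functional supporting the body there is 1 at all vertices of positive
weight, so these span a boundary simplex; in particular 0 is not among them. -/
theorem exists_mem_boundaryTriangulation_cone (hA : IsLatticeBody A)
    (hh : InducesCentralTriangulation A h) {x : Fin d → ℝ} (hx : x ≠ 0) :
    ∃ V ∈ boundaryTriangulation A h, ∃ t : (Fin d → ℝ) → ℝ,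
      (∀ n ∈ V, 0 < t n) ∧ x = ∑ n ∈ V, t n • n := by
  classical
  obtain ⟨s, hs, hsA, hsi⟩ := exists_smul_mem_diff_interior hA hx
  obtain ⟨C, hC, hxC⟩ := exists_mem_coherentSubdivision hA h hsA
  obtain ⟨V, hV, hV0, hVC, hCV⟩ := hh.exists_zero_mem hA.isCompact hC
  obtain ⟨t, ht0, ht1, ht⟩ := Finset.mem_convexHull'.1 (hCV hxC)
  obtain ⟨m, hm, -, hm1⟩ := exists_mem_dualPolytope_eq_one hA.convex hA.zero_mem_interior hsi
  have hVA : ∀ n ∈ V, n ∈ A := fun n hn => by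
    obtain ⟨-, c, b, -, hE⟩ := hVC
    obtain ⟨z, hz, rfl⟩ := hV.subset_of_convexHull_eq hE hn
    exact hz.1
  have hnn : ∀ n ∈ V, 0 ≤ t n * (1 - m ⬝ᵥ n) := fun n hn =>
    mul_nonneg (ht0 n hn) (by linarith [hm n (hVA n hn)])
  have hsum : ∑ n ∈ V, t n * (1 - m ⬝ᵥ n) = 0 := by
    have := hm1 hsA
    rw [← ht, dotProduct_sum_smul] at this
    simp only [mul_sub, mul_one, Finset.sum_sub_distrib, ht1, this, sub_self]
  have hz := (Finset.sum_eq_zero_iff_of_nonneg hnn).1 hsum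
  set W := V.filter fun n => 0 < t n with hW
  have hWV : W ⊆ V := Finset.filter_subset _ _
  have hW1 : ∀ n ∈ W, m ⬝ᵥ n = 1 := fun n hn => by
    obtain ⟨h1, h2⟩ := Finset.mem_filter.1 hn
    have := (mul_eq_zero.1 (hz n h1)).resolve_left h2.ne'
    linarith
  have hsW : ∑ n ∈ W, t n • n = s • x := by
    rw [← ht]
    refine Finset.sum_subset hWV fun n hn hnW => ?_
    have : t n = 0 := le_antisymm (not_lt.1 fun h => hnW (Finset.mem_filter.2 ⟨hn, h⟩)) (ht0 n hn)
    rw [this, zero_smul]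
  have hWne : W.Nonempty := by
    rw [Finset.nonempty_iff_ne_empty]
    intro h
    rw [h, Finset.sum_empty] at hsW
    exact smul_ne_zero hs.ne' hx hsW.symm
  refine ⟨W, ⟨⟨hWne, hV.2.mono hWV⟩,
    convexHull_mem_coherentSubdivision_of_subset hA.isCompact hV hVC hWV hWne, fun y hy => ?_⟩,
    fun n => s⁻¹ * t n, fun n hn => ?_, ?_⟩
  · have hyA : y ∈ A := convexHull_min (fun n hn => hVA n (hWV hn)) hA.convex hy
    refine mem_frontier_of_dotProduct_eq_one hm hyA ?_
    have : convexHull ℝ (W : Set (Fin d → ℝ)) ⊆ {y | dotCLM m y = 1} :=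
      convexHull_min hW1 (convex_hyperplane (dotCLM m).isLinear 1)
    exact this hy
  · have := (Finset.mem_filter.1 hn).2
    positivity
  · simp only [mul_smul, ← Finset.smul_sum]
    rw [hsW, inv_smul_smul₀ hs.ne']

theorem exists_isCentralBoundaryComplex (hA : IsLatticeBody A)
    (hh : InducesCentralTriangulation A h) :
    ∃ K : Finset (Finset (Fin d → ℝ)), (K : Set (Finset (Fin d → ℝ))) = boundaryTriangulation A h ∧
      IsCentralBoundaryComplex (dualPolytope A) K := by
  classical
  set K := (finite_boundaryTriangulation (h := h) hA.isCompact).toFinset with hK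
  have hKmem : ∀ V, V ∈ K ↔ V ∈ boundaryTriangulation A h := fun V => Set.Finite.mem_toFinset _
  have hcov : ∀ x : Fin d → ℝ, x ≠ 0 → ∃ V ∈ K, ∃ t : (Fin d → ℝ) → ℝ,
      (∀ n ∈ V, 0 < t n) ∧ x = ∑ n ∈ V, t n • n := fun x hx => by
    obtain ⟨V, hV, h⟩ := exists_mem_boundaryTriangulation_cone hA hh hx
    exact ⟨V, (hKmem V).2 hV, h⟩
  have hsupp : ∀ V ∈ K, ∃ m ∈ dualPolytope A, ∀ n ∈ V, m ⬝ᵥ n = 1 := fun V hV =>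
    exists_support_of_mem_boundaryTriangulation hA ((hKmem V).1 hV)
  refine ⟨K, Set.Finite.coe_toFinset _, ⟨fun V hV => ((hKmem V).1 hV).1.1, fun V hV W hW hne => ?_,
    hsupp, fun V hV t ht => ?_, hcov, fun m => ⟨fun hm V hV n hn => ?_, fun hm n hn => ?_⟩, ?_⟩⟩
  · exact (hKmem W).2 (mem_boundaryTriangulation_of_subset hA.isCompact ((hKmem V).1 hV) hW hne)
  · obtain ⟨m, -, hm⟩ := hsupp V hV
    have hsum : ∑ n ∈ V, t n = 0 := by
      have := congrArg (fun x => m ⬝ᵥ x) ht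
      simp only [dotProduct_sum_smul, dotProduct_zero] at this
      rw [← this]
      exact Finset.sum_congr rfl fun n hn => by rw [hm n hn, mul_one]
    have := affineIndependent_iff.1 ((hKmem V).1 hV).1.2 Finset.univ (fun n => t n)
      (by rw [← hsum]; exact Finset.sum_coe_sort V t)
      (by rw [← ht]; exact Finset.sum_coe_sort V fun n => t n • n)
    exact fun n hn => this ⟨n, hn⟩ (Finset.mem_univ _)
  · obtain ⟨z, hz, rfl⟩ := subset_latticePoint_of_mem_boundaryTriangulation ((hKmem V).1 hV) hn
    exact hm _ hz
  · rcases eq_or_ne n 0 with rfl | hn0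
    · simp
    obtain ⟨V, hV, t, ht, rfl⟩ := hcov n hn0
    obtain ⟨m', hm', hm'1⟩ := hsupp V hV
    have h1 := hm' _ hn
    rw [dotProduct_sum_smul] at h1 ⊢
    refine le_trans (Finset.sum_le_sum fun n hn => ?_) h1
    rw [hm'1 n hn]
    exact mul_le_mul_of_nonneg_left (hm V hV n hn) (ht n hn).le
  -- The floor only recovers the integer coordinates of a lattice point. Upper hulls are concave,
  -- hence the minus sign. Subtracting from `h 0` makes the affine functions that touch at the
  -- origin linear.
  · refine ⟨fun x => h 0 - h fun i => ⌊x i⌋, fun V hV => ?_⟩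
    have hφ : ∀ z : Fin d → ℤ, (fun i => ⌊latticePoint z i⌋) = z := fun z => by
      funext i; simp [latticePoint]
    have hVb := (hKmem V).1 hV
    obtain ⟨V', hV's, hV'0, hV'C, hsub⟩ := hh.exists_zero_mem hA.isCompact hVb.2.1
    have hVV' := subset_of_convexHull_subset_of_mem_coherentSubdivision hVb.1 hV's hVb.2.1 hV'C hsub
    -- Centrality makes the cone over `V` with apex 0 a cell as well. Its affine function touches
    -- the heights at 0 and on `V`, and at no other vertex of the complex.
    have hW : insert 0 V ⊆ V' := Finset.insert_subset hV'0 hVV'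
    obtain ⟨c, b, hdom, hE⟩ := exists_contactSet_of_subset hA.isCompact hV's hV'C hW
    have hWs : IsSimplexVertexSet (insert 0 V) := ⟨Finset.insert_nonempty _ _, hV's.2.mono hW⟩
    have hWC := convexHull_mem_coherentSubdivision_of_subset hA.isCompact hV's hV'C hW hWs.1
    have hWE := hWs.subset_of_convexHull_eq hE
    have hl0 : latticePoint (0 : Fin d → ℤ) = 0 := by funext i; simp [latticePoint]
    have hcontact : ∀ z : Fin d → ℤ, latticePoint z ∈ insert 0 V →
        (h z : ℝ) = c ⬝ᵥ latticePoint z + b := fun z hz => by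
      obtain ⟨w, hw, hwz⟩ := hWE hz
      rw [latticePoint_injective hwz] at hw
      exact hw.2
    have hb : (h 0 : ℝ) = b := by
      have := hcontact 0 (by rw [hl0]; exact Finset.mem_insert_self _ _)
      rw [this, hl0]; simp
    refine ⟨-c, fun W hWK n hn => ?_⟩
    have hWb := (hKmem W).1 hWK
    obtain ⟨z, hz, rfl⟩ := subset_latticePoint_of_mem_boundaryTriangulation hWb hn
    beta_reduce
    rw [hφ, neg_dotProduct, hb]
    refine ⟨by linarith [hdom z hz], fun heq => ?_, fun hzV => ?_⟩
    · have hzb := mem_boundaryTriangulation_of_subset hA.isCompact hWb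
        (Finset.singleton_subset_iff.2 hn) (Finset.singleton_nonempty _)
      have hmem : latticePoint z ∈ convexHull ℝ ((insert 0 V : Finset _) : Set (Fin d → ℝ)) := by
        rw [hE]
        exact subset_convexHull ℝ _ ⟨z, ⟨hz, by linarith⟩, rfl⟩
      have := subset_of_convexHull_subset_of_mem_coherentSubdivision hzb.1 hWs hzb.2.1 hWC
        (by simpa using hmem)
      have hzin := this (Finset.mem_singleton_self _)
      refine (Finset.mem_insert.1 hzin).resolve_left fun h0 => ?_
      exact zero_notMem_convexHull_of_mem_boundaryTriangulation hA hWb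
        (h0 ▸ subset_convexHull ℝ _ hn)
    · linarith [hcontact z (Finset.mem_insert_of_mem hzV)]

end

/-! ### Chains of finite sets and functionals selecting them -/

theorem IsChain.exists_top {α : Type*} {D : Finset (Finset α)}
    (hD : IsChain (· ⊆ ·) (D : Set (Finset α))) (hne : D.Nonempty) : ∃ V ∈ D, ∀ σ ∈ D, σ ⊆ V := by
  obtain ⟨V, hV, hmax⟩ := D.exists_max_image Finset.card hne
  refine ⟨V, hV, fun σ hσ => ?_⟩
  rcases hD.total hσ hV with h | h
  · exact h
  · exact (Finset.eq_of_subset_of_card_le h (hmax σ hσ)).symm.subset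

theorem IsChain.exists_bot {α : Type*} {D : Finset (Finset α)}
    (hD : IsChain (· ⊆ ·) (D : Set (Finset α))) (hne : D.Nonempty) : ∃ V ∈ D, ∀ σ ∈ D, V ⊆ σ := by
  obtain ⟨V, hV, hmin⟩ := D.exists_min_image Finset.card hne
  refine ⟨V, hV, fun σ hσ => ?_⟩
  rcases hD.total hV hσ with h | h
  · exact h
  · exact (Finset.eq_of_subset_of_card_le h (hmin σ hσ)).symm.subset

section ChainFunctional

variable {α : Type*} [DecidableEq α]

/-- The number of members of `D` that do not contain `n`. -/
def chainRank (D : Finset (Finset α)) (n : α) : ℕ := (D.filter fun σ => n ∉ σ).card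

theorem chainRank_lt {D : Finset (Finset α)} (hD : IsChain (· ⊆ ·) (D : Set (Finset α)))
    {σ : Finset α} (hσ : σ ∈ D) {x y : α} (hx : x ∈ σ) (hy : y ∉ σ) :
    chainRank D x < chainRank D y := by
  refine Finset.card_lt_card (Finset.ssubset_iff_of_subset ?_ |>.2 ⟨σ, ?_, ?_⟩)
  · intro σ' hσ'
    obtain ⟨h1, h2⟩ := Finset.mem_filter.1 hσ'
    refine Finset.mem_filter.2 ⟨h1, fun h3 => ?_⟩
    rcases hD.total hσ h1 with h | h
    · exact h2 (h hx)
    · exact hy (h h3)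
  · exact Finset.mem_filter.2 ⟨hσ, hy⟩
  · exact fun h => (Finset.mem_filter.1 h).2 hx

theorem exists_separating_of_chainRank_lt {D : Finset (Finset α)} {x y : α}
    (h : chainRank D x < chainRank D y) : ∃ σ ∈ D, x ∈ σ ∧ y ∉ σ := by
  by_contra! hcon
  refine absurd h (not_lt.2 (Finset.card_le_card fun σ hσ => ?_))
  obtain ⟨h1, h2⟩ := Finset.mem_filter.1 hσ
  exact Finset.mem_filter.2 ⟨h1, fun h3 => h2 (hcon σ h1 h3)⟩

/-- Weight of the comparison of two elements by the chain `D`. -/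
def chainCompare (D : Finset (Finset α)) (x y : α) : ℝ :=
  if chainRank D y < chainRank D x then 2 else if chainRank D x = chainRank D y then 1 else 0

theorem chainCompare_nonneg (D : Finset (Finset α)) (x y : α) : 0 ≤ chainCompare D x y := by
  unfold chainCompare; split_ifs <;> norm_num

theorem chainCompare_add_swap (D : Finset (Finset α)) (x y : α) :
    chainCompare D x y + chainCompare D y x = 2 := by
  unfold chainCompare
  rcases lt_trichotomy (chainRank D x) (chainRank D y) with h | h | h
  · simp [h, h.not_gt, h.ne]
  · simp [h]; norm_num
  · simp [h, h.not_gt, h.ne]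

theorem chainCompare_eq_zero_iff (D : Finset (Finset α)) (x y : α) :
    chainCompare D x y = 0 ↔ chainRank D x < chainRank D y := by
  unfold chainCompare
  split_ifs with h1 h2
  · simp [h1.le]
  · simp [h2]
  · simp; omega

theorem sum_sum_chainCompare (D : Finset (Finset α)) (τ : Finset α) :
    ∑ x ∈ τ, ∑ y ∈ τ, chainCompare D x y = (τ.card : ℝ) ^ 2 := by
  have h : ∑ x ∈ τ, ∑ y ∈ τ, chainCompare D x y + ∑ x ∈ τ, ∑ y ∈ τ, chainCompare D x y =
      2 * (τ.card : ℝ) ^ 2 := by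
    nth_rewrite 2 [Finset.sum_comm]
    rw [← Finset.sum_add_distrib]
    simp_rw [← Finset.sum_add_distrib, chainCompare_add_swap]
    simp; ring
  linarith

/-- Comparisons of two elements of `τ` add up to `|τ| ^ 2`, whatever the chain, because the two
orders of a pair contribute 2 together. What is left are comparisons of `τ` with its complement in
`V`. They are nonnegative, and all vanish exactly when `τ` precedes its complement in the preorder
of `D`, that is, when `τ` belongs to `D`. -/
theorem chain_functional {D : Finset (Finset α)} (hD : IsChain (· ⊆ ·) (D : Set (Finset α)))
    {V : Finset α} (hV : V ∈ D) (hsub : ∀ σ ∈ D, σ ⊆ V) {τ : Finset α} (hτ : τ ⊆ V)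
    (hne : τ.Nonempty) :
    ∑ x ∈ τ, -∑ y ∈ V, chainCompare D x y ≤ -(τ.card : ℝ) ^ 2 ∧
      (∑ x ∈ τ, -∑ y ∈ V, chainCompare D x y = -(τ.card : ℝ) ^ 2 ↔ τ ∈ D) := by
  have key : ∑ x ∈ τ, -∑ y ∈ V, chainCompare D x y =
      -(τ.card : ℝ) ^ 2 - ∑ x ∈ τ, ∑ y ∈ V \ τ, chainCompare D x y := by
    rw [← sum_sum_chainCompare D τ, Finset.sum_neg_distrib, ← Finset.sum_neg_distrib,
      ← Finset.sum_neg_distrib, ← Finset.sum_sub_distrib]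
    refine Finset.sum_congr rfl fun x _ => ?_
    rw [← Finset.sum_sdiff hτ]; ring
  have hnn : ∀ x ∈ τ, 0 ≤ ∑ y ∈ V \ τ, chainCompare D x y := fun x _ =>
    Finset.sum_nonneg fun y _ => chainCompare_nonneg D x y
  have hiff : ∑ x ∈ τ, ∑ y ∈ V \ τ, chainCompare D x y = 0 ↔
      ∀ x ∈ τ, ∀ y ∈ V \ τ, chainRank D x < chainRank D y := by
    rw [Finset.sum_eq_zero_iff_of_nonneg hnn]
    refine forall₂_congr fun x _ => ?_
    rw [Finset.sum_eq_zero_iff_of_nonneg fun y _ => chainCompare_nonneg D x y]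
    exact forall₂_congr fun y _ => chainCompare_eq_zero_iff D x y
  rw [key]
  refine ⟨by linarith [Finset.sum_nonneg hnn], ?_⟩
  rw [sub_eq_self, hiff]
  constructor
  · intro h
    by_cases hVτ : (V \ τ).Nonempty
    -- A member of `D` that separates the last element of `τ` from the first element outside must be
    -- `τ` itself.
    · obtain ⟨x, hx, hxmax⟩ := τ.exists_max_image (chainRank D) hne
      obtain ⟨y, hy, hymin⟩ := (V \ τ).exists_min_image (chainRank D) hVτ
      obtain ⟨σ, hσ, hxσ, hyσ⟩ := exists_separating_of_chainRank_lt (h x hx y hy)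
      have : τ = σ := by
        refine Finset.Subset.antisymm (fun m hm => ?_) (fun m hm => ?_)
        · by_contra hmσ
          exact absurd (hxmax m hm) (not_le.2 (chainRank_lt hD hσ hxσ hmσ))
        · by_contra hmτ
          exact absurd (hymin m (Finset.mem_sdiff.2 ⟨hsub σ hσ hm, hmτ⟩))
            (not_le.2 (chainRank_lt hD hσ hm hyσ))
      rwa [this]
    · rw [Finset.not_nonempty_iff_eq_empty, Finset.sdiff_eq_empty_iff_subset] at hVτ
      rwa [Finset.Subset.antisymm hτ hVτ]
  · intro h x hx y hy
    exact chainRank_lt hD h hx (Finset.mem_sdiff.1 hy).2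

/-- A positive function on a finite set is a positive combination of the indicator functions of a
chain of subsets. -/
theorem exists_chain_decomposition (V : Finset α) : V.Nonempty → ∀ t : α → ℝ, (∀ n ∈ V, 0 < t n) →
    ∃ (D : Finset (Finset α)) (c : Finset α → ℝ), V ∈ D ∧
      IsChain (· ⊆ ·) (D : Set (Finset α)) ∧ (∀ τ ∈ D, τ.Nonempty ∧ τ ⊆ V) ∧ (∀ τ ∈ D, 0 < c τ) ∧
      ∀ n ∈ V, t n = ∑ τ ∈ D, if n ∈ τ then c τ else 0 := by
  induction V using Finset.strongInduction with
  | H V ih =>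
  intro hV t ht
  -- Peel off the minimum times the indicator of `V`. The difference is positive on the smaller set
  -- `V'` and zero on the rest of `V`.
  obtain ⟨n₀, hn₀, hmin⟩ := V.exists_min_image t hV
  set V' := V.filter fun n => t n₀ < t n with hV'
  have hV'V : V' ⊂ V := Finset.filter_ssubset.2 ⟨n₀, hn₀, lt_irrefl _⟩
  have hout : ∀ n ∈ V, n ∉ V' → t n = t n₀ := fun n hn hn' =>
    le_antisymm (not_lt.1 fun h => hn' (Finset.mem_filter.2 ⟨hn, h⟩)) (hmin n hn)
  by_cases hne : V'.Nonempty
  · obtain ⟨D, c, hVD, hch, hsub, hpos, hdec⟩ := ih V' hV'V hne (fun n => t n - t n₀)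
      fun n hn => sub_pos.2 (Finset.mem_filter.1 hn).2
    have hVnot : V ∉ D := fun h => hV'V.not_subset (hsub V h).2
    have hDV : ∀ τ ∈ D, τ ≠ V := fun τ hτ h => hVnot (h ▸ hτ)
    refine ⟨insert V D, fun τ => if τ = V then t n₀ else c τ, Finset.mem_insert_self _ _, ?_,
      fun τ hτ => ?_, fun τ hτ => ?_, fun n hn => ?_⟩
    · rw [Finset.coe_insert]
      exact hch.insert fun τ hτ _ => Or.inr ((hsub τ hτ).2.trans hV'V.subset)
    · rcases Finset.mem_insert.1 hτ with rfl | h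
      · exact ⟨hV, subset_rfl⟩
      · exact ⟨(hsub τ h).1, (hsub τ h).2.trans hV'V.subset⟩
    · rcases Finset.mem_insert.1 hτ with rfl | h
      · simpa using ht n₀ hn₀
      · simpa [hDV τ h] using hpos τ h
    · rw [Finset.sum_insert hVnot, if_pos hn]
      beta_reduce
      rw [if_pos rfl]
      have hcongr : ∑ τ ∈ D, (if n ∈ τ then if τ = V then t n₀ else c τ else 0) =
          ∑ τ ∈ D, if n ∈ τ then c τ else 0 :=
        Finset.sum_congr rfl fun τ hτ => by rw [if_neg (hDV τ hτ)]
      rw [hcongr]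
      by_cases hn' : n ∈ V'
      · rw [← hdec n hn']; ring
      · rw [Finset.sum_eq_zero fun τ hτ => if_neg fun h => hn' ((hsub τ hτ).2 h), add_zero,
          hout n hn hn']
  · rw [Finset.not_nonempty_iff_eq_empty] at hne
    refine ⟨{V}, fun _ => t n₀, Finset.mem_singleton_self _, by simp [IsChain], ?_, ?_, ?_⟩
    · simpa using hV
    · simpa using ht n₀ hn₀
    · intro n hn
      simpa [hn] using hout n hn (by rw [hne]; simp)

theorem sum_smul_eq_sum_chain {F : Type*} [AddCommGroup F] [Module ℝ F] {V : Finset α}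
    {D : Finset (Finset α)} {c : Finset α → ℝ} {t : α → ℝ} (hsub : ∀ τ ∈ D, τ ⊆ V)
    (ht : ∀ n ∈ V, t n = ∑ τ ∈ D, if n ∈ τ then c τ else 0) (f : α → F) :
    ∑ n ∈ V, t n • f n = ∑ τ ∈ D, c τ • ∑ n ∈ τ, f n := by
  calc ∑ n ∈ V, t n • f n = ∑ n ∈ V, ∑ τ ∈ D, if n ∈ τ then c τ • f n else 0 := by
        refine Finset.sum_congr rfl fun n hn => ?_
        rw [ht n hn, Finset.sum_smul]
        exact Finset.sum_congr rfl fun τ _ => by split_ifs <;> simp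
    _ = ∑ τ ∈ D, c τ • ∑ n ∈ τ, f n := by
        rw [Finset.sum_comm]
        refine Finset.sum_congr rfl fun τ hτ => ?_
        rw [← Finset.sum_filter, Finset.filter_mem_eq_inter, Finset.inter_eq_right.2 (hsub τ hτ),
          Finset.smul_sum]

end ChainFunctional

/-! ### Maximisers for steeply decreasing weights -/

section Hierarchical

variable {α : Type*} [DecidableEq α]

/-- Positive weights that drop by the factor `δ` when the cardinality grows. -/
structure IsHierarchical (S : Finset (Finset α)) (w : Finset α → ℝ) (δ : ℝ) : Prop where
  pos : ∀ σ ∈ S, 0 < w σ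
  le : ∀ σ ∈ S, w σ ≤ δ
  mul_le : ∀ σ ∈ S, ∀ σ' ∈ S, σ.card < σ'.card → w σ' ≤ δ * w σ

variable {S : Finset (Finset α)} {w : Finset α → ℝ} {g : α → Finset α → ℝ} {γ Γ δ : ℝ}
  {ρ : Finset α} {u : α → ℝ}

theorem sum_sdiff_mul_le {σ : Finset α} (hu : ∀ m ∈ ρ, 0 ≤ u m)
    (hγ : ∀ m ∈ ρ, m ∉ σ → γ ≤ g m σ) :
    γ * ∑ m ∈ ρ \ σ, u m ≤ ∑ m ∈ ρ \ σ, u m * g m σ := by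
  rw [Finset.mul_sum]
  refine Finset.sum_le_sum fun m hm => ?_
  obtain ⟨h1, h2⟩ := Finset.mem_sdiff.1 hm
  rw [mul_comm]
  exact mul_le_mul_of_nonneg_left (hγ m h1 h2) (hu m h1)

theorem sum_sdiff_le_mul {σ : Finset α} (hu : ∀ m ∈ ρ, 0 ≤ u m)
    (hΓ : ∀ m ∈ ρ, m ∉ σ → g m σ ≤ Γ) :
    ∑ m ∈ ρ \ σ, u m * g m σ ≤ Γ * ∑ m ∈ ρ \ σ, u m := by
  rw [Finset.mul_sum]
  refine Finset.sum_le_sum fun m hm => ?_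
  obtain ⟨h1, h2⟩ := Finset.mem_sdiff.1 hm
  rw [mul_comm Γ]
  exact mul_le_mul_of_nonneg_left (hΓ m h1 h2) (hu m h1)

/-- For incomparable `σ` and `σ'` the intersection `π` would win. The mass of `ρ` it misses is at
most the sum of the two missed masses, so its penalty is at most `w π / 4`. As `π` has smaller
cardinality, `w σ ≤ δ w π` is much smaller than what remains. The intersection is nonempty because
otherwise the total mass 1 would be missed, which is too much. -/
theorem subset_or_subset_of_isMax_aux (hdown : ∀ σ ∈ S, ∀ σ' ⊆ σ, σ'.Nonempty → σ' ∈ S)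
    (hw : IsHierarchical S w δ) (hγ : 0 < γ) (hδ : 0 < δ) (hΓ : 1 ≤ Γ) (hγ1 : γ ≤ 1)
    (hc : 8 * Γ * δ ≤ γ) (hu : ∀ m ∈ ρ, 0 ≤ u m) (hu1 : ∑ m ∈ ρ, u m = 1)
    (hg : ∀ σ ∈ S, ∀ m ∈ ρ, m ∉ σ → γ ≤ g m σ ∧ g m σ ≤ Γ) {σ σ' : Finset α}
    (hσ : σ ∈ S) (hσ' : σ' ∈ S)
    (hmax : ∀ π ∈ S, w π - ∑ m ∈ ρ \ π, u m * g m π ≤ w σ - ∑ m ∈ ρ \ σ, u m * g m σ)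
    (h1 : γ * ∑ m ∈ ρ \ σ, u m ≤ w σ) (h2 : γ * ∑ m ∈ ρ \ σ', u m ≤ w σ') :
    σ ⊆ σ' ∨ σ' ⊆ σ := by
  by_contra! hcon
  obtain ⟨hn1, hn2⟩ := hcon
  set π := σ ∩ σ' with hπ
  have hδ8 : 8 * δ ≤ γ := by nlinarith
  have hsum : ∑ m ∈ ρ \ π, u m ≤ ∑ m ∈ ρ \ σ, u m + ∑ m ∈ ρ \ σ', u m := by
    rw [hπ, Finset.sdiff_inter_distrib_right, ← Finset.sum_union_inter]
    have : 0 ≤ ∑ m ∈ (ρ \ σ) ∩ (ρ \ σ'), u m := Finset.sum_nonneg fun m hm =>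
      hu m (Finset.mem_sdiff.1 (Finset.mem_inter.1 hm).1).1
    linarith
  have hwσ := hw.le σ hσ
  have hwσ' := hw.le σ' hσ'
  have hπne : π.Nonempty := by
    rw [Finset.nonempty_iff_ne_empty]
    intro h
    rw [h, Finset.sdiff_empty, hu1] at hsum
    nlinarith
  have hπS : π ∈ S := hdown σ hσ π Finset.inter_subset_left hπne
  have hcard : π.card < σ.card := Finset.card_lt_card
    ⟨Finset.inter_subset_left, fun h => hn1 (h.trans Finset.inter_subset_right)⟩
  have hcard' : π.card < σ'.card := Finset.card_lt_card
    ⟨Finset.inter_subset_right, fun h => hn2 (h.trans Finset.inter_subset_left)⟩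
  have hw1 := hw.mul_le π hπS σ hσ hcard
  have hw2 := hw.mul_le π hπS σ' hσ' hcard'
  have hwπ := hw.pos π hπS
  have hE := sum_sdiff_le_mul (σ := π) (Γ := Γ) hu fun m hm hmπ => (hg π hπS m hm hmπ).2
  have hEσ : 0 ≤ ∑ m ∈ ρ \ σ, u m * g m σ := Finset.sum_nonneg fun m hm => by
    obtain ⟨hm1, hm2⟩ := Finset.mem_sdiff.1 hm
    exact mul_nonneg (hu m hm1) (hγ.le.trans (hg σ hσ m hm1 hm2).1)
  have hm := hmax π hπS
  have hk : γ * ∑ m ∈ ρ \ π, u m ≤ 2 * δ * w π := by nlinarith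
  have hk2 : γ * (Γ * ∑ m ∈ ρ \ π, u m) ≤ γ * (w π / 4) := by
    have : Γ * (γ * ∑ m ∈ ρ \ π, u m) ≤ Γ * (2 * δ * w π) :=
      mul_le_mul_of_nonneg_left hk (by linarith)
    nlinarith [mul_le_mul_of_nonneg_right hc hwπ.le]
  have hk3 := le_of_mul_le_mul_left hk2 hγ
  have hδ1 : δ ≤ 1 / 8 := by linarith
  nlinarith

theorem mul_sum_sdiff_le_of_isMax (hw : IsHierarchical S w δ)
    (hu : ∀ m ∈ ρ, 0 ≤ u m) (hρ : ρ ∈ S)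
    (hg : ∀ σ ∈ S, ∀ m ∈ ρ, m ∉ σ → γ ≤ g m σ ∧ g m σ ≤ Γ) {σ : Finset α} (hσ : σ ∈ S)
    (hmax : ∀ π ∈ S, w π - ∑ m ∈ ρ \ π, u m * g m π ≤ w σ - ∑ m ∈ ρ \ σ, u m * g m σ) :
    γ * ∑ m ∈ ρ \ σ, u m ≤ w σ := by
  have h := hmax ρ hρ
  rw [Finset.sdiff_self, Finset.sum_empty] at h
  have := sum_sdiff_mul_le (σ := σ) (γ := γ) hu fun m hm hmσ => (hg σ hσ m hm hmσ).1
  linarith [hw.pos ρ hρ]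

/-- By the preceding comparison with `ρ` itself, only `ρ ⊂ σ` has to be excluded; then neither set
has a penalty and `ρ` has the larger weight. -/
theorem subset_of_isMax (hdown : ∀ σ ∈ S, ∀ σ' ⊆ σ, σ'.Nonempty → σ' ∈ S)
    (hw : IsHierarchical S w δ) (hγ : 0 < γ) (hδ : 0 < δ) (hΓ : 1 ≤ Γ) (hγ1 : γ ≤ 1)
    (hc : 8 * Γ * δ ≤ γ) (hu : ∀ m ∈ ρ, 0 ≤ u m) (hu1 : ∑ m ∈ ρ, u m = 1) (hρ : ρ ∈ S)
    (hg : ∀ σ ∈ S, ∀ m ∈ ρ, m ∉ σ → γ ≤ g m σ ∧ g m σ ≤ Γ) {σ : Finset α} (hσ : σ ∈ S)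
    (hmax : ∀ π ∈ S, w π - ∑ m ∈ ρ \ π, u m * g m π ≤ w σ - ∑ m ∈ ρ \ σ, u m * g m σ) :
    σ ⊆ ρ := by
  have h := subset_or_subset_of_isMax_aux hdown hw hγ hδ hΓ hγ1 hc hu hu1 hg hσ hρ hmax
    (mul_sum_sdiff_le_of_isMax hw hu hρ hg hσ hmax)
    (by rw [Finset.sdiff_self, Finset.sum_empty, mul_zero]; exact (hw.pos ρ hρ).le)
  rcases h with h | h
  · exact h
  · by_contra hn
    have hcard : ρ.card < σ.card := Finset.card_lt_card ⟨h, hn⟩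
    have h1 := hw.mul_le ρ hρ σ hσ hcard
    have h2 := hmax ρ hρ
    rw [Finset.sdiff_self, Finset.sum_empty, Finset.sdiff_eq_empty_iff_subset.2 h,
      Finset.sum_empty] at h2
    have := hw.pos ρ hρ
    nlinarith

theorem subset_or_subset_of_isMax (hdown : ∀ σ ∈ S, ∀ σ' ⊆ σ, σ'.Nonempty → σ' ∈ S)
    (hw : IsHierarchical S w δ) (hγ : 0 < γ) (hδ : 0 < δ) (hΓ : 1 ≤ Γ) (hγ1 : γ ≤ 1)
    (hc : 8 * Γ * δ ≤ γ) (hu : ∀ m ∈ ρ, 0 ≤ u m) (hu1 : ∑ m ∈ ρ, u m = 1) (hρ : ρ ∈ S)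
    (hg : ∀ σ ∈ S, ∀ m ∈ ρ, m ∉ σ → γ ≤ g m σ ∧ g m σ ≤ Γ) {σ σ' : Finset α}
    (hσ : σ ∈ S) (hσ' : σ' ∈ S)
    (hmax : ∀ π ∈ S, w π - ∑ m ∈ ρ \ π, u m * g m π ≤ w σ - ∑ m ∈ ρ \ σ, u m * g m σ)
    (hmax' : ∀ π ∈ S, w π - ∑ m ∈ ρ \ π, u m * g m π ≤ w σ' - ∑ m ∈ ρ \ σ', u m * g m σ') :
    σ ⊆ σ' ∨ σ' ⊆ σ :=
  subset_or_subset_of_isMax_aux hdown hw hγ hδ hΓ hγ1 hc hu hu1 hg hσ hσ' hmax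
    (mul_sum_sdiff_le_of_isMax hw hu hρ hg hσ hmax)
    (mul_sum_sdiff_le_of_isMax hw hu hρ hg hσ' hmax')

/-- A triangular system of equations indexed by a chain has a nonnegative solution when the right
hand sides decrease rapidly. -/
theorem exists_solution_of_chain {v : Finset α → ℝ} (hγ : 0 < γ) (hΓ : 0 < Γ)
    (C : Finset (Finset α)) : IsChain (· ⊆ ·) (C : Set (Finset α)) → (∀ σ ∈ C, σ ⊂ ρ) →
    (∀ σ ∈ C, 0 < v σ) → (∀ σ ∈ C, ∀ σ' ∈ C, σ ⊂ σ' → 2 * Γ * v σ' ≤ γ * v σ) →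
    (∀ σ ∈ C, ∀ m ∈ ρ, m ∉ σ → γ ≤ g m σ ∧ g m σ ≤ Γ) →
    ∃ u : α → ℝ, (∀ m ∈ ρ, 0 ≤ u m) ∧ (∀ m ∈ ρ, (∀ σ ∈ C, m ∈ σ) → u m = 0) ∧
      (∀ σ ∈ C, ∑ m ∈ ρ \ σ, u m * g m σ = v σ) ∧
      ∀ m ∈ ρ, ∀ σ ∈ C, m ∉ σ → (∀ σ' ∈ C, m ∉ σ' → σ' ⊆ σ) → v σ ≤ 2 * (ρ.card * Γ) * u m := by
  induction C using Finset.strongInduction with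
  | H C ih =>
  intro hch hss hv hdrop hg
  rcases C.eq_empty_or_nonempty with rfl | hne
  · exact ⟨fun _ => 0, by simp, by simp, by simp, by simp⟩
  -- Solve for the larger sets and then correct at the least one, `σ`. The correction lives on `A`,
  -- the points outside `σ` that lie in all other members, so the other equations are unaffected.
  obtain ⟨σ, hσ, hleast⟩ := hch.exists_bot hne
  have hsub : C.erase σ ⊆ C := Finset.erase_subset _ _
  obtain ⟨u, hu0, husupp, hueq, hulow⟩ := ih (C.erase σ) (Finset.erase_ssubset hσ)
    (hch.mono (Finset.coe_subset.2 hsub)) (fun τ hτ => hss τ (hsub hτ))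
    (fun τ hτ => hv τ (hsub hτ)) (fun τ hτ τ' hτ' => hdrop τ (hsub hτ) τ' (hsub hτ'))
    (fun τ hτ => hg τ (hsub hτ))
  set A := (ρ \ σ).filter fun m => ∀ σ' ∈ C.erase σ, m ∈ σ' with hA
  have hAmem : ∀ m, m ∈ A ↔ m ∈ ρ \ σ ∧ ∀ σ' ∈ C.erase σ, m ∈ σ' := fun m => Finset.mem_filter
  have hvσ := hv σ hσ
  have hlt : ∀ σ' ∈ C.erase σ, σ ⊂ σ' := fun σ' hσ' =>
    (hleast σ' (hsub hσ')).ssubset_of_ne (Finset.ne_of_mem_erase hσ').symm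
  -- The old solution vanishes on the next member `σ₀`, so its mass outside `σ` is its mass outside
  -- `σ₀`, at most `v σ₀ / γ`. The drop from `v σ` to `v σ₀` makes its contribution to the equation
  -- of `σ` at most `v σ / 2`.
  have hAne : A.Nonempty ∧ ∑ m ∈ ρ \ σ, u m * g m σ ≤ v σ / 2 := by
    rcases (C.erase σ).eq_empty_or_nonempty with he | hne'
    · constructor
      · obtain ⟨m, hm, hmσ⟩ := Finset.exists_of_ssubset (hss σ hσ)
        exact ⟨m, (hAmem m).2 ⟨Finset.mem_sdiff.2 ⟨hm, hmσ⟩, by simp [he]⟩⟩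
      · rw [Finset.sum_eq_zero fun m hm => by
          rw [husupp m (Finset.mem_sdiff.1 hm).1 (by simp [he]), zero_mul]]
        positivity
    · obtain ⟨σ₀, hσ₀, hleast₀⟩ :=
        (hch.mono (Finset.coe_subset.2 hsub)).exists_bot hne'
      constructor
      · obtain ⟨m, hm, hmσ⟩ := Finset.exists_of_ssubset (hlt σ₀ hσ₀)
        exact ⟨m, (hAmem m).2 ⟨Finset.mem_sdiff.2 ⟨(hss σ₀ (hsub hσ₀)).subset hm, hmσ⟩,
          fun σ' hσ' => hleast₀ σ' hσ' hm⟩⟩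
      · have h1 : ∑ m ∈ ρ \ σ, u m = ∑ m ∈ ρ \ σ₀, u m := by
          refine (Finset.sum_subset (Finset.sdiff_subset_sdiff subset_rfl (hlt σ₀ hσ₀).subset)
            fun m hm hm' => ?_).symm
          have hmρ := (Finset.mem_sdiff.1 hm).1
          refine husupp m hmρ fun σ' hσ' => hleast₀ σ' hσ' ?_
          by_contra hmσ₀
          exact hm' (Finset.mem_sdiff.2 ⟨hmρ, hmσ₀⟩)
        have h2 := sum_sdiff_le_mul (σ := σ) (Γ := Γ) hu0 fun m hm hmσ => (hg σ hσ m hm hmσ).2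
        have h3 := sum_sdiff_mul_le (σ := σ₀) (γ := γ) hu0
          fun m hm hmσ => (hg σ₀ (hsub hσ₀) m hm hmσ).1
        rw [hueq σ₀ hσ₀] at h3
        rw [h1] at h2
        have h4 := hdrop σ hσ σ₀ (hsub hσ₀) (hlt σ₀ hσ₀)
        refine h2.trans (le_of_mul_le_mul_left ?_ hγ)
        nlinarith [mul_le_mul_of_nonneg_left h3 hΓ.le]
  obtain ⟨hAne, hR⟩ := hAne
  set G := ∑ m ∈ A, g m σ with hG
  have hAsub : A ⊆ ρ \ σ := Finset.filter_subset _ _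
  have hgA : ∀ m ∈ A, γ ≤ g m σ ∧ g m σ ≤ Γ := fun m hm => by
    obtain ⟨h1, h2⟩ := Finset.mem_sdiff.1 (hAsub hm)
    exact hg σ hσ m h1 h2
  have hGpos : 0 < G := Finset.sum_pos (fun m hm => hγ.trans_le (hgA m hm).1) hAne
  have hGle : G ≤ ρ.card * Γ := by
    have h1 := Finset.sum_le_card_nsmul A (fun m => g m σ) Γ fun m hm => (hgA m hm).2
    rw [nsmul_eq_mul] at h1
    have h2 : (A.card : ℝ) ≤ ρ.card := by
      exact_mod_cast Finset.card_le_card (hAsub.trans Finset.sdiff_subset)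
    exact h1.trans (mul_le_mul_of_nonneg_right h2 hΓ.le)
  set R := v σ - ∑ m ∈ ρ \ σ, u m * g m σ with hRdef
  have hRpos : v σ / 2 ≤ R := by linarith
  have hR0 : 0 < R := by linarith
  -- The remainder `R ≥ v σ / 2` is spread evenly over `A`. Since `G ≤ |ρ| Γ`, this yields the
  -- stated lower bound for the new entries.
  refine ⟨fun m => u m + if m ∈ A then R / G else 0, fun m hm => ?_, fun m hm hall => ?_,
    fun τ hτ => ?_, fun m hm τ hτ hmτ hmax => ?_⟩
  · have := hu0 m hm
    dsimp only
    split_ifs <;> positivity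
  · have hmA : m ∉ A := fun h => (Finset.mem_sdiff.1 (hAsub h)).2 (hall σ hσ)
    dsimp only
    rw [husupp m hm fun τ hτ => hall τ (hsub hτ), if_neg hmA, add_zero]
  · simp only [add_mul, Finset.sum_add_distrib]
    by_cases hτσ : τ = σ
    · subst hτσ
      have : ∑ m ∈ ρ \ τ, (if m ∈ A then R / G else 0) * g m τ = R := by
        rw [← Finset.sum_subset hAsub fun m _ hm => by rw [if_neg hm, zero_mul]]
        rw [Finset.sum_congr rfl fun m hm => by rw [if_pos hm], ← Finset.mul_sum]
        exact div_mul_cancel₀ R hGpos.ne'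
      rw [this]; simp [hRdef]
    · have hτ' : τ ∈ C.erase σ := Finset.mem_erase.2 ⟨hτσ, hτ⟩
      rw [hueq τ hτ', Finset.sum_eq_zero, add_zero]
      intro m hm
      rw [if_neg fun h => (Finset.mem_sdiff.1 hm).2 (((hAmem m).1 h).2 τ hτ'), zero_mul]
  · dsimp only
    by_cases hmA : m ∈ A
    · have hτσ : τ = σ := by
        by_contra h
        exact hmτ (((hAmem m).1 hmA).2 τ (Finset.mem_erase.2 ⟨h, hτ⟩))
      subst hτσ
      rw [if_pos hmA]
      have h1 : G * (R / G) = R := by field_simp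
      have h2 : G * (R / G) ≤ ρ.card * Γ * (R / G) :=
        mul_le_mul_of_nonneg_right hGle (by positivity)
      have h3 : 0 ≤ ρ.card * Γ * u m := by have := hu0 m hm; positivity
      nlinarith
    · rw [if_neg hmA, add_zero]
      have hτ' : τ ∈ C.erase σ := by
        refine Finset.mem_erase.2 ⟨fun h => hmA ((hAmem m).2 ⟨?_, fun σ' hσ' => ?_⟩), hτ⟩
        · exact Finset.mem_sdiff.2 ⟨hm, h ▸ hmτ⟩
        · by_contra hmσ'
          exact (hlt σ' hσ').not_subset (h ▸ hmax σ' (hsub hσ') hmσ')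
      exact hulow m hm τ hτ' hmτ fun σ' hσ' => hmax σ' (hsub hσ')

/-- Equality with `w ρ` along `C` is a triangular system for `u` with right hand sides `w σ - w ρ`.
A set `σ` outside `C` falls short: it either properly contains `ρ` and has too small a weight, or
misses a point `m` at which `u m` is bounded below in terms of a smaller member of the chain, and
then the penalty exceeds `w σ`. -/
theorem exists_barycentric_coordinates_of_chain {N : ℝ} (hS : ∀ σ ∈ S, σ.Nonempty)
    (hw : IsHierarchical S w δ) (hγ : 0 < γ) (hδ : 0 < δ) (hΓ : 1 ≤ Γ) (hγ1 : γ ≤ 1) (hN1 : 1 ≤ N)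
    (hc : 8 * (N * Γ) * δ ≤ γ) (hρN : ρ.card ≤ N) (hρ : ρ ∈ S)
    (hg : ∀ σ ∈ S, ∀ m ∈ ρ, m ∉ σ → γ ≤ g m σ ∧ g m σ ≤ Γ) {C : Finset (Finset α)}
    (hCS : C ⊆ S) (hch : IsChain (· ⊆ ·) (C : Set (Finset α))) (hρC : ρ ∈ C)
    (hCρ : ∀ σ ∈ C, σ ⊆ ρ) :
    ∃ u : α → ℝ, (∀ m ∈ ρ, 0 < u m) ∧ ∑ m ∈ ρ, u m = 1 ∧
      ∀ σ ∈ S, w σ - ∑ m ∈ ρ \ σ, u m * g m σ ≤ w ρ ∧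
        (w σ - ∑ m ∈ ρ \ σ, u m * g m σ = w ρ ↔ σ ∈ C) := by
  have hΓ0 : 0 < Γ := by linarith
  have hNΓ : 1 ≤ N * Γ := one_le_mul_of_one_le_of_one_le hN1 hΓ
  have hc1 : 8 * Γ * δ ≤ γ := by
    refine le_trans ?_ hc
    have : Γ ≤ N * Γ := le_mul_of_one_le_left hΓ0.le hN1
    nlinarith
  have hδ8 : 8 * δ ≤ 1 := by nlinarith
  have hemp : ∅ ∉ S := fun h => Finset.not_nonempty_empty (hS ∅ h)
  have hwρ := hw.pos ρ hρ
  -- The empty set is added to the chain with value 1 and coefficients 1; its equation is the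
  -- normalisation `∑ u m = 1`.
  set v : Finset α → ℝ := fun σ => if σ = ∅ then 1 else w σ - w ρ with hv
  set g' : α → Finset α → ℝ := fun m σ => if σ = ∅ then 1 else g m σ with hg'
  have hmem : ∀ σ ∈ insert ∅ (C.erase ρ), σ = ∅ ∨ (σ ≠ ∅ ∧ σ ∈ C ∧ σ ∈ S ∧ σ ⊂ ρ) := by
    intro σ hσ
    rcases Finset.mem_insert.1 hσ with h | h
    · exact Or.inl h
    · have hC := Finset.mem_of_mem_erase h
      exact Or.inr ⟨fun h => hemp (h ▸ hCS hC), hC, hCS hC,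
        (hCρ σ hC).ssubset_of_ne (Finset.ne_of_mem_erase h)⟩
  have hvlow : ∀ σ ∈ S, σ ⊂ ρ → w σ / 2 ≤ w σ - w ρ := fun σ hσ hss => by
    have h1 := hw.mul_le σ hσ ρ hρ (Finset.card_lt_card hss)
    have h2 := hw.pos σ hσ
    nlinarith
  have hch' : IsChain (· ⊆ ·) ((insert ∅ (C.erase ρ) : Finset (Finset α)) : Set (Finset α)) := by
    rw [Finset.coe_insert]
    exact (hch.mono (Finset.coe_subset.2 (Finset.erase_subset _ _))).insert
      fun τ _ _ => Or.inl (Finset.empty_subset τ)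
  obtain ⟨u, hu0, -, hueq, hulow⟩ := exists_solution_of_chain (ρ := ρ) (g := g') (v := v) hγ hΓ0
    (insert ∅ (C.erase ρ)) hch'
    (fun σ hσ => by
      rcases hmem σ hσ with rfl | h
      · exact Finset.empty_ssubset.2 (hS ρ hρ)
      · exact h.2.2.2)
    (fun σ hσ => by
      rcases hmem σ hσ with rfl | ⟨h0, -, h1, h2⟩
      · simp [hv]
      · simp only [hv, if_neg h0]
        linarith [hvlow σ h1 h2, hw.pos σ h1])
    (fun σ hσ σ' hσ' hss => by
      have hne' : σ' ≠ ∅ := fun h => Finset.not_ssubset_empty σ (h ▸ hss)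
      obtain ⟨-, -, hS', -⟩ := (hmem σ' hσ').resolve_left hne'
      simp only [hv, if_neg hne']
      rcases hmem σ hσ with rfl | ⟨h0, -, h1, h2⟩
      · rw [if_pos rfl]
        have := hw.le σ' hS'
        nlinarith
      · rw [if_neg h0]
        have k1 := hvlow σ h1 h2
        have k2 := hw.mul_le σ h1 σ' hS' (Finset.card_lt_card hss)
        have k3 := hw.pos σ h1
        have k4 : 2 * Γ * (w σ' - w ρ) ≤ 2 * Γ * (δ * w σ) :=
          mul_le_mul_of_nonneg_left (by linarith) (by linarith)
        have k5 : γ * (w σ / 2) ≤ γ * (w σ - w ρ) := mul_le_mul_of_nonneg_left k1 hγ.le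
        nlinarith [mul_le_mul_of_nonneg_right hc1 k3.le])
    (fun σ hσ m hm hmσ => by
      rcases hmem σ hσ with rfl | ⟨h0, -, h1, -⟩
      · simp only [hg', if_true]; exact ⟨hγ1, hΓ⟩
      · simp only [hg', if_neg h0]; exact hg σ h1 m hm hmσ)
  -- The set `σ` is the largest member of the enlarged chain that misses `m`; one exists because the
  -- empty set does.
  have hlow : ∀ m ∈ ρ, ∃ σ ∈ insert ∅ (C.erase ρ), m ∉ σ ∧ v σ ≤ 2 * (N * Γ) * u m := by
    intro m hm
    obtain ⟨σ, hσ, hmax⟩ := (hch'.mono (s := (((insert ∅ (C.erase ρ)).filter fun σ => m ∉ σ :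
      Finset (Finset α)) : Set (Finset α))) (Finset.coe_subset.2 (Finset.filter_subset _ _))
      ).exists_top ⟨∅, by simp⟩
    obtain ⟨h1, h2⟩ := Finset.mem_filter.1 hσ
    refine ⟨σ, h1, h2, (hulow m hm σ h1 h2 fun σ' hσ' hm' =>
      hmax σ' (Finset.mem_filter.2 ⟨hσ', hm'⟩)).trans ?_⟩
    have := hu0 m hm
    have : (ρ.card * Γ) * u m ≤ (N * Γ) * u m := by gcongr
    linarith
  have hvpos : ∀ σ ∈ insert ∅ (C.erase ρ), 0 < v σ := fun σ hσ => by
    rcases hmem σ hσ with rfl | ⟨h0, -, h1, h2⟩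
    · simp [hv]
    · simp only [hv, if_neg h0]
      linarith [hvlow σ h1 h2, hw.pos σ h1]
  have hupos : ∀ m ∈ ρ, 0 < u m := fun m hm => by
    obtain ⟨σ, hσ, -, h⟩ := hlow m hm
    have := hvpos σ hσ
    by_contra! hcon
    nlinarith
  refine ⟨u, hupos, ?_, fun σ hσ => ?_⟩
  · have := hueq ∅ (Finset.mem_insert_self _ _)
    simpa [hv, hg'] using this
  by_cases hσC : σ ∈ C
  · have : w σ - ∑ m ∈ ρ \ σ, u m * g m σ = w ρ := by
      by_cases hσρ : σ = ρ
      · rw [hσρ]; simp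
      · have h0 : σ ≠ ∅ := fun h => hemp (h ▸ hσ)
        have := hueq σ (Finset.mem_insert_of_mem (Finset.mem_erase.2 ⟨hσρ, hσC⟩))
        simp only [hv, hg', if_neg h0] at this
        linarith
    exact ⟨this.le, iff_of_true this hσC⟩
  · suffices h : w σ - ∑ m ∈ ρ \ σ, u m * g m σ < w ρ from ⟨h.le, iff_of_false h.ne hσC⟩
    by_contra! hcon
    have hE := sum_sdiff_mul_le (σ := σ) (γ := γ) hu0 fun m hm hmσ => (hg σ hσ m hm hmσ).1
    have hnn : 0 ≤ ∑ m ∈ ρ \ σ, u m := Finset.sum_nonneg fun m hm =>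
      hu0 m (Finset.mem_sdiff.1 hm).1
    have hγnn := mul_nonneg hγ.le hnn
    by_cases hρσ : ρ ⊆ σ
    · have hss : ρ ⊂ σ := hρσ.ssubset_of_ne fun h => hσC (h ▸ hρC)
      have := hw.mul_le ρ hρ σ hσ (Finset.card_lt_card hss)
      nlinarith
    -- Choose `m` outside `σ` in the least member of `C` not contained in `σ`. Every member of the
    -- chain that misses `m` is then contained in `σ`.
    · obtain ⟨π', hπ', hmin⟩ := (hch.mono (s := ((C.filter fun σ' => ¬ σ' ⊆ σ :
        Finset (Finset α)) : Set (Finset α))) (Finset.coe_subset.2 (Finset.filter_subset _ _))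
        ).exists_bot ⟨ρ, Finset.mem_filter.2 ⟨hρC, hρσ⟩⟩
      obtain ⟨hπ'C, hπ'σ⟩ := Finset.mem_filter.1 hπ'
      obtain ⟨m, hmπ', hmσ⟩ := Finset.not_subset.1 hπ'σ
      have hmρ := hCρ π' hπ'C hmπ'
      obtain ⟨π, hπ, hmπ, hvπ⟩ := hlow m hmρ
      have humle : γ * u m ≤ w σ := by
        have : u m ≤ ∑ m ∈ ρ \ σ, u m := Finset.single_le_sum (f := u)
          (fun i hi => hu0 i (Finset.mem_sdiff.1 hi).1) (Finset.mem_sdiff.2 ⟨hmρ, hmσ⟩)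
        nlinarith
      have hbound : γ * v π ≤ 2 * (N * Γ) * w σ := by
        have h1 := mul_le_mul_of_nonneg_left hvπ hγ.le
        have h2 := mul_le_mul_of_nonneg_left humle (by linarith : 0 ≤ 2 * (N * Γ))
        linarith
      rcases hmem π hπ with rfl | ⟨h0, h1, h2, h3⟩
      · simp only [hv, if_true] at hbound
        have h4 := mul_le_mul_of_nonneg_left (hw.le σ hσ) (by linarith : 0 ≤ 2 * (N * Γ))
        linarith
      · have hπσ : π ⊆ σ := by
          by_contra h
          exact hmπ (hmin π (Finset.mem_filter.2 ⟨h1, h⟩) hmπ')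
        have hss : π ⊂ σ := hπσ.ssubset_of_ne fun h => hσC (h ▸ h1)
        have h4 := hw.mul_le π h2 σ hσ (Finset.card_lt_card hss)
        have h5 := hvlow π h2 h3
        have h6 := hw.pos π h2
        simp only [hv, if_neg h0] at hbound
        have h7 := mul_le_mul_of_nonneg_left h4 (by linarith : 0 ≤ 2 * (N * Γ))
        have h8 := mul_le_mul_of_nonneg_left h5 hγ.le
        have h9 := mul_le_mul_of_nonneg_right hc h6.le
        nlinarith [mul_pos hγ h6]

end Hierarchical

/-! ### Selecting functionals and dual points for one complex -/

section

variable {d : ℕ} {B : Set (Fin d → ℝ)} {K : Finset (Finset (Fin d → ℝ))}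

theorem IsCentralBoundaryComplex.exists_dotProduct_eq (hK : IsCentralBoundaryComplex B K)
    {V : Finset (Fin d → ℝ)} (hV : V ∈ K) (a : (Fin d → ℝ) → ℝ) :
    ∃ c : Fin d → ℝ, ∀ n ∈ V, c ⬝ᵥ n = a n := by
  have hli : LinearIndependent ℝ (fun x : V => (x : Fin d → ℝ)) := by
    have := (linearIndepOn_finset_iff (v := id) (s := V) (R := ℝ)).2 (hK.linearIndep V hV)
    exact this
  obtain ⟨f, hf⟩ := LinearMap.exists_extend
    ((Module.Basis.span hli).constr ℝ fun x : V => a x)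
  obtain ⟨c, hc⟩ := exists_eq_dotCLM f
  refine ⟨c, fun n hn => ?_⟩
  have h1 : ((Module.Basis.span hli) ⟨n, hn⟩ : Fin d → ℝ) = n :=
    congrArg _ (Module.Basis.span_apply hli ⟨n, hn⟩)
  rw [← hc]
  have h2 := LinearMap.congr_fun hf ((Module.Basis.span hli) ⟨n, hn⟩)
  rw [Module.Basis.constr_basis] at h2
  rw [← h2]
  exact congrArg f h1.symm

/-- A convex function certifying that the barycentric subdivision is coherent. -/
theorem IsCentralBoundaryComplex.exists_barycentric_functional
    (hK : IsCentralBoundaryComplex B K) :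
    ∃ ω : Finset (Fin d → ℝ) → ℝ, ∀ D ⊆ K, IsChain (· ⊆ ·) (D : Set (Finset (Fin d → ℝ))) →
      D.Nonempty → ∃ u : Fin d → ℝ, ∀ τ ∈ K,
        u ⬝ᵥ (∑ n ∈ τ, n) ≤ ω τ ∧ (u ⬝ᵥ (∑ n ∈ τ, n) = ω τ ↔ τ ∈ D) := by
  classical
  obtain ⟨φ, hφ⟩ := hK.convex
  have hdata : ∀ D : Finset (Finset (Fin d → ℝ)), ∃ (V : Finset (Fin d → ℝ)) (c a : Fin d → ℝ),
      D ⊆ K → IsChain (· ⊆ ·) (D : Set (Finset (Fin d → ℝ))) → D.Nonempty →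
        V ∈ D ∧ (∀ σ ∈ D, σ ⊆ V) ∧ (∀ W ∈ K, ∀ n ∈ W, c ⬝ᵥ n ≤ φ n ∧ (c ⬝ᵥ n = φ n ↔ n ∈ V)) ∧
        ∀ n ∈ V, a ⬝ᵥ n = -∑ y ∈ V, chainCompare D n y := by
    intro D
    by_cases h : D ⊆ K ∧ IsChain (· ⊆ ·) (D : Set (Finset (Fin d → ℝ))) ∧ D.Nonempty
    · obtain ⟨h1, h2, h3⟩ := h
      obtain ⟨V, hV, htop⟩ := h2.exists_top h3
      obtain ⟨c, hc⟩ := hφ V (h1 hV)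
      obtain ⟨a, ha⟩ := hK.exists_dotProduct_eq (h1 hV) fun n => -∑ y ∈ V, chainCompare D n y
      exact ⟨V, c, a, fun _ _ _ => ⟨hV, htop, hc, ha⟩⟩
    -- Arbitrary values, so that the choice is defined for every `D`.
    · exact ⟨∅, 0, 0, fun h1 h2 h3 => absurd ⟨h1, h2, h3⟩ h⟩
  choose V c a hdata using hdata
  have hgap : ∀ D ⊆ K, IsChain (· ⊆ ·) (D : Set (Finset (Fin d → ℝ))) → D.Nonempty →
      ∀ τ ∈ K, (∀ n ∈ τ, 0 ≤ φ n - c D ⬝ᵥ n) ∧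
        (¬ τ ⊆ V D → 0 < ∑ n ∈ τ, (φ n - c D ⬝ᵥ n)) := by
    intro D hD hch hne τ hτ
    obtain ⟨-, -, hc, -⟩ := hdata D hD hch hne
    have hnn : ∀ n ∈ τ, 0 ≤ φ n - c D ⬝ᵥ n := fun n hn => sub_nonneg.2 (hc τ hτ n hn).1
    refine ⟨hnn, fun hτV => ?_⟩
    obtain ⟨n, hn, hnV⟩ := Finset.not_subset.1 hτV
    refine Finset.sum_pos' hnn ⟨n, hn, sub_pos.2 ((hc τ hτ n hn).1.lt_of_ne fun h => ?_)⟩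
    exact hnV ((hc τ hτ n hn).2.1 h)
  -- Simplices outside the top `V D` have a positive gap in the convex function. A small `κ`,
  -- uniform over the finitely many `D` and `τ`, keeps the refinement inside `V D` from spoiling it.
  have hev : ∀ᶠ κ : ℝ in nhdsWithin 0 (Ioi 0), ∀ D ∈ K.powerset, ∀ τ ∈ K,
      IsChain (· ⊆ ·) (D : Set (Finset (Fin d → ℝ))) → D.Nonempty → ¬ τ ⊆ V D →
        κ * (∑ n ∈ τ, a D ⬝ᵥ n + (τ.card : ℝ) ^ 2) < ∑ n ∈ τ, (φ n - c D ⬝ᵥ n) := by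
    rw [Filter.eventually_all_finset]
    intro D hD
    rw [Filter.eventually_all_finset]
    intro τ hτ
    by_cases h : IsChain (· ⊆ ·) (D : Set (Finset (Fin d → ℝ))) ∧ D.Nonempty ∧ ¬ τ ⊆ V D
    · obtain ⟨h1, h2, h3⟩ := h
      have hpos := (hgap D (Finset.mem_powerset.1 hD) h1 h2 τ hτ).2 h3
      have hc : Continuous fun κ : ℝ => κ * (∑ n ∈ τ, a D ⬝ᵥ n + (τ.card : ℝ) ^ 2) := by fun_prop
      filter_upwards [nhdsWithin_le_nhds ((hc.tendsto 0).eventually (gt_mem_nhds (show (0 : ℝ) *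
        (∑ n ∈ τ, a D ⬝ᵥ n + (τ.card : ℝ) ^ 2) < ∑ n ∈ τ, (φ n - c D ⬝ᵥ n) by
          rw [zero_mul]; exact hpos)))] with κ hκ _ _ _
      exact hκ
    · exact Filter.Eventually.of_forall fun κ h1 h2 h3 => absurd ⟨h1, h2, h3⟩ h
  obtain ⟨κ, hκ, hκ0⟩ := (hev.and self_mem_nhdsWithin).exists
  have hκ0' : 0 < κ := hκ0
  refine ⟨fun τ => ∑ n ∈ τ, φ n - κ * (τ.card : ℝ) ^ 2, fun D hD hch hne =>
    ⟨c D + κ • a D, fun τ hτ => ?_⟩⟩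
  obtain ⟨hV, htop, hc, ha⟩ := hdata D hD hch hne
  have hval : (c D + κ • a D) ⬝ᵥ (∑ n ∈ τ, n) =
      ∑ n ∈ τ, c D ⬝ᵥ n + κ * ∑ n ∈ τ, a D ⬝ᵥ n := by
    rw [add_dotProduct, smul_dotProduct, smul_eq_mul, dotProduct_sum, dotProduct_sum]
  rw [hval]
  by_cases hτV : τ ⊆ V D
  · have h1 : ∑ n ∈ τ, c D ⬝ᵥ n = ∑ n ∈ τ, φ n :=
      Finset.sum_congr rfl fun n hn => (hc τ hτ n hn).2.2 (hτV hn)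
    have h2 : ∑ n ∈ τ, a D ⬝ᵥ n = ∑ n ∈ τ, -∑ y ∈ V D, chainCompare D n y :=
      Finset.sum_congr rfl fun n hn => ha n (hτV hn)
    obtain ⟨h3, h4⟩ := chain_functional hch hV htop hτV (hK.nonempty τ hτ)
    rw [h1, h2, ← h4]
    refine ⟨by nlinarith, fun h => ?_, fun h => by rw [h]; ring⟩
    have : κ * (∑ n ∈ τ, -∑ y ∈ V D, chainCompare D n y) = κ * (-(τ.card : ℝ) ^ 2) := by linarith
    exact mul_left_cancel₀ hκ0'.ne' this
  · have h1 := hκ D (Finset.mem_powerset.2 hD) τ hτ hch hne hτV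
    rw [Finset.sum_sub_distrib] at h1
    have h2 : ∑ n ∈ τ, c D ⬝ᵥ n + κ * ∑ n ∈ τ, a D ⬝ᵥ n < ∑ n ∈ τ, φ n - κ * (τ.card : ℝ) ^ 2 := by
      linarith
    exact ⟨h2.le, iff_of_false h2.ne fun h => hτV (htop τ h)⟩

/-- Moving a direction by `ε • u₁` amounts to replacing `w σ` by `w σ + ε (u₁ ⬝ᵥ p σ)`. Strict
inequalities between finitely many weights survive this. -/
theorem eventually_isHierarchical {α : Type*} {S : Finset (Finset α)} {w : Finset α → ℝ} {δ : ℝ}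
    (h0 : ∀ σ ∈ S, 0 < w σ) (h1 : ∀ σ ∈ S, w σ < δ)
    (h2 : ∀ σ ∈ S, ∀ σ' ∈ S, σ.card < σ'.card → w σ' < δ * w σ) (f : Finset α → ℝ) :
    ∀ᶠ ε : ℝ in nhds 0, IsHierarchical S (fun σ => w σ + ε * f σ) δ := by
  have hc : ∀ σ, Filter.Tendsto (fun ε : ℝ => w σ + ε * f σ) (nhds 0) (nhds (w σ)) := fun σ => by
    have : Continuous fun ε : ℝ => w σ + ε * f σ := by fun_prop
    simpa using this.tendsto 0
  have e0 : ∀ᶠ ε : ℝ in nhds 0, ∀ σ ∈ S, 0 < w σ + ε * f σ :=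
    (Filter.eventually_all_finset S).2 fun σ hσ => (hc σ).eventually (lt_mem_nhds (h0 σ hσ))
  have e1 : ∀ᶠ ε : ℝ in nhds 0, ∀ σ ∈ S, w σ + ε * f σ < δ :=
    (Filter.eventually_all_finset S).2 fun σ hσ => (hc σ).eventually (gt_mem_nhds (h1 σ hσ))
  have e2 : ∀ᶠ ε : ℝ in nhds 0, ∀ σ ∈ S, ∀ σ' ∈ S, σ.card < σ'.card →
      w σ' + ε * f σ' < δ * (w σ + ε * f σ) := by
    refine (Filter.eventually_all_finset S).2 fun σ hσ =>
      (Filter.eventually_all_finset S).2 fun σ' hσ' => ?_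
    by_cases hlt : σ.card < σ'.card
    · filter_upwards [(hc σ').eventually_lt ((hc σ).const_mul δ) (h2 σ hσ σ' hσ' hlt)] with ε h _
      exact h
    · exact Filter.Eventually.of_forall fun ε h => absurd h hlt
  filter_upwards [e0, e1, e2] with ε h0 h1 h2
  exact ⟨h0, fun σ hσ => (h1 σ hσ).le, fun σ hσ σ' hσ' h => (h2 σ hσ σ' hσ' h).le⟩

/-- Points indexed by the simplices of `K` whose convex hull realizes the barycentric subdivision
of the boundary of a polytope dual to `K`, with normal fan adapted to the cones over `K`. -/
theorem IsCentralBoundaryComplex.exists_dual_points (hK : IsCentralBoundaryComplex B K) :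
    ∃ p : Finset (Fin d → ℝ) → (Fin d → ℝ),
      (∀ ρ ∈ K, ∀ t : (Fin d → ℝ) → ℝ, (∀ m ∈ ρ, 0 < t m) → ∀ σ ∈ K,
        (∀ π ∈ K, (∑ m ∈ ρ, t m • m) ⬝ᵥ p π ≤ (∑ m ∈ ρ, t m • m) ⬝ᵥ p σ) → σ ⊆ ρ ∧
          ∀ σ' ∈ K, (∀ π ∈ K, (∑ m ∈ ρ, t m • m) ⬝ᵥ p π ≤ (∑ m ∈ ρ, t m • m) ⬝ᵥ p σ') →
            σ ⊆ σ' ∨ σ' ⊆ σ) ∧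
      ∀ u₁ : Fin d → ℝ, ∀ᶠ ε : ℝ in nhds 0, ∀ ρ ∈ K, ∀ C ⊆ K,
        IsChain (· ⊆ ·) (C : Set (Finset (Fin d → ℝ))) → ρ ∈ C → (∀ σ ∈ C, σ ⊆ ρ) →
        ∃ t : (Fin d → ℝ) → ℝ, (∀ m ∈ ρ, 0 < t m) ∧ ∑ m ∈ ρ, t m = 1 ∧ ∀ σ ∈ K,
          (∑ m ∈ ρ, t m • m + ε • u₁) ⬝ᵥ p σ ≤ (∑ m ∈ ρ, t m • m + ε • u₁) ⬝ᵥ p ρ ∧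
          ((∑ m ∈ ρ, t m • m + ε • u₁) ⬝ᵥ p σ = (∑ m ∈ ρ, t m • m + ε • u₁) ⬝ᵥ p ρ ↔ σ ∈ C) := by
  classical
  obtain ⟨φ, hφ⟩ := hK.convex
  have hdata : ∀ σ : Finset (Fin d → ℝ), ∃ c n : Fin d → ℝ, σ ∈ K →
      (∀ W ∈ K, ∀ m ∈ W, c ⬝ᵥ m ≤ φ m ∧ (c ⬝ᵥ m = φ m ↔ m ∈ σ)) ∧ n ∈ B ∧
        ∀ m ∈ σ, n ⬝ᵥ m = 1 := by
    intro σ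
    by_cases hσ : σ ∈ K
    · obtain ⟨c, hc⟩ := hφ σ hσ
      obtain ⟨n, hn⟩ := hK.support σ hσ
      exact ⟨c, n, fun _ => ⟨hc, hn⟩⟩
    · exact ⟨0, 0, fun h => absurd h hσ⟩
  choose c n hdata using hdata
  have hn1 : ∀ σ ∈ K, ∀ W ∈ K, ∀ m ∈ W, n σ ⬝ᵥ m ≤ 1 := fun σ hσ =>
    (hK.mem_dual_iff _).1 (hdata σ hσ).2.1
  obtain ⟨γ, ⟨hγ, hγ1⟩, hγ0⟩ : ∃ γ : ℝ, ((∀ σ ∈ K, ∀ W ∈ K, ∀ m ∈ W, m ∉ σ →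
      γ < φ m - c σ ⬝ᵥ m) ∧ γ < 1) ∧ γ ∈ Ioi (0 : ℝ) := by
    refine Filter.Eventually.exists (f := nhdsWithin 0 (Ioi 0))
      (Filter.Eventually.and (Filter.Eventually.and ?_ ?_) self_mem_nhdsWithin)
    · refine (Filter.eventually_all_finset K).2 fun σ hσ => (Filter.eventually_all_finset K).2
        fun W hW => (Filter.eventually_all_finset W).2 fun m hm => ?_
      by_cases hmσ : m ∈ σ
      · exact Filter.Eventually.of_forall fun γ h => absurd hmσ h
      · have h := (hdata σ hσ).1 W hW m hm
        filter_upwards [nhdsWithin_le_nhds (gt_mem_nhds (sub_pos.2 (h.1.lt_of_ne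
          fun h' => hmσ (h.2.1 h'))))] with γ hγ _
        exact hγ
    · exact nhdsWithin_le_nhds (gt_mem_nhds zero_lt_one)
  -- The weights chosen below are at most 1, so this also bounds the coefficients `g`.
  obtain ⟨Γ, hΓ, hΓ1⟩ : ∃ Γ : ℝ, (∀ σ ∈ K, ∀ W ∈ K, ∀ m ∈ W,
      φ m - c σ ⬝ᵥ m + (1 - n σ ⬝ᵥ m) ≤ Γ) ∧ 1 ≤ Γ := by
    refine Filter.Eventually.exists (f := Filter.atTop)
      (Filter.Eventually.and ?_ (Filter.eventually_ge_atTop 1))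
    exact (Filter.eventually_all_finset K).2 fun σ hσ => (Filter.eventually_all_finset K).2
      fun W hW => (Filter.eventually_all_finset W).2 fun m hm => Filter.eventually_ge_atTop _
  obtain ⟨N, hN, hN1⟩ : ∃ N : ℝ, (∀ ρ ∈ K, (ρ.card : ℝ) ≤ N) ∧ 1 ≤ N := by
    refine Filter.Eventually.exists (f := Filter.atTop)
      (Filter.Eventually.and ?_ (Filter.eventually_ge_atTop 1))
    exact (Filter.eventually_all_finset K).2 fun σ hσ => Filter.eventually_ge_atTop _
  have hγ0' : 0 < γ := hγ0
  have hNΓ : 1 ≤ N * Γ := one_le_mul_of_one_le_of_one_le hN1 hΓ1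
  set δ := γ / (8 * (N * Γ)) with hδ
  have hδ0 : 0 < δ := by positivity
  have hc8 : 8 * (N * Γ) * δ = γ := by rw [hδ]; field_simp
  have hδ1 : δ ≤ 1 := by nlinarith
  have hc1 : 8 * Γ * δ ≤ γ := by
    have : Γ ≤ N * Γ := le_mul_of_one_le_left (by linarith) hN1
    nlinarith
  -- Base `δ / 2` instead of `δ` makes the hierarchy inequalities strict, which leaves room for the
  -- perturbation.
  set w : Finset (Fin d → ℝ) → ℝ := fun σ => (δ / 2) ^ σ.card with hw
  have hη0 : 0 < δ / 2 := by positivity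
  have hη1 : δ / 2 ≤ 1 := by linarith
  have hw0 : ∀ σ ∈ K, 0 < w σ := fun σ _ => pow_pos hη0 _
  have hwδ : ∀ σ ∈ K, w σ < δ := fun σ hσ => by
    have h1 : w σ ≤ (δ / 2) ^ 1 :=
      pow_le_pow_of_le_one hη0.le hη1 (hK.nonempty σ hσ).card_pos
    rw [pow_one] at h1
    linarith
  have hwmul : ∀ σ ∈ K, ∀ σ' ∈ K, σ.card < σ'.card → w σ' < δ * w σ := fun σ hσ σ' _ h => by
    have h1 : w σ' ≤ (δ / 2) ^ (σ.card + 1) := pow_le_pow_of_le_one hη0.le hη1 h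
    have h2 := hw0 σ hσ
    rw [pow_succ] at h1
    have h3 : (δ / 2) ^ σ.card * (δ / 2) = w σ * (δ / 2) := rfl
    nlinarith
  -- On σ the functional `c σ` agrees with `φ` and `n σ` is 1, so `p σ` exceeds `φ` there by exactly
  -- `w σ`. At any vertex `m` it falls short of `φ m + w σ` by `g m σ`.
  set p : Finset (Fin d → ℝ) → (Fin d → ℝ) := fun σ => c σ + w σ • n σ with hp
  set g : (Fin d → ℝ) → Finset (Fin d → ℝ) → ℝ :=
    fun m σ => φ m - c σ ⬝ᵥ m + w σ * (1 - n σ ⬝ᵥ m) with hg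
  have hg0 : ∀ σ ∈ K, ∀ m ∈ σ, g m σ = 0 := fun σ hσ m hm => by
    simp only [hg, (hdata σ hσ).2.2 m hm, (((hdata σ hσ).1 σ hσ m hm).2.2 hm)]
    ring
  have hgb : ∀ ρ ∈ K, ∀ σ ∈ K, ∀ m ∈ ρ, m ∉ σ → γ ≤ g m σ ∧ g m σ ≤ Γ := by
    intro ρ hρ σ hσ m hm hmσ
    have h1 := hγ σ hσ ρ hρ m hm hmσ
    have h2 := hΓ σ hσ ρ hρ m hm
    have h3 := hn1 σ hσ ρ hρ m hm
    have h4 := hw0 σ hσ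
    have h5 := hwδ σ hσ
    simp only [hg]
    constructor <;> nlinarith
  have hval : ∀ ρ ∈ K, ∀ t : (Fin d → ℝ) → ℝ, ∑ m ∈ ρ, t m = 1 → ∀ σ ∈ K,
      (∑ m ∈ ρ, t m • m) ⬝ᵥ p σ = ∑ m ∈ ρ, t m * φ m + (w σ - ∑ m ∈ ρ \ σ, t m * g m σ) := by
    intro ρ hρ t ht σ hσ
    have h1 : ∑ m ∈ ρ \ σ, t m * g m σ = ∑ m ∈ ρ, t m * g m σ := by
      refine Finset.sum_subset Finset.sdiff_subset fun m hm hm' => ?_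
      have hmσ : m ∈ σ := by
        by_contra h
        exact hm' (Finset.mem_sdiff.2 ⟨hm, h⟩)
      rw [hg0 σ hσ m hmσ, mul_zero]
    rw [h1, dotProduct_comm, dotProduct_sum_smul]
    have h2 : ∀ m ∈ ρ, t m * (p σ ⬝ᵥ m) = t m * φ m + t m * w σ - t m * g m σ := fun m _ => by
      simp only [hp, hg, add_dotProduct, smul_dotProduct, smul_eq_mul]
      ring
    rw [Finset.sum_congr rfl h2, Finset.sum_sub_distrib, Finset.sum_add_distrib, ← Finset.sum_mul,
      ht]
    ring
  have hhier : IsHierarchical K w δ :=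
    ⟨hw0, fun σ hσ => (hwδ σ hσ).le, fun σ hσ σ' hσ' h => (hwmul σ hσ σ' hσ' h).le⟩
  refine ⟨p, fun ρ hρ t ht => ?_, fun u₁ => ?_⟩
  · have hT : 0 < ∑ m ∈ ρ, t m := Finset.sum_pos ht (hK.nonempty ρ hρ)
    set T := ∑ m ∈ ρ, t m with hTdef
    set t' : (Fin d → ℝ) → ℝ := fun m => T⁻¹ * t m with ht'
    have ht'1 : ∑ m ∈ ρ, t' m = 1 := by
      simp only [ht']
      rw [← Finset.mul_sum]
      exact inv_mul_cancel₀ hT.ne'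
    have ht'0 : ∀ m ∈ ρ, 0 ≤ t' m := fun m hm => by have := ht m hm; positivity
    have hscale : ∑ m ∈ ρ, t m • m = T • ∑ m ∈ ρ, t' m • m := by
      simp only [ht', mul_smul, ← Finset.smul_sum]
      rw [smul_inv_smul₀ hT.ne']
    have htrans : ∀ σ ∈ K,
        (∀ π ∈ K, (∑ m ∈ ρ, t m • m) ⬝ᵥ p π ≤ (∑ m ∈ ρ, t m • m) ⬝ᵥ p σ) →
        ∀ π ∈ K, w π - ∑ m ∈ ρ \ π, t' m * g m π ≤ w σ - ∑ m ∈ ρ \ σ, t' m * g m σ := by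
      intro σ hσ hmax π hπ
      have h := hmax π hπ
      rw [hscale, smul_dotProduct, smul_dotProduct, smul_eq_mul, smul_eq_mul] at h
      have h' := le_of_mul_le_mul_left h hT
      rw [hval ρ hρ t' ht'1 π hπ, hval ρ hρ t' ht'1 σ hσ] at h'
      linarith
    intro σ hσ hmax
    refine ⟨subset_of_isMax hK.down_closed hhier hγ0' hδ0 hΓ1 hγ1.le hc1 ht'0 ht'1 hρ (hgb ρ hρ)
      hσ (htrans σ hσ hmax), fun σ' hσ' hmax' => ?_⟩
    exact subset_or_subset_of_isMax hK.down_closed hhier hγ0' hδ0 hΓ1 hγ1.le hc1 ht'0 ht'1 hρ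
      (hgb ρ hρ) hσ hσ' (htrans σ hσ hmax) (htrans σ' hσ' hmax')
  -- The perturbation is absorbed into the weights; the coefficients `g` stay as they are.
  · filter_upwards [eventually_isHierarchical hw0 hwδ hwmul fun σ => u₁ ⬝ᵥ p σ] with ε hε
    intro ρ hρ C hC hch hρC hCρ
    obtain ⟨t, ht0, ht1, ht⟩ := exists_barycentric_coordinates_of_chain hK.nonempty hε hγ0' hδ0
      hΓ1 hγ1.le hN1 hc8.le (hN ρ hρ) hρ (hgb ρ hρ) hC hch hρC hCρ
    have hval' : ∀ σ ∈ K, (∑ m ∈ ρ, t m • m + ε • u₁) ⬝ᵥ p σ = ∑ m ∈ ρ, t m * φ m +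
        (w σ + ε * (u₁ ⬝ᵥ p σ) - ∑ m ∈ ρ \ σ, t m * g m σ) := fun σ hσ => by
      rw [add_dotProduct, hval ρ hρ t ht1 σ hσ, smul_dotProduct, smul_eq_mul]
      ring
    refine ⟨t, ht0, ht1, fun σ hσ => ?_⟩
    have hρval := hval' ρ hρ
    rw [Finset.sdiff_self, Finset.sum_empty, sub_zero] at hρval
    obtain ⟨h1, h2⟩ := ht σ hσ
    rw [hval' σ hσ, hρval, ← h2]
    exact ⟨by linarith, fun h => by linarith, fun h => by linarith⟩

end

/-! ### The two summands of the Minkowski sum -/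

section

variable {d : ℕ} {Q : Set (Fin d → ℝ)} {S T : Finset (Finset (Fin d → ℝ))}

/-- Since `u` is a positive combination of vertices, `u ⬝ᵥ u ≤ 0` would follow otherwise. -/
theorem IsCentralBoundaryComplex.exists_pos (hT : IsCentralBoundaryComplex Q T)
    {u : Fin d → ℝ} (hu : u ≠ 0) : ∃ V ∈ T, ∃ n ∈ V, 0 < u ⬝ᵥ n := by
  obtain ⟨V, hV, t, ht, hut⟩ := hT.cover u hu
  refine ⟨V, hV, ?_⟩
  by_contra! hcon
  have h1 : u ⬝ᵥ u ≤ 0 := by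
    nth_rewrite 2 [hut]
    rw [dotProduct_sum_smul]
    exact Finset.sum_nonpos fun n hn => mul_nonpos_of_nonneg_of_nonpos (ht n hn).le (hcon n hn)
  have h2 : 0 ≤ u ⬝ᵥ u := dotProduct_self_star_nonneg _
  exact hu (dotProduct_self_eq_zero.1 (le_antisymm h1 h2))

theorem IsCentralBoundaryComplex.exists_barycentric_cone (hT : IsCentralBoundaryComplex Q T)
    {x : Fin d → ℝ} (hx : x ≠ 0) : ∃ (D : Finset (Finset (Fin d → ℝ)))
      (c : Finset (Fin d → ℝ) → ℝ), D ⊆ T ∧ D.Nonempty ∧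
      IsChain (· ⊆ ·) (D : Set (Finset (Fin d → ℝ))) ∧ (∀ τ ∈ D, 0 < c τ) ∧
      x = ∑ τ ∈ D, c τ • ∑ n ∈ τ, n := by
  classical
  obtain ⟨V, hV, t, ht, rfl⟩ := hT.cover x hx
  obtain ⟨D, c, hVD, hch, hsub, hpos, hdec⟩ :=
    exists_chain_decomposition V (hT.nonempty V hV) t ht
  exact ⟨D, c, fun τ hτ => hT.down_closed V hV τ (hsub τ hτ).2 (hsub τ hτ).1, ⟨V, hVD⟩, hch, hpos,
    sum_smul_eq_sum_chain (fun τ hτ => (hsub τ hτ).2) hdec fun n => n⟩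

theorem sum_dotProduct_le_card {τ : Finset (Fin d → ℝ)} {u : Fin d → ℝ}
    (h : ∀ n ∈ τ, u ⬝ᵥ n ≤ 1) : u ⬝ᵥ (∑ n ∈ τ, n) ≤ τ.card ∧
      (u ⬝ᵥ (∑ n ∈ τ, n) = τ.card → ∀ n ∈ τ, u ⬝ᵥ n = 1) := by
  have hnn : ∀ n ∈ τ, 0 ≤ 1 - u ⬝ᵥ n := fun n hn => sub_nonneg.2 (h n hn)
  have hs : ∑ n ∈ τ, (1 - u ⬝ᵥ n) = τ.card - u ⬝ᵥ (∑ n ∈ τ, n) := by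
    rw [Finset.sum_sub_distrib, dotProduct_sum]; simp
  refine ⟨by linarith [Finset.sum_nonneg hnn], fun heq n hn => ?_⟩
  have := (Finset.sum_eq_zero_iff_of_nonneg hnn).1 (by rw [hs, heq, sub_self]) n hn
  linarith

/-- After clearing the denominator the bound is the sum of `u₀ ⬝ᵥ ∑ n ≤ |τ|` and `ε` times `u₁ ⬝ᵥ ∑
n ≤ ω τ`. Equality forces equality in the second, which selects `D`. -/
theorem barycentric_perturbation_le {ω : Finset (Fin d → ℝ) → ℝ}
    {D : Finset (Finset (Fin d → ℝ))} {u₀ u₁ : Fin d → ℝ} {ε : ℝ} (hε : 0 < ε)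
    (hpos : ∀ τ ∈ T, 0 < τ.card + ε * ω τ) (hu₀ : ∀ τ ∈ T, ∀ n ∈ τ, u₀ ⬝ᵥ n ≤ 1)
    (hu₁ : ∀ τ ∈ T, u₁ ⬝ᵥ (∑ n ∈ τ, n) ≤ ω τ ∧ (u₁ ⬝ᵥ (∑ n ∈ τ, n) = ω τ ↔ τ ∈ D))
    (hD : ∀ τ ∈ D, ∀ n ∈ τ, u₀ ⬝ᵥ n = 1) {τ : Finset (Fin d → ℝ)} (hτ : τ ∈ T) :
    (u₀ + ε • u₁) ⬝ᵥ ((τ.card + ε * ω τ)⁻¹ • ∑ n ∈ τ, n) ≤ 1 ∧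
      ((u₀ + ε • u₁) ⬝ᵥ ((τ.card + ε * ω τ)⁻¹ • ∑ n ∈ τ, n) = 1 ↔ τ ∈ D) := by
  have hp := hpos τ hτ
  obtain ⟨h1, h2⟩ := hu₁ τ hτ
  have h3 := (sum_dotProduct_le_card (hu₀ τ hτ)).1
  rw [dotProduct_smul, smul_eq_mul, inv_mul_le_iff₀ hp, inv_mul_eq_iff_eq_mul₀ hp.ne', mul_one,
    add_dotProduct, smul_dotProduct, smul_eq_mul]
  have h4 := mul_le_mul_of_nonneg_left h1 hε.le
  refine ⟨by linarith, fun heq => h2.1 ?_, fun hτD => ?_⟩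
  · have : ε * (u₁ ⬝ᵥ ∑ n ∈ τ, n) = ε * ω τ := by linarith
    exact mul_left_cancel₀ hε.ne' this
  · rw [h2.2 hτD, dotProduct_sum, Finset.sum_congr rfl (hD τ hτD)]
    simp

/-- Points `p σ` and `q τ` such that the faces of the Minkowski sum of their convex hulls are
indexed by the pairs of chains of `S` and `T` on which the pairing is identically `1`. -/
theorem exists_minkowski_points (hS : IsCentralBoundaryComplex Q S)
    (hT : IsCentralBoundaryComplex (dualPolytope Q) T)
    (hSQ : ∀ σ ∈ S, ∀ m ∈ σ, m ∈ dualPolytope Q) :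
    ∃ p q : Finset (Fin d → ℝ) → (Fin d → ℝ),
      (∀ u ≠ 0,
        (∀ σ ∈ S, (∀ π ∈ S, u ⬝ᵥ p π ≤ u ⬝ᵥ p σ) → ∀ σ' ∈ S, (∀ π ∈ S, u ⬝ᵥ p π ≤ u ⬝ᵥ p σ') →
          σ ⊆ σ' ∨ σ' ⊆ σ) ∧
        (∀ τ ∈ T, (∀ π ∈ T, u ⬝ᵥ q π ≤ u ⬝ᵥ q τ) → ∀ τ' ∈ T, (∀ π ∈ T, u ⬝ᵥ q π ≤ u ⬝ᵥ q τ') →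
          τ ⊆ τ' ∨ τ' ⊆ τ) ∧
        (∀ σ ∈ S, (∀ π ∈ S, u ⬝ᵥ p π ≤ u ⬝ᵥ p σ) → ∀ τ ∈ T, (∀ π ∈ T, u ⬝ᵥ q π ≤ u ⬝ᵥ q τ) →
          ∀ m ∈ σ, ∀ n ∈ τ, m ⬝ᵥ n = 1)) ∧
      ∀ C ⊆ S, ∀ D ⊆ T, IsChain (· ⊆ ·) (C : Set (Finset (Fin d → ℝ))) →
        IsChain (· ⊆ ·) (D : Set (Finset (Fin d → ℝ))) → C.Nonempty → D.Nonempty →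
        (∀ σ ∈ C, ∀ τ ∈ D, ∀ m ∈ σ, ∀ n ∈ τ, m ⬝ᵥ n = 1) →
        ∃ u ≠ 0, (∀ σ ∈ S, σ ∈ C ↔ ∀ π ∈ S, u ⬝ᵥ p π ≤ u ⬝ᵥ p σ) ∧
          ∀ τ ∈ T, τ ∈ D ↔ ∀ π ∈ T, u ⬝ᵥ q π ≤ u ⬝ᵥ q τ := by
  classical
  obtain ⟨p, hp1, hp2⟩ := hS.exists_dual_points
  obtain ⟨ω, hω⟩ := hT.exists_barycentric_functional
  have hdata : ∀ D : Finset (Finset (Fin d → ℝ)), ∃ u₁ : Fin d → ℝ, D ⊆ T →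
      IsChain (· ⊆ ·) (D : Set (Finset (Fin d → ℝ))) → D.Nonempty → ∀ τ ∈ T,
        u₁ ⬝ᵥ (∑ n ∈ τ, n) ≤ ω τ ∧ (u₁ ⬝ᵥ (∑ n ∈ τ, n) = ω τ ↔ τ ∈ D) := by
    intro D
    by_cases h : D ⊆ T ∧ IsChain (· ⊆ ·) (D : Set (Finset (Fin d → ℝ))) ∧ D.Nonempty
    · obtain ⟨u₁, hu₁⟩ := hω D h.1 h.2.1 h.2.2
      exact ⟨u₁, fun _ _ _ => hu₁⟩
    · exact ⟨0, fun h1 h2 h3 => absurd ⟨h1, h2, h3⟩ h⟩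
  choose u₁ hu₁ using hdata
  set q : ℝ → Finset (Fin d → ℝ) → (Fin d → ℝ) :=
    fun ε τ => (τ.card + ε * ω τ)⁻¹ • ∑ n ∈ τ, n with hq
  have hSle : ∀ σ ∈ S, ∀ m ∈ σ, ∀ τ ∈ T, ∀ n ∈ τ, m ⬝ᵥ n ≤ 1 := fun σ hσ m hm =>
    (hT.mem_dual_iff m).1 (hSQ σ hσ m hm)
  have hsing : ∀ τ ∈ T, ∀ n ∈ τ, {n} ∈ T := fun τ hτ n hn =>
    hT.down_closed τ hτ _ (Finset.singleton_subset_iff.2 hn) (Finset.singleton_nonempty n)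
  -- compatibility for small `ε`
  have hcompat : ∀ᶠ ε : ℝ in nhds 0, ∀ σ ∈ S, ∀ τ ∈ T, (¬ ∀ m ∈ σ, ∀ n ∈ τ, m ⬝ᵥ n = 1) →
      ∀ u : Fin d → ℝ, u ≠ 0 → (∀ π ∈ S, u ⬝ᵥ p π ≤ u ⬝ᵥ p σ) →
        ∃ π ∈ T, u ⬝ᵥ q ε τ < u ⬝ᵥ q ε π := by
    refine (Filter.eventually_all_finset S).2 fun σ hσ => (Filter.eventually_all_finset T).2
      fun τ hτ => ?_
    by_cases hστ : ∀ m ∈ σ, ∀ n ∈ τ, m ⬝ᵥ n = 1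
    · exact Filter.Eventually.of_forall fun ε h => absurd hστ h
    -- Unit directions in the normal cone of `p σ` form a compact set. A strict inequality at `ε =
    -- 0` near each of them therefore holds uniformly for small `ε`.
    have hcpt : IsCompact (Metric.sphere (0 : Fin d → ℝ) 1 ∩
        {u | ∀ π ∈ S, u ⬝ᵥ p π ≤ u ⬝ᵥ p σ}) := by
      refine (isCompact_sphere 0 1).inter_right ?_
      have : {u : Fin d → ℝ | ∀ π ∈ S, u ⬝ᵥ p π ≤ u ⬝ᵥ p σ} =
          ⋂ π ∈ S, {u | u ⬝ᵥ p π ≤ u ⬝ᵥ p σ} := by ext; simp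
      rw [this]
      exact isClosed_biInter fun π _ => isClosed_le (continuous_id.dotProduct continuous_const)
        (continuous_id.dotProduct continuous_const)
    have hloc : ∀ u ∈ Metric.sphere (0 : Fin d → ℝ) 1 ∩ {u | ∀ π ∈ S, u ⬝ᵥ p π ≤ u ⬝ᵥ p σ},
        ∀ᶠ z : ℝ × (Fin d → ℝ) in nhds (0, u), ∃ π ∈ T, z.2 ⬝ᵥ q z.1 τ < z.2 ⬝ᵥ q z.1 π := by
      rintro u ⟨hu1, hu2⟩
      have hu0 : u ≠ 0 := fun h => by simp [h] at hu1
      obtain ⟨π, hπ, hlt⟩ : ∃ π ∈ T, u ⬝ᵥ q 0 τ < u ⬝ᵥ q 0 π := by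
        -- For `ε = 0` the points are true barycenters and, for singletons, the vertices. If `u` is
        -- maximal at the barycenter of `τ` with value `M`, then `u / M` lies in Δ and equals 1 on
        -- all of `τ`.
        by_contra! hcon
        have hM : ∀ V ∈ T, ∀ n ∈ V, u ⬝ᵥ n ≤ u ⬝ᵥ q 0 τ := fun V hV n hn => by
          have := hcon {n} (hsing V hV n hn)
          simpa [hq] using this
        set M := u ⬝ᵥ q 0 τ with hMdef
        obtain ⟨V, hV, n₀, hn₀, hpos⟩ := hT.exists_pos hu0
        have hM0 : 0 < M := hpos.trans_le (hM V hV n₀ hn₀)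
        have hv : ∀ V ∈ T, ∀ n ∈ V, (M⁻¹ • u) ⬝ᵥ n ≤ 1 := fun V hV n hn => by
          rw [smul_dotProduct, smul_eq_mul, inv_mul_le_iff₀ hM0, mul_one]
          exact hM V hV n hn
        have hvQ : M⁻¹ • u ∈ dualPolytope Q := (hT.mem_dual_iff _).2 hv
        have hcard : (0 : ℝ) < τ.card := by exact_mod_cast (hT.nonempty τ hτ).card_pos
        have hvτ : ∀ n ∈ τ, (M⁻¹ • u) ⬝ᵥ n = 1 := by
          refine (sum_dotProduct_le_card (hv τ hτ)).2 ?_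
          rw [smul_dotProduct, smul_eq_mul, inv_mul_eq_iff_eq_mul₀ hM0.ne', hMdef]
          simp only [hq, zero_mul, add_zero, dotProduct_smul, smul_eq_mul]
          field_simp
        -- A functional supporting `ρ` shows that the weights of `u` on `ρ` add up to at most `M`.
        -- They must also average pairings at most 1 to the value `M`, so all pairings of `ρ` with
        -- `τ` are 1, and `σ ⊆ ρ`.
        obtain ⟨ρ, hρ, t, ht, hut⟩ := hS.cover u hu0
        obtain ⟨n', hn', hn'1⟩ := hS.support ρ hρ
        have hsum : ∑ m ∈ ρ, t m ≤ M := by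
          have h1 := hvQ n' hn'
          rw [smul_dotProduct, smul_eq_mul, inv_mul_le_iff₀ hM0, mul_one, dotProduct_comm, hut,
            dotProduct_sum_smul] at h1
          refine le_trans (Finset.sum_le_sum fun m hm => ?_) h1
          rw [hn'1 m hm, mul_one]
        have hρτ : ∀ m ∈ ρ, ∀ n ∈ τ, m ⬝ᵥ n = 1 := by
          intro m hm n hn
          have h1 := hvτ n hn
          rw [smul_dotProduct, smul_eq_mul, inv_mul_eq_iff_eq_mul₀ hM0.ne', mul_one,
            dotProduct_comm, hut, dotProduct_sum_smul] at h1
          have hnn : ∀ m ∈ ρ, 0 ≤ t m * (1 - n ⬝ᵥ m) := fun m hm =>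
            mul_nonneg (ht m hm).le (by
              have := hSle ρ hρ m hm τ hτ n hn
              rw [dotProduct_comm] at this
              linarith)
          have hz : ∑ m ∈ ρ, t m * (1 - n ⬝ᵥ m) = 0 := by
            refine le_antisymm ?_ (Finset.sum_nonneg hnn)
            simp only [mul_sub, mul_one, Finset.sum_sub_distrib]
            linarith
          have := ((mul_eq_zero.1 ((Finset.sum_eq_zero_iff_of_nonneg hnn).1 hz m hm)).resolve_left
            (ht m hm).ne')
          rw [dotProduct_comm]
          linarith
        have hsub := (hp1 ρ hρ t ht σ hσ (hut ▸ hu2)).1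
        exact hστ fun m hm n hn => hρτ m (hsub hm) n hn
      have hcont : ∀ π ∈ T, ContinuousAt (fun z : ℝ × (Fin d → ℝ) => z.2 ⬝ᵥ q z.1 π) (0, u) := by
        intro π hπ
        have hcard : (π.card : ℝ) + ((0, u) : ℝ × (Fin d → ℝ)).1 * ω π ≠ 0 := by
          have : π.card ≠ 0 := (hT.nonempty π hπ).card_pos.ne'
          simpa using this
        simp only [hq, dotProduct_smul, smul_eq_mul]
        refine ContinuousAt.mul (ContinuousAt.inv₀ ?_ hcard) ?_
        · exact (continuous_const.add (continuous_fst.mul continuous_const)).continuousAt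
        · exact (continuous_snd.dotProduct continuous_const).continuousAt
      filter_upwards [(hcont τ hτ).eventually_lt (hcont π hπ) hlt] with z hz
      exact ⟨π, hπ, hz⟩
    filter_upwards [hcpt.eventually_forall_of_forall_eventually (P := fun ε u =>
      ∃ π ∈ T, u ⬝ᵥ q ε τ < u ⬝ᵥ q ε π) hloc] with ε hε _ u hu0 hu
    have hn := norm_pos_iff.2 hu0
    obtain ⟨π, hπ, hlt⟩ := hε (‖u‖⁻¹ • u) ⟨by
      rw [mem_sphere_zero_iff_norm, norm_smul, norm_inv, norm_norm, inv_mul_cancel₀ hn.ne'],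
      fun π hπ => by
        rw [smul_dotProduct, smul_dotProduct]
        exact smul_le_smul_of_nonneg_left (hu π hπ) (by positivity)⟩
    rw [smul_dotProduct, smul_dotProduct] at hlt
    exact ⟨π, hπ, lt_of_smul_lt_smul_left hlt (by positivity)⟩
  have hposε : ∀ᶠ ε : ℝ in nhds 0, ∀ τ ∈ T, 0 < τ.card + ε * ω τ := by
    refine (Filter.eventually_all_finset T).2 fun τ hτ => ?_
    have hc : Continuous fun ε : ℝ => (τ.card : ℝ) + ε * ω τ := by fun_prop
    refine (hc.tendsto 0).eventually (lt_mem_nhds ?_)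
    have := (hT.nonempty τ hτ).card_pos
    simpa using this
  have hchain := (Filter.eventually_all_finset T.powerset).2 fun D _ => hp2 (u₁ D)
  obtain ⟨ε, ⟨⟨hε1, hε2⟩, hε3⟩, hε0⟩ := (((hcompat.and hposε).and hchain).filter_mono
    (nhdsWithin_le_nhds (s := Ioi 0)) |>.and self_mem_nhdsWithin).exists
  have hε : 0 < ε := hε0
  refine ⟨p, q ε, fun u hu => ⟨?_, ?_, ?_⟩, ?_⟩
  · intro σ hσ hmax σ' hσ' hmax'
    obtain ⟨ρ, hρ, t, ht, rfl⟩ := hS.cover u hu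
    exact (hp1 ρ hρ t ht σ hσ hmax).2 σ' hσ' hmax'
  · intro τ hτ hmax τ' hτ' hmax'
    set M := u ⬝ᵥ q ε τ with hM
    have hM' : u ⬝ᵥ q ε τ' = M := le_antisymm (hmax τ' hτ') (hmax' τ hτ)
    have hM0 : 0 < M := by
      obtain ⟨V, hV, n, hn, hpos⟩ := hT.exists_pos hu
      have h1 := hmax {n} (hsing V hV n hn)
      refine lt_of_lt_of_le ?_ h1
      have := hε2 {n} (hsing V hV n hn)
      simp only [hq, dotProduct_smul, smul_eq_mul, Finset.sum_singleton]
      positivity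
    -- The sum of two maximisers lies in the cone over a barycentric chain `D`. Maximality of `M`
    -- makes its coefficients in the points of `D` add up to at least 2, so the functional selecting
    -- `D`, at most 1 on every `q`, is 1 at both points. Both simplices thus belong to `D`.
    have hx : q ε τ + q ε τ' ≠ 0 := fun h => by
      have h1 : u ⬝ᵥ (q ε τ + q ε τ') = M + M := by rw [dotProduct_add, hM']
      rw [h, dotProduct_zero] at h1
      linarith
    obtain ⟨D, c, hDT, hDne, hch, hc, hxc⟩ := hT.exists_barycentric_cone hx
    obtain ⟨V, hV, htop⟩ := hch.exists_top hDne
    obtain ⟨u₀, hu₀Q, hu₀⟩ := hT.support V (hDT hV)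
    have hU := fun π (hπ : π ∈ T) => barycentric_perturbation_le hε hε2
      ((hT.mem_dual_iff u₀).1 hu₀Q) (hu₁ D hDT hch hDne) (fun π hπ n hn => hu₀ n (htop π hπ hn)) hπ
    have hbq : ∀ π ∈ D, ∑ n ∈ π, n = (π.card + ε * ω π) • q ε π := fun π hπ => by
      simp only [hq]
      rw [smul_inv_smul₀ (hε2 π (hDT hπ)).ne']
    have hxc' : q ε τ + q ε τ' = ∑ π ∈ D, (c π * (π.card + ε * ω π)) • q ε π := by
      rw [hxc]
      exact Finset.sum_congr rfl fun π hπ => by rw [hbq π hπ, smul_smul]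
    have hc'0 : ∀ π ∈ D, 0 < c π * (π.card + ε * ω π) := fun π hπ =>
      mul_pos (hc π hπ) (hε2 π (hDT hπ))
    have h1 : (u₀ + ε • u₁ D) ⬝ᵥ (q ε τ + q ε τ') = ∑ π ∈ D, c π * (π.card + ε * ω π) := by
      rw [hxc', dotProduct_sum_smul]
      exact Finset.sum_congr rfl fun π hπ => by rw [(hU π (hDT hπ)).2.2 hπ, mul_one]
    have h2 : M + M ≤ M * ∑ π ∈ D, c π * (π.card + ε * ω π) := by
      have : u ⬝ᵥ (q ε τ + q ε τ') = M + M := by rw [dotProduct_add, hM']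
      rw [← this, hxc', dotProduct_sum_smul, Finset.mul_sum]
      refine Finset.sum_le_sum fun π hπ => ?_
      rw [mul_comm M]
      exact mul_le_mul_of_nonneg_left (hmax π (hDT hπ)) (hc'0 π hπ).le
    have h3 : 2 ≤ ∑ π ∈ D, c π * (π.card + ε * ω π) := by
      refine le_of_mul_le_mul_left ?_ hM0
      linarith
    rw [← h1, dotProduct_add] at h3
    have h4 := hU τ hτ
    have h5 := hU τ' hτ'
    have h6 : τ ∈ D := h4.2.1 (le_antisymm h4.1 (by
      have := h5.1
      simp only [hq] at h3
      linarith))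
    have h7 : τ' ∈ D := h5.2.1 (le_antisymm h5.1 (by
      have := h4.1
      simp only [hq] at h3
      linarith))
    exact hch.total h6 h7
  · intro σ hσ hmax τ hτ hmax'
    by_contra hcon
    obtain ⟨π, hπ, hlt⟩ := hε1 σ hσ τ hτ hcon u hu hmax
    exact absurd (hmax' π hπ) (not_le.2 hlt)
  · intro C hC D hD hCch hDch hCne hDne hCD
    obtain ⟨ρ, hρ, hρtop⟩ := hCch.exists_top hCne
    obtain ⟨t, ht, ht1, hCval⟩ := hε3 D (Finset.mem_powerset.2 hD) ρ (hC hρ) C hC hCch hρ hρtop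
    have hpair : ∀ n, (∑ m ∈ ρ, t m • m) ⬝ᵥ n = ∑ m ∈ ρ, t m * (m ⬝ᵥ n) := fun n => by
      rw [dotProduct_comm, dotProduct_sum_smul]
      exact Finset.sum_congr rfl fun m _ => by rw [dotProduct_comm]
    have hU := fun π (hπ : π ∈ T) => barycentric_perturbation_le (u₀ := ∑ m ∈ ρ, t m • m) hε hε2
      (fun τ hτ n hn => by
        rw [hpair, ← ht1]
        refine Finset.sum_le_sum fun m hm => ?_
        exact mul_le_of_le_one_right (ht m hm).le (hSle ρ (hC hρ) m hm τ hτ n hn))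
      (hu₁ D hD hDch hDne) (fun τ hτ n hn => by
        rw [hpair, ← ht1]
        exact Finset.sum_congr rfl fun m hm => by rw [hCD ρ hρ τ hτ m hm n hn, mul_one]) hπ
    obtain ⟨τ₀, hτ₀⟩ := hDne
    -- The first summand has total weight 1 on `ρ`, so it pairs to 1 with the vertices of `D` and to
    -- at most 1 with all others. The second selects `D` among the `q`, and `t` was solved with it
    -- included so that `C` is selected among the `p`.
    refine ⟨∑ m ∈ ρ, t m • m + ε • u₁ D, fun h => ?_, fun σ hσ => ?_, fun τ hτ => ?_⟩
    · have := (hU τ₀ (hD hτ₀)).2.2 hτ₀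
      rw [h, zero_dotProduct] at this
      exact zero_ne_one this
    · rw [← (hCval σ hσ).2]
      exact ⟨fun h π hπ => h ▸ (hCval π hπ).1,
        fun h => le_antisymm (hCval σ hσ).1 (h ρ (hC hρ))⟩
    · rw [← (hU τ hτ).2]
      constructor
      · intro h π hπ
        have := (hU π hπ).1
        rw [← h] at this
        exact this
      · intro h
        refine le_antisymm (hU τ hτ).1 ?_
        rw [← (hU τ₀ (hD hτ₀)).2.2 hτ₀]
        exact h τ₀ (hD hτ₀)

end

/-! ### Barycentric subdivision of one boundary complex -/

/-- The barycenter of a finite set of points. -/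
noncomputable def barycenter {d : ℕ} (V : Finset (Fin d → ℝ)) : Fin d → ℝ := V.centroid ℝ id

theorem dotProduct_barycenter {d : ℕ} {V : Finset (Fin d → ℝ)} (hV : V.Nonempty) (u : Fin d → ℝ) :
    u ⬝ᵥ barycenter V = (V.card : ℝ)⁻¹ * (u ⬝ᵥ ∑ n ∈ V, n) := by
  rw [barycenter, centroid_id_eq_smul_sum hV, dotProduct_smul, smul_eq_mul]

theorem dotProduct_barycenter_le {d : ℕ} {V : Finset (Fin d → ℝ)} (hV : V.Nonempty) {u : Fin d → ℝ}
    (h : ∀ n ∈ V, u ⬝ᵥ n ≤ 1) :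
    u ⬝ᵥ barycenter V ≤ 1 ∧ (u ⬝ᵥ barycenter V = 1 ↔ ∀ n ∈ V, u ⬝ᵥ n = 1) := by
  have hc : (0 : ℝ) < V.card := by exact_mod_cast hV.card_pos
  obtain ⟨h1, h2⟩ := sum_dotProduct_le_card h
  rw [dotProduct_barycenter hV, inv_mul_le_iff₀ hc, mul_one, inv_mul_eq_iff_eq_mul₀ hc.ne', mul_one]
  refine ⟨h1, h2, fun h3 => ?_⟩
  rw [dotProduct_sum, Finset.sum_congr rfl h3]
  simp

section

variable {d : ℕ} {B : Set (Fin d → ℝ)} {K : Finset (Finset (Fin d → ℝ))}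

theorem IsCentralBoundaryComplex.exists_barycenter_functional (hK : IsCentralBoundaryComplex B K) :
    ∃ ω : Finset (Fin d → ℝ) → ℝ, ∀ D ⊆ K, IsChain (· ⊆ ·) (D : Set (Finset (Fin d → ℝ))) →
      D.Nonempty → ∃ u : Fin d → ℝ, ∀ τ ∈ K,
        u ⬝ᵥ barycenter τ ≤ ω τ ∧ (u ⬝ᵥ barycenter τ = ω τ ↔ τ ∈ D) := by
  obtain ⟨ω, hω⟩ := hK.exists_barycentric_functional
  refine ⟨fun τ => (τ.card : ℝ)⁻¹ * ω τ, fun D hD hch hne => ?_⟩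
  obtain ⟨u, hu⟩ := hω D hD hch hne
  refine ⟨u, fun τ hτ => ?_⟩
  have hc : (0 : ℝ) < (τ.card : ℝ)⁻¹ := by
    have := (hK.nonempty τ hτ).card_pos
    positivity
  rw [dotProduct_barycenter (hK.nonempty τ hτ), ← (hu τ hτ).2]
  exact ⟨mul_le_mul_of_nonneg_left (hu τ hτ).1 hc.le, mul_right_inj' hc.ne'⟩

/-- Let `u` and `u'` select `L` and `L'` against the same `ω`. Then `u - u'` is nonnegative on the
hull of `L` and nonpositive on that of `L'`, where it vanishes only on the hull of the common
members. At a common point it is zero. -/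
theorem IsCentralBoundaryComplex.mem_convexHull_barycenter_inter
    (hK : IsCentralBoundaryComplex B K) {L L' : Finset (Finset (Fin d → ℝ))} (hL : L ⊆ K)
    (hL' : L' ⊆ K) (hLc : IsChain (· ⊆ ·) (L : Set (Finset (Fin d → ℝ))))
    (hLc' : IsChain (· ⊆ ·) (L' : Set (Finset (Fin d → ℝ)))) {x : Fin d → ℝ}
    (hx : x ∈ convexHull ℝ (barycenter '' (L : Set (Finset (Fin d → ℝ)))))
    (hx' : x ∈ convexHull ℝ (barycenter '' (L' : Set (Finset (Fin d → ℝ))))) :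
    x ∈ convexHull ℝ (barycenter '' ((L : Set (Finset (Fin d → ℝ))) ∩ L')) := by
  obtain ⟨ω, hω⟩ := hK.exists_barycenter_functional
  have hne : L.Nonempty := by
    have := convexHull_nonempty_iff.1 ⟨x, hx⟩
    simpa using this
  have hne' : L'.Nonempty := by
    have := convexHull_nonempty_iff.1 ⟨x, hx'⟩
    simpa using this
  obtain ⟨u, hu⟩ := hω L hL hLc hne
  obtain ⟨u', hu'⟩ := hω L' hL' hLc' hne'
  have h1 := mem_convexHull_image_of_le (I := L') (J := L) (f := barycenter)
    (l := (dotCLM (u - u')).toLinearMap) (M := 0) (fun τ hτ => by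
      simp only [ContinuousLinearMap.coe_coe, dotCLM_apply, sub_dotProduct]
      linarith [(hu τ (hL' hτ)).1, (hu' τ (hL' hτ)).2.2 hτ]) (fun τ hτ h => by
      simp only [ContinuousLinearMap.coe_coe, dotCLM_apply, sub_dotProduct] at h
      exact (hu τ (hL' hτ)).2.1 (by linarith [(hu' τ (hL' hτ)).2.2 hτ])) hx'
  have h2 := mem_convexHull_image_of_le (I := L) (J := L') (f := barycenter)
    (l := (dotCLM (u' - u)).toLinearMap) (M := 0) (fun τ hτ => by
      simp only [ContinuousLinearMap.coe_coe, dotCLM_apply, sub_dotProduct]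
      linarith [(hu' τ (hL hτ)).1, (hu τ (hL hτ)).2.2 hτ]) (fun τ hτ h => by
      simp only [ContinuousLinearMap.coe_coe, dotCLM_apply, sub_dotProduct] at h
      exact (hu' τ (hL hτ)).2.1 (by linarith [(hu τ (hL hτ)).2.2 hτ])) hx
  refine h1.2 (le_antisymm h1.1 ?_)
  have := h2.1
  simp only [ContinuousLinearMap.coe_coe, dotCLM_apply, sub_dotProduct] at this ⊢
  linarith

theorem IsCentralBoundaryComplex.exists_exposing_functional
    (hK : IsCentralBoundaryComplex B K) {L L' : Finset (Finset (Fin d → ℝ))} (hL : L ⊆ K)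
    (hL' : L' ⊆ L) (hLc : IsChain (· ⊆ ·) (L : Set (Finset (Fin d → ℝ)))) (hne : L'.Nonempty) :
    ∃ f : Fin d → ℝ, ∀ x ∈ convexHull ℝ (barycenter '' (L : Set (Finset (Fin d → ℝ)))),
      f ⬝ᵥ x ≤ 0 ∧
        (f ⬝ᵥ x = 0 ↔ x ∈ convexHull ℝ (barycenter '' (L' : Set (Finset (Fin d → ℝ))))) := by
  obtain ⟨ω, hω⟩ := hK.exists_barycenter_functional
  obtain ⟨u, hu⟩ := hω L hL hLc (hne.mono hL')
  obtain ⟨u', hu'⟩ := hω L' (hL'.trans hL) (hLc.mono (Finset.coe_subset.2 hL')) hne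
  refine ⟨u' - u, fun x hx => ?_⟩
  have h2 := mem_convexHull_image_of_le (I := L) (J := L') (f := barycenter)
    (l := (dotCLM (u' - u)).toLinearMap) (M := 0) (fun τ hτ => by
      simp only [ContinuousLinearMap.coe_coe, dotCLM_apply, sub_dotProduct]
      linarith [(hu' τ (hL hτ)).1, (hu τ (hL hτ)).2.2 hτ]) (fun τ hτ h => by
      simp only [ContinuousLinearMap.coe_coe, dotCLM_apply, sub_dotProduct] at h
      exact (hu' τ (hL hτ)).2.1 (by linarith [(hu τ (hL hτ)).2.2 hτ])) hx
  refine ⟨h2.1, fun h => convexHull_mono (image_mono inter_subset_left) (h2.2 h), fun h => ?_⟩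
  have hz : convexHull ℝ (barycenter '' (L' : Set (Finset (Fin d → ℝ)))) ⊆
      {y | dotCLM (u' - u) y = 0} := by
    refine convexHull_min ?_ (convex_hyperplane (dotCLM (u' - u)).isLinear 0)
    rintro _ ⟨τ, hτ, rfl⟩
    have h3 := (hu τ (hL (hL' hτ))).2.2 (hL' hτ)
    have h4 := (hu' τ (hL (hL' hτ))).2.2 hτ
    simp only [mem_ofPred_eq, dotCLM_apply, sub_dotProduct]
    linarith
  exact hz h

/-- Write `x` in the cone over a barycentric chain. A functional supporting the top simplex bounds
the total weight by 1, and `y₀` shows that it is 1. Any `y` with value 1 at `x` then averages values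
at most 1 to 1, so it is 1 on every vertex involved. -/
theorem IsCentralBoundaryComplex.exists_chain_mem_convexHull (hK : IsCentralBoundaryComplex B K)
    {x y₀ : Fin d → ℝ} (hx : ∀ y ∈ B, y ⬝ᵥ x ≤ 1) (hy₀ : y₀ ∈ B) (hy₀x : y₀ ⬝ᵥ x = 1) :
    ∃ D ⊆ K, D.Nonempty ∧ IsChain (· ⊆ ·) (D : Set (Finset (Fin d → ℝ))) ∧
      x ∈ convexHull ℝ (barycenter '' (D : Set (Finset (Fin d → ℝ)))) ∧
      ∀ y ∈ B, y ⬝ᵥ x = 1 → ∀ τ ∈ D, ∀ v ∈ τ, y ⬝ᵥ v = 1 := by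
  have hx0 : x ≠ 0 := by
    rintro rfl
    simp at hy₀x
  obtain ⟨D, c, hDK, hDne, hch, hc, hxc⟩ := hK.exists_barycentric_cone hx0
  obtain ⟨V, hV, htop⟩ := hch.exists_top hDne
  obtain ⟨y', hy', hy'V⟩ := hK.support V (hDK hV)
  have hsum_le : ∑ τ ∈ D, c τ * τ.card ≤ 1 := by
    have h1 := hx y' hy'
    rw [hxc, dotProduct_sum_smul] at h1
    refine le_trans (Finset.sum_le_sum fun τ hτ => ?_) h1
    rw [dotProduct_sum, Finset.sum_congr rfl fun n hn => hy'V n (htop τ hτ hn)]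
    simp
  have hle : ∀ y ∈ B, ∀ τ ∈ D, c τ * (y ⬝ᵥ ∑ n ∈ τ, n) ≤ c τ * τ.card := fun y hy τ hτ =>
    mul_le_mul_of_nonneg_left
      (sum_dotProduct_le_card ((hK.mem_dual_iff y).1 hy τ (hDK hτ))).1 (hc τ hτ).le
  have hval : ∀ y ∈ B, y ⬝ᵥ x = 1 → ∑ τ ∈ D, c τ * (y ⬝ᵥ ∑ n ∈ τ, n) = ∑ τ ∈ D, c τ * τ.card := by
    intro y hy hyx
    refine le_antisymm (Finset.sum_le_sum (hle y hy)) (hsum_le.trans ?_)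
    rw [← hyx, hxc, dotProduct_sum_smul]
  have hsum : ∑ τ ∈ D, c τ * τ.card = 1 := by
    rw [← hval y₀ hy₀ hy₀x, ← hy₀x, hxc, dotProduct_sum_smul]
  refine ⟨D, hDK, hDne, hch, ?_, fun y hy hyx τ hτ => ?_⟩
  · rw [mem_convexHull_image_finset]
    refine ⟨fun τ => c τ * τ.card, fun τ hτ => ?_, hsum, ?_⟩
    · have := hc τ hτ
      positivity
    · rw [hxc]
      refine Finset.sum_congr rfl fun τ hτ => ?_
      have hcard : (τ.card : ℝ) ≠ 0 := by
        exact_mod_cast (hK.nonempty τ (hDK hτ)).card_pos.ne'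
      rw [barycenter, centroid_id_eq_smul_sum (hK.nonempty τ (hDK hτ)), smul_smul, mul_assoc,
        mul_inv_cancel₀ hcard, mul_one]
  · have := (Finset.sum_eq_sum_iff_of_le (hle y hy)).1 (hval y hy hyx) τ hτ
    exact (sum_dotProduct_le_card ((hK.mem_dual_iff y).1 hy τ (hDK hτ))).2
      (mul_left_cancel₀ (hc τ hτ).ne' this)

end

/-! ### Compatible pairs of chains and the cells of Σ -/

section

variable {d : ℕ}

/-- The pairs of nonempty chains of simplices of `S` and `T` on which the pairing is identically
equal to `1`. -/
structure IsCompatiblePair (S T : Finset (Finset (Fin d → ℝ)))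
    (x : Finset (Finset (Fin d → ℝ)) × Finset (Finset (Fin d → ℝ))) : Prop where
  fst_subset : x.1 ⊆ S
  snd_subset : x.2 ⊆ T
  fst_chain : IsChain (· ⊆ ·) (x.1 : Set (Finset (Fin d → ℝ)))
  snd_chain : IsChain (· ⊆ ·) (x.2 : Set (Finset (Fin d → ℝ)))
  fst_nonempty : x.1.Nonempty
  snd_nonempty : x.2.Nonempty
  pairing : ∀ σ ∈ x.1, ∀ τ ∈ x.2, ∀ m ∈ σ, ∀ n ∈ τ, m ⬝ᵥ n = 1

theorem IsCompatiblePair.mono {S T : Finset (Finset (Fin d → ℝ))}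
    {x y : Finset (Finset (Fin d → ℝ)) × Finset (Finset (Fin d → ℝ))}
    (hx : IsCompatiblePair S T x) (h1 : y.1 ⊆ x.1) (h2 : y.2 ⊆ x.2) (h1n : y.1.Nonempty)
    (h2n : y.2.Nonempty) : IsCompatiblePair S T y :=
  ⟨h1.trans hx.fst_subset, h2.trans hx.snd_subset, hx.fst_chain.mono (Finset.coe_subset.2 h1),
    hx.snd_chain.mono (Finset.coe_subset.2 h2), h1n, h2n,
    fun σ hσ τ hτ => hx.pairing σ (h1 hσ) τ (h2 hτ)⟩

/-- The product of barycentric simplices given by a pair of chains. -/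
def productCell (x : Finset (Finset (Fin d → ℝ)) × Finset (Finset (Fin d → ℝ))) :
    Set ((Fin d → ℝ) × (Fin d → ℝ)) :=
  convexHull ℝ (barycenter '' (x.1 : Set (Finset (Fin d → ℝ)))) ×ˢ
    convexHull ℝ (barycenter '' (x.2 : Set (Finset (Fin d → ℝ))))

theorem productCell_eq_convexHull
    (x : Finset (Finset (Fin d → ℝ)) × Finset (Finset (Fin d → ℝ))) :
    productCell x = convexHull ℝ
      ((fun i : Finset (Fin d → ℝ) × Finset (Fin d → ℝ) => (barycenter i.1, barycenter i.2)) ''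
        ((x.1 ×ˢ x.2 : Finset _) : Set (Finset (Fin d → ℝ) × Finset (Fin d → ℝ)))) := by
  rw [productCell, ← convexHull_prod, Finset.coe_product, prod_image_image_eq]

theorem productCell_nonempty {S T : Finset (Finset (Fin d → ℝ))}
    {x : Finset (Finset (Fin d → ℝ)) × Finset (Finset (Fin d → ℝ))}
    (hx : IsCompatiblePair S T x) : (productCell x).Nonempty :=
  ((hx.fst_nonempty.to_set.image _).convexHull).prod ((hx.snd_nonempty.to_set.image _).convexHull)

theorem exists_argmax_prod {α β : Type*} [DecidableEq α] [DecidableEq β] {I : Finset α}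
    {I' : Finset β} (hI : I.Nonempty) (hI' : I'.Nonempty) (f : α → ℝ) (f' : β → ℝ) :
    ∃ (J : Finset α) (J' : Finset β), J.Nonempty ∧ J'.Nonempty ∧ J ⊆ I ∧ J' ⊆ I' ∧
      (∀ i ∈ I, i ∈ J ↔ ∀ j ∈ I, f j ≤ f i) ∧ (∀ i ∈ I', i ∈ J' ↔ ∀ j ∈ I', f' j ≤ f' i) ∧
      ∀ i, i ∈ J ×ˢ J' ↔ i ∈ I ×ˢ I' ∧ ∀ j ∈ I ×ˢ I', f j.1 + f' j.2 ≤ f i.1 + f' i.2 := by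
  classical
  obtain ⟨a, ha, hamax⟩ := I.exists_max_image f hI
  obtain ⟨b, hb, hbmax⟩ := I'.exists_max_image f' hI'
  refine ⟨I.filter fun i => ∀ j ∈ I, f j ≤ f i, I'.filter fun i => ∀ j ∈ I', f' j ≤ f' i,
    ⟨a, Finset.mem_filter.2 ⟨ha, hamax⟩⟩, ⟨b, Finset.mem_filter.2 ⟨hb, hbmax⟩⟩,
    Finset.filter_subset _ _, Finset.filter_subset _ _, fun i hi => by simp [hi],
    fun i hi => by simp [hi], ?_⟩
  rintro ⟨i, i'⟩
  simp only [Finset.mem_product, Finset.mem_filter, Prod.forall]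
  constructor
  · rintro ⟨⟨h1, h2⟩, h3, h4⟩
    exact ⟨⟨h1, h3⟩, fun j j' hj => add_le_add (h2 j hj.1) (h4 j' hj.2)⟩
  · rintro ⟨⟨h1, h3⟩, h⟩
    refine ⟨⟨h1, fun j hj => ?_⟩, h3, fun j hj => ?_⟩
    · have := h j i' ⟨hj, h3⟩
      linarith
    · have := h i j ⟨h1, hj⟩
      linarith

variable {Q : Set (Fin d → ℝ)} {S T : Finset (Finset (Fin d → ℝ))}

/-- The pairing of two barycenters averages vertex pairings that are at most 1, so it is 1 only if
all of them are. Bilinearity extends the value 1 to the product of the hulls. -/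
theorem productCell_subset_sigmaSupport_iff (hS : IsCentralBoundaryComplex Q S)
    (hT : IsCentralBoundaryComplex (dualPolytope Q) T) (hQ : Convex ℝ Q)
    (hSQ : ∀ σ ∈ S, ∀ m ∈ σ, m ∈ dualPolytope Q) (hTQ : ∀ τ ∈ T, ∀ n ∈ τ, n ∈ Q)
    {x : Finset (Finset (Fin d → ℝ)) × Finset (Finset (Fin d → ℝ))} (h1 : x.1 ⊆ S) (h2 : x.2 ⊆ T) :
    productCell x ⊆ sigmaSupport Q ↔ ∀ σ ∈ x.1, ∀ τ ∈ x.2, ∀ m ∈ σ, ∀ n ∈ τ, m ⬝ᵥ n = 1 := by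
  have hle : ∀ σ ∈ S, ∀ m ∈ σ, ∀ τ ∈ T, ∀ n ∈ τ, m ⬝ᵥ n ≤ 1 := fun σ hσ m hm =>
    (hT.mem_dual_iff m).1 (hSQ σ hσ m hm)
  have hbS : ∀ σ ∈ S, barycenter σ ∈ dualPolytope Q := fun σ hσ =>
    convexHull_min (hSQ σ hσ) (convex_dualPolytope Q)
      (σ.centroid_mem_convexHull (hS.nonempty σ hσ))
  have hbT : ∀ τ ∈ T, barycenter τ ∈ Q := fun τ hτ =>
    convexHull_min (hTQ τ hτ) hQ (τ.centroid_mem_convexHull (hT.nonempty τ hτ))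
  have hpair : ∀ σ ∈ S, ∀ τ ∈ T,
      barycenter σ ⬝ᵥ barycenter τ = 1 ↔ ∀ m ∈ σ, ∀ n ∈ τ, m ⬝ᵥ n = 1 := by
    intro σ hσ τ hτ
    rw [dotProduct_comm, (dotProduct_barycenter_le (hS.nonempty σ hσ) fun m hm => ?_).2]
    · refine forall₂_congr fun m hm => ?_
      rw [dotProduct_comm, (dotProduct_barycenter_le (hT.nonempty τ hτ) (hle σ hσ m hm τ hτ)).2]
    · rw [dotProduct_comm]
      exact (dotProduct_barycenter_le (hT.nonempty τ hτ) (hle σ hσ m hm τ hτ)).1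
  constructor
  · intro h σ hσ τ hτ
    have hmem : (barycenter σ, barycenter τ) ∈ productCell x :=
      ⟨subset_convexHull ℝ _ (mem_image_of_mem _ hσ), subset_convexHull ℝ _ (mem_image_of_mem _ hτ)⟩
    exact (hpair σ (h1 hσ) τ (h2 hτ)).1 (h hmem).2.2
  · rintro h ⟨m, n⟩ ⟨hm, hn⟩
    have hmQ : convexHull ℝ (barycenter '' (x.1 : Set (Finset (Fin d → ℝ)))) ⊆ dualPolytope Q := by
      refine convexHull_min ?_ (convex_dualPolytope Q)
      rintro _ ⟨σ, hσ, rfl⟩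
      exact hbS σ (h1 hσ)
    have hnQ : convexHull ℝ (barycenter '' (x.2 : Set (Finset (Fin d → ℝ)))) ⊆ Q := by
      refine convexHull_min ?_ hQ
      rintro _ ⟨τ, hτ, rfl⟩
      exact hbT τ (h2 hτ)
    have hstep : ∀ σ ∈ x.1, barycenter σ ⬝ᵥ n = 1 := by
      intro σ hσ
      have : convexHull ℝ (barycenter '' (x.2 : Set (Finset (Fin d → ℝ)))) ⊆
          {n | dotCLM (barycenter σ) n = 1} := by
        refine convexHull_min ?_ (convex_hyperplane (dotCLM _).isLinear 1)
        rintro _ ⟨τ, hτ, rfl⟩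
        exact (hpair σ (h1 hσ) τ (h2 hτ)).2 (h σ hσ τ hτ)
      exact this hn
    have : convexHull ℝ (barycenter '' (x.1 : Set (Finset (Fin d → ℝ)))) ⊆
        {m | dotCLM n m = 1} := by
      refine convexHull_min ?_ (convex_hyperplane (dotCLM _).isLinear 1)
      rintro _ ⟨σ, hσ, rfl⟩
      simp only [mem_ofPred_eq, dotCLM_apply]
      rw [dotProduct_comm]
      exact hstep σ hσ
    refine ⟨hmQ hm, hnQ hn, ?_⟩
    rw [dotProduct_comm]
    exact this hm

theorem productCell_subset_iff (hS : IsCentralBoundaryComplex Q S)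
    (hT : IsCentralBoundaryComplex (dualPolytope Q) T)
    {x y : Finset (Finset (Fin d → ℝ)) × Finset (Finset (Fin d → ℝ))}
    (hx : IsCompatiblePair S T x) (hy : IsCompatiblePair S T y) :
    productCell x ⊆ productCell y ↔ x ≤ y := by
  have key : ∀ {B : Set (Fin d → ℝ)} {K : Finset (Finset (Fin d → ℝ))},
      IsCentralBoundaryComplex B K → ∀ {L L' : Finset (Finset (Fin d → ℝ))}, L ⊆ K → L' ⊆ K →
      IsChain (· ⊆ ·) (L' : Set (Finset (Fin d → ℝ))) →
      convexHull ℝ (barycenter '' (L : Set (Finset (Fin d → ℝ)))) ⊆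
        convexHull ℝ (barycenter '' (L' : Set (Finset (Fin d → ℝ)))) → L ⊆ L' := by
    -- If the barycenter of `τ` lies in the hull of `L'`, the chains `{τ}` and `L'` must have a
    -- common member.
    intro B K hK L L' hL hL' hc h τ hτ
    have h1 := hK.mem_convexHull_barycenter_inter (L := {τ}) (x := barycenter τ)
      (Finset.singleton_subset_iff.2 (hL hτ)) hL' (by simp [IsChain]) hc (by simp)
      (h (subset_convexHull ℝ _ (mem_image_of_mem _ hτ)))
    obtain ⟨-, σ, ⟨h2, h3⟩, -⟩ := convexHull_nonempty_iff.1 ⟨_, h1⟩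
    have h4 : σ = τ := by simpa using h2
    exact h4 ▸ h3
  constructor
  · intro h
    rcases prod_subset_prod_iff.1 h with ⟨h1, h2⟩ | h1 | h1
    · exact ⟨key hS hx.fst_subset hy.fst_subset hy.fst_chain h1,
        key hT hx.snd_subset hy.snd_subset hy.snd_chain h2⟩
    · exact absurd h1 (hx.fst_nonempty.to_set.image _).convexHull.ne_empty
    · exact absurd h1 (hx.snd_nonempty.to_set.image _).convexHull.ne_empty
  · rintro ⟨h1, h2⟩
    exact prod_mono (convexHull_mono (image_mono (Finset.coe_subset.2 h1)))
      (convexHull_mono (image_mono (Finset.coe_subset.2 h2)))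

/-- A functional on the product splits into one on each factor, so its maximal face is the product
of the cells of two subchains. -/
theorem exists_productCell_eq_of_isExposed
    {x : Finset (Finset (Fin d → ℝ)) × Finset (Finset (Fin d → ℝ))} (hx : IsCompatiblePair S T x)
    {F : Set ((Fin d → ℝ) × (Fin d → ℝ))} (hF : F.Nonempty) (hexp : IsExposed ℝ (productCell x) F) :
    ∃ y, IsCompatiblePair S T y ∧ productCell y = F := by
  classical
  obtain ⟨l, rfl⟩ := hexp hF
  obtain ⟨J, J', hJ, hJ', hJs, hJs', -, -, hmax⟩ := exists_argmax_prod hx.fst_nonempty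
    hx.snd_nonempty (fun σ => l (barycenter σ, 0)) (fun τ => l (0, barycenter τ))
  refine ⟨(J, J'), hx.mono hJs hJs' hJ hJ', ?_⟩
  have hl : ∀ m n : Fin d → ℝ, l (m, 0) + l (0, n) = l (m, n) := fun m n => by
    rw [← map_add]; simp
  simp only [hl] at hmax
  rw [productCell_eq_convexHull x, productCell_eq_convexHull]
  exact (setOf_isMax_convexHull_image (I := x.1 ×ˢ x.2) (J := J ×ˢ J')
    (fun i : Finset (Fin d → ℝ) × Finset (Fin d → ℝ) => (barycenter i.1, barycenter i.2))
    l.toLinearMap (hJ.product hJ') hmax).symm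

theorem isExposed_productCell_inter (hS : IsCentralBoundaryComplex Q S)
    (hT : IsCentralBoundaryComplex (dualPolytope Q) T)
    {x y : Finset (Finset (Fin d → ℝ)) × Finset (Finset (Fin d → ℝ))}
    (hx : IsCompatiblePair S T x) (hy : IsCompatiblePair S T y) :
    IsExposed ℝ (productCell x) (productCell x ∩ productCell y) := by
  classical
  rintro ⟨⟨m₀, n₀⟩, ⟨hm₀, hn₀⟩, hm₀', hn₀'⟩
  have hinter : ∀ {B : Set (Fin d → ℝ)} {K : Finset (Finset (Fin d → ℝ))},
      IsCentralBoundaryComplex B K → ∀ {L L' : Finset (Finset (Fin d → ℝ))}, L ⊆ K → L' ⊆ K →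
      IsChain (· ⊆ ·) (L : Set (Finset (Fin d → ℝ))) →
      IsChain (· ⊆ ·) (L' : Set (Finset (Fin d → ℝ))) →
      ∀ {z}, z ∈ convexHull ℝ (barycenter '' (L : Set (Finset (Fin d → ℝ)))) →
      z ∈ convexHull ℝ (barycenter '' (L' : Set (Finset (Fin d → ℝ)))) →
      ∃ f : Fin d → ℝ, ∀ z ∈ convexHull ℝ (barycenter '' (L : Set (Finset (Fin d → ℝ)))),
        f ⬝ᵥ z ≤ 0 ∧
        (f ⬝ᵥ z = 0 ↔ z ∈ convexHull ℝ (barycenter '' (L' : Set (Finset (Fin d → ℝ))))) := by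
    intro B K hK L L' hL hL' hc hc' z hz hz'
    have hmem := fun {z} hz hz' =>
      hK.mem_convexHull_barycenter_inter (x := z) hL hL' hc hc' hz hz'
    have hne : (L ∩ L').Nonempty := by
      have := (convexHull_nonempty_iff.1 ⟨_, hmem hz hz'⟩).of_image
      rwa [← Finset.coe_inter, Finset.coe_nonempty] at this
    obtain ⟨f, hf⟩ := hK.exists_exposing_functional hL Finset.inter_subset_left hc hne
    refine ⟨f, fun w hw => ⟨(hf w hw).1, (hf w hw).2.trans ⟨fun h => ?_, fun h => ?_⟩⟩⟩
    · exact convexHull_mono (image_mono (Finset.coe_subset.2 Finset.inter_subset_right)) h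
    · rw [Finset.coe_inter]
      exact hmem hw h
  obtain ⟨f, hf⟩ := hinter hS hx.fst_subset hy.fst_subset hx.fst_chain hy.fst_chain hm₀ hm₀'
  obtain ⟨f', hf'⟩ := hinter hT hx.snd_subset hy.snd_subset hx.snd_chain hy.snd_chain hn₀ hn₀'
  refine ⟨(dotCLM f).comp (ContinuousLinearMap.fst ℝ (Fin d → ℝ) (Fin d → ℝ)) +
    (dotCLM f').comp (ContinuousLinearMap.snd ℝ (Fin d → ℝ) (Fin d → ℝ)), ?_⟩
  have hl : ∀ p : (Fin d → ℝ) × (Fin d → ℝ), ((dotCLM f).comp (ContinuousLinearMap.fst ℝ (Fin d → ℝ) (Fin d → ℝ)) +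
      (dotCLM f').comp (ContinuousLinearMap.snd ℝ (Fin d → ℝ) (Fin d → ℝ))) p = f ⬝ᵥ p.1 + f' ⬝ᵥ p.2 := fun p => rfl
  simp only [hl]
  ext ⟨m, n⟩
  constructor
  · rintro ⟨⟨hm, hn⟩, hm', hn'⟩
    refine ⟨⟨hm, hn⟩, ?_⟩
    rintro ⟨m', n'⟩ ⟨h1, h2⟩
    dsimp only at *
    rw [(hf m hm).2.2 hm', (hf' n hn).2.2 hn']
    linarith [(hf m' h1).1, (hf' n' h2).1]
  · rintro ⟨⟨hm, hn⟩, hmax⟩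
    have h := hmax (m₀, n₀) ⟨hm₀, hn₀⟩
    dsimp only at *
    rw [(hf m₀ hm₀).2.2 hm₀', (hf' n₀ hn₀).2.2 hn₀'] at h
    have h1 := (hf m hm).1
    have h2 := (hf' n hn).1
    exact ⟨⟨hm, hn⟩, (hf m hm).2.1 (by linarith), (hf' n hn).2.1 (by linarith)⟩

/-- The chain through `m` inherits value 1 against `n`. So each of its vertices is a functional with
value 1 at `n`, and the chain through `n` inherits value 1 against all of them. -/
theorem exists_mem_productCell (hS : IsCentralBoundaryComplex Q S)
    (hT : IsCentralBoundaryComplex (dualPolytope Q) T)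
    (hSQ : ∀ σ ∈ S, ∀ m ∈ σ, m ∈ dualPolytope Q) {p : (Fin d → ℝ) × (Fin d → ℝ)}
    (hp : p ∈ sigmaSupport Q) : ∃ x, IsCompatiblePair S T x ∧ p ∈ productCell x := by
  obtain ⟨m, n⟩ := p
  obtain ⟨hm, hn, hmn⟩ := hp
  dsimp only at *
  obtain ⟨C, hCS, hCne, hCch, hmC, hC⟩ := hS.exists_chain_mem_convexHull (x := m) (y₀ := n)
    (fun y hy => by rw [dotProduct_comm]; exact hm y hy) hn (by rwa [dotProduct_comm])
  obtain ⟨D, hDT, hDne, hDch, hnD, hD⟩ := hT.exists_chain_mem_convexHull (x := n) (y₀ := m)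
    (fun y hy => hy n hn) hm hmn
  refine ⟨(C, D), ⟨hCS, hDT, hCch, hDch, hCne, hDne, fun σ hσ τ hτ m' hm' n' hn' => ?_⟩, hmC, hnD⟩
  refine hD m' (hSQ σ (hCS hσ) m' hm') ?_ τ hτ n' hn'
  rw [dotProduct_comm]
  exact hC n hn (by rwa [dotProduct_comm]) σ hσ m' hm'

/-! ### The boundary complex of the Minkowski sum -/

/-- If `u` were constant on the `q`, all of `T` would be a chain and hence lie in one simplex. The
negative of a functional supporting that simplex would then be positive on no vertex. -/
theorem exists_not_isMax (hT : IsCentralBoundaryComplex (dualPolytope Q) T) {q : Finset (Fin d → ℝ) → (Fin d → ℝ)}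
    {u : Fin d → ℝ} (hu : u ≠ 0)
    (hchain : ∀ τ ∈ T, (∀ π ∈ T, u ⬝ᵥ q π ≤ u ⬝ᵥ q τ) → ∀ τ' ∈ T,
      (∀ π ∈ T, u ⬝ᵥ q π ≤ u ⬝ᵥ q τ') → τ ⊆ τ' ∨ τ' ⊆ τ) :
    ∃ τ ∈ T, ∃ π ∈ T, u ⬝ᵥ q τ < u ⬝ᵥ q π := by
  by_contra! hcon
  have hch : IsChain (· ⊆ ·) (T : Set (Finset (Fin d → ℝ))) := fun τ hτ τ' hτ' _ =>
    hchain τ hτ (hcon τ hτ) τ' hτ' (hcon τ' hτ')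
  obtain ⟨V₀, hV₀, -⟩ := hT.cover u hu
  obtain ⟨V, hV, htop⟩ := hch.exists_top ⟨V₀, hV₀⟩
  obtain ⟨m, -, hm⟩ := hT.support V hV
  have hm0 : -m ≠ 0 := fun h => by
    obtain ⟨n, hn⟩ := hT.nonempty V hV
    have := hm n hn
    rw [neg_eq_zero.1 h, zero_dotProduct] at this
    exact zero_ne_one this
  obtain ⟨W, hW, n, hn, hpos⟩ := hT.exists_pos hm0
  rw [neg_dotProduct, hm n (htop W hW hn)] at hpos
  linarith

theorem exists_orderIso_boundaryComplex (hS : IsCentralBoundaryComplex Q S)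
    (hT : IsCentralBoundaryComplex (dualPolytope Q) T)
    (hSQ : ∀ σ ∈ S, ∀ m ∈ σ, m ∈ dualPolytope Q) [Nontrivial (Fin d → ℝ)] :
    ∃ P : Set (Fin d → ℝ), IsConvexPolytope P ∧ (interior P).Nonempty ∧
      Nonempty ({x // IsCompatiblePair S T x} ≃o boundaryComplex P) := by
  classical
  obtain ⟨p, q, hI, hII⟩ := exists_minkowski_points hS hT hSQ
  let f : Finset (Fin d → ℝ) × Finset (Fin d → ℝ) → (Fin d → ℝ) := fun i => p i.1 + q i.2
  set P := convexHull ℝ (f '' ((S ×ˢ T : Finset _) : Set _)) with hP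
  obtain ⟨e, he⟩ := exists_ne (0 : Fin d → ℝ)
  have hSne : S.Nonempty := by
    obtain ⟨V, hV, -⟩ := hS.cover e he
    exact ⟨V, hV⟩
  have hTne : T.Nonempty := by
    obtain ⟨V, hV, -⟩ := hT.cover e he
    exact ⟨V, hV⟩
  have hnc : ∀ u : Fin d → ℝ, u ≠ 0 → ∃ a ∈ f '' ((S ×ˢ T : Finset _) : Set _),
      ∃ b ∈ f '' ((S ×ˢ T : Finset _) : Set _), u ⬝ᵥ a < u ⬝ᵥ b := by
    intro u hu
    obtain ⟨τ, hτ, π, hπ, hlt⟩ := exists_not_isMax hT hu (hI u hu).2.1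
    obtain ⟨σ, hσ⟩ := hSne
    refine ⟨_, mem_image_of_mem f (Finset.mem_coe.2 (Finset.mk_mem_product hσ hτ)), _,
      mem_image_of_mem f (Finset.mem_coe.2 (Finset.mk_mem_product hσ hπ)), ?_⟩
    simp only [f, dotProduct_add]
    linarith
  have hface : ∀ (x : Finset (Finset (Fin d → ℝ)) × Finset (Finset (Fin d → ℝ))) (u : Fin d → ℝ),
      x.1 ⊆ S → x.2 ⊆ T → x.1.Nonempty → x.2.Nonempty →
      (∀ σ ∈ S, σ ∈ x.1 ↔ ∀ π ∈ S, u ⬝ᵥ p π ≤ u ⬝ᵥ p σ) →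
      (∀ τ ∈ T, τ ∈ x.2 ↔ ∀ π ∈ T, u ⬝ᵥ q π ≤ u ⬝ᵥ q τ) →
      {y | y ∈ P ∧ ∀ z ∈ P, dotCLM u z ≤ dotCLM u y} =
        convexHull ℝ (f '' ((x.1 ×ˢ x.2 : Finset _) : Set _)) := by
    intro x u h1 h2 h1n h2n hm1 hm2
    obtain ⟨J, J', -, -, hJs, hJs', hJ, hJ', hmax⟩ := exists_argmax_prod hSne hTne
      (fun σ => u ⬝ᵥ p σ) (fun τ => u ⬝ᵥ q τ)
    have e1 : x.1 = J := Finset.ext fun σ =>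
      ⟨fun h => (hJ σ (h1 h)).2 ((hm1 σ (h1 h)).1 h), fun h => (hm1 σ (hJs h)).2 ((hJ σ (hJs h)).1 h)⟩
    have e2 : x.2 = J' := Finset.ext fun τ =>
      ⟨fun h => (hJ' τ (h2 h)).2 ((hm2 τ (h2 h)).1 h),
        fun h => (hm2 τ (hJs' h)).2 ((hJ' τ (hJs' h)).1 h)⟩
    rw [← e1, ← e2] at hmax
    refine setOf_isMax_convexHull_image f (dotCLM u).toLinearMap (h1n.product h2n) fun i => ?_
    rw [hmax i]
    simp only [ContinuousLinearMap.coe_coe, dotCLM_apply, f, dotProduct_add]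
  have hexists : ∀ x, IsCompatiblePair S T x → ∃ u ≠ 0,
      (∀ σ ∈ S, σ ∈ x.1 ↔ ∀ π ∈ S, u ⬝ᵥ p π ≤ u ⬝ᵥ p σ) ∧
      (∀ τ ∈ T, τ ∈ x.2 ↔ ∀ π ∈ T, u ⬝ᵥ q π ≤ u ⬝ᵥ q τ) ∧
      {y | y ∈ P ∧ ∀ z ∈ P, dotCLM u z ≤ dotCLM u y} =
        convexHull ℝ (f '' ((x.1 ×ˢ x.2 : Finset _) : Set _)) := by
    intro x hx
    obtain ⟨u, hu, h1, h2⟩ := hII x.1 hx.fst_subset x.2 hx.snd_subset hx.fst_chain hx.snd_chain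
      hx.fst_nonempty hx.snd_nonempty hx.pairing
    exact ⟨u, hu, h1, h2, hface x u hx.fst_subset hx.snd_subset hx.fst_nonempty hx.snd_nonempty
      h1 h2⟩
  have hmem : ∀ x, IsCompatiblePair S T x →
      convexHull ℝ (f '' ((x.1 ×ˢ x.2 : Finset _) : Set _)) ∈ boundaryComplex P := by
    intro x hx
    obtain ⟨u, hu, -, -, hF⟩ := hexists x hx
    refine ⟨?_, fun h => ?_, fun _ => ⟨dotCLM u, hF.symm⟩⟩
    · exact ((hx.fst_nonempty.product hx.snd_nonempty).to_set.image f).convexHull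
    · obtain ⟨a, ha, b, hb, hlt⟩ := hnc u hu
      have ha' := subset_convexHull ℝ _ ha
      rw [← hP, ← h, ← hF] at ha'
      exact absurd (ha'.2 b (subset_convexHull ℝ _ hb)) (not_le.2 hlt)
  refine ⟨P, ⟨(S ×ˢ T).image f, by rw [Finset.coe_image]⟩, ?_, ?_⟩
  -- The sum is full-dimensional because no nonzero functional is constant on its generators.
  · rw [hP, interior_convexHull_nonempty_iff_affineSpan_eq_top,
      AffineSubspace.affineSpan_eq_top_iff_vectorSpan_eq_top_of_nonempty ℝ _ _
        ((hSne.product hTne).to_set.image f)]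
    by_contra hne
    obtain ⟨g, hg0, hg⟩ := Submodule.exists_le_ker_of_lt_top _ (lt_top_iff_ne_top.2 hne)
    obtain ⟨u, hu⟩ := exists_eq_dotCLM g
    have hu0 : u ≠ 0 := by
      rintro rfl
      exact hg0 (LinearMap.ext fun x => by rw [hu]; simp)
    obtain ⟨a, ha, b, hb, hlt⟩ := hnc u hu0
    have := hg (vsub_mem_vectorSpan ℝ hb ha)
    rw [LinearMap.mem_ker, hu, vsub_eq_sub, dotProduct_sub] at this
    linarith
  · refine ⟨RelIso.ofSurjective (OrderEmbedding.ofMapLEIff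
      (fun x : {x // IsCompatiblePair S T x} =>
        (⟨convexHull ℝ (f '' ((x.1.1 ×ˢ x.1.2 : Finset _) : Set _)), hmem x.1 x.2⟩ :
          boundaryComplex P)) ?_) ?_⟩
    · rintro ⟨x, hx⟩ ⟨y, hy⟩
      change convexHull ℝ _ ⊆ convexHull ℝ _ ↔ x ≤ y
      constructor
      -- The functional exposing the face of `y` is maximal at every generator of the face of `x`,
      -- so both components of that generator are maximal and belong to `y`.
      · intro h
        obtain ⟨u, hu, h1, h2, hF⟩ := hexists y hy
        have hmax : ∀ σ ∈ x.1, ∀ τ ∈ x.2, ∀ σ' ∈ S, ∀ τ' ∈ T,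
            u ⬝ᵥ p σ' + u ⬝ᵥ q τ' ≤ u ⬝ᵥ p σ + u ⬝ᵥ q τ := by
          intro σ hσ τ hτ σ' hσ' τ' hτ'
          have h3 := h (subset_convexHull ℝ _ (mem_image_of_mem f
            (Finset.mem_coe.2 (Finset.mk_mem_product hσ hτ))))
          rw [← hF] at h3
          have h4 := h3.2 _ (subset_convexHull ℝ _ (mem_image_of_mem f
            (Finset.mem_coe.2 (Finset.mk_mem_product hσ' hτ'))))
          simpa only [dotCLM_apply, f, dotProduct_add] using h4
        obtain ⟨σ₀, hσ₀⟩ := hx.fst_nonempty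
        obtain ⟨τ₀, hτ₀⟩ := hx.snd_nonempty
        refine ⟨fun σ hσ => (h1 σ (hx.fst_subset hσ)).2 fun π hπ => ?_,
          fun τ hτ => (h2 τ (hx.snd_subset hτ)).2 fun π hπ => ?_⟩
        · linarith [hmax σ hσ τ₀ hτ₀ π hπ τ₀ (hx.snd_subset hτ₀)]
        · linarith [hmax σ₀ hσ₀ τ hτ σ₀ (hx.fst_subset hσ₀) π hπ]
      · rintro ⟨h1, h2⟩
        exact convexHull_mono (image_mono (Finset.coe_subset.2 (Finset.product_subset_product h1 h2)))
    · rintro ⟨F, hFne, hFP, hexp⟩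
      obtain ⟨l, hl⟩ := hexp hFne
      obtain ⟨u, hu⟩ := exists_eq_dotCLM l.toLinearMap
      have hlu : l = dotCLM u := ContinuousLinearMap.ext hu
      -- The zero functional would expose the whole polytope, which is not a proper face.
      have hu0 : u ≠ 0 := by
        rintro rfl
        refine hFP ?_
        rw [hl, hlu]
        ext y
        simp
      obtain ⟨J, J', hJne, hJne', hJs, hJs', hJ, hJ', -⟩ := exists_argmax_prod hSne hTne
        (fun σ => u ⬝ᵥ p σ) (fun τ => u ⬝ᵥ q τ)
      obtain ⟨i1, i2, i3⟩ := hI u hu0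
      have hx : IsCompatiblePair S T (J, J') :=
        ⟨hJs, hJs', fun σ hσ σ' hσ' _ => i1 σ (hJs hσ) ((hJ σ (hJs hσ)).1 hσ) σ' (hJs hσ')
            ((hJ σ' (hJs hσ')).1 hσ'),
          fun τ hτ τ' hτ' _ => i2 τ (hJs' hτ) ((hJ' τ (hJs' hτ)).1 hτ) τ' (hJs' hτ')
            ((hJ' τ' (hJs' hτ')).1 hτ'), hJne, hJne',
          fun σ hσ τ hτ => i3 σ (hJs hσ) ((hJ σ (hJs hσ)).1 hσ) τ (hJs' hτ)
            ((hJ' τ (hJs' hτ)).1 hτ)⟩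
      refine ⟨⟨(J, J'), hx⟩, Subtype.ext ?_⟩
      change convexHull ℝ _ = F
      rw [hl, hlu]
      exact (hface (J, J') u hJs hJs' hJne hJne' hJ hJ').symm

end

/-! ### Assembly -/

theorem mainTheorem2 (d : ℕ) (Q : Set (Fin d → ℝ)) (hQ : IsReflexivePolytope Q)
    (lam nu : (Fin d → ℤ) → ℤ)
    (hlam : InducesCentralTriangulation (dualPolytope Q) lam)
    (hnu : InducesCentralTriangulation Q nu) :
    IsPolytopalComplex (sigmaComplex Q lam nu) ∧
    ⋃₀ sigmaComplex Q lam nu = sigmaSupport Q ∧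
    (∃ P : Set (Fin d → ℝ), IsConvexPolytope P ∧ (interior P).Nonempty ∧
      Nonempty (sigmaComplex Q lam nu ≃o boundaryComplex P)) ∧
    Nonempty (sigmaSupport Q ≃ₜ Metric.sphere (0 : EuclideanSpace ℝ (Fin d)) 1) := by
  classical
  have hA := hQ.isLatticeBody
  have hA' := hQ.isLatticeBody_dualPolytope
  obtain ⟨S, hSeq, hS⟩ := exists_isCentralBoundaryComplex hA' hlam
  obtain ⟨T, hTeq, hT⟩ := exists_isCentralBoundaryComplex hA hnu
  -- By biduality the supporting functionals of the simplices of S are points of `Q`.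
  rw [dualPolytope_dualPolytope hA.isCompact hA.convex hA.zero_mem_interior] at hS
  have hSQ : ∀ σ ∈ S, ∀ m ∈ σ, m ∈ dualPolytope Q := fun σ hσ m hm => by
    have hσ' : σ ∈ boundaryTriangulation (dualPolytope Q) lam := hSeq ▸ hσ
    obtain ⟨z, hz, rfl⟩ := subset_latticePoint_of_mem_boundaryTriangulation hσ' hm
    exact hz
  have hTQ : ∀ τ ∈ T, ∀ n ∈ τ, n ∈ Q := fun τ hτ n hn => by
    have hτ' : τ ∈ boundaryTriangulation Q nu := hTeq ▸ hτ
    obtain ⟨z, hz, rfl⟩ := subset_latticePoint_of_mem_boundaryTriangulation hτ' hn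
    exact hz
  have hcell : ∀ c, c ∈ sigmaComplex Q lam nu ↔ ∃ x, IsCompatiblePair S T x ∧ productCell x = c := by
    intro c
    constructor
    · rintro ⟨_, ⟨C, hCne, hC, hCch, rfl⟩, _, ⟨D, hDne, hD, hDch, rfl⟩, rfl, hsub⟩
      rw [← hSeq] at hC
      rw [← hTeq] at hD
      have hC' := Finset.coe_subset.1 hC
      have hD' := Finset.coe_subset.1 hD
      exact ⟨(C, D), ⟨hC', hD', hCch, hDch, hCne, hDne,
        (productCell_subset_sigmaSupport_iff hS hT hA.convex hSQ hTQ (x := (C, D)) hC' hD').1 hsub⟩,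
        rfl⟩
    · rintro ⟨x, hx, rfl⟩
      refine ⟨_, ⟨x.1, hx.fst_nonempty, ?_, hx.fst_chain, rfl⟩, _,
        ⟨x.2, hx.snd_nonempty, ?_, hx.snd_chain, rfl⟩, rfl,
        (productCell_subset_sigmaSupport_iff hS hT hA.convex hSQ hTQ hx.fst_subset
          hx.snd_subset).2 hx.pairing⟩
      · rw [← hSeq]
        exact Finset.coe_subset.2 hx.fst_subset
      · rw [← hTeq]
        exact Finset.coe_subset.2 hx.snd_subset
  have hiso : Nonempty ({x // IsCompatiblePair S T x} ≃o sigmaComplex Q lam nu) := by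
    refine ⟨RelIso.ofSurjective (OrderEmbedding.ofMapLEIff
      (fun x : {x // IsCompatiblePair S T x} =>
        (⟨productCell x.1, (hcell _).2 ⟨x.1, x.2, rfl⟩⟩ : sigmaComplex Q lam nu))
      fun x y => productCell_subset_iff hS hT x.2 y.2) ?_⟩
    rintro ⟨c, hc⟩
    obtain ⟨x, hx, rfl⟩ := (hcell c).1 hc
    exact ⟨⟨x, hx⟩, rfl⟩
  refine ⟨⟨?_, ?_, ?_, ?_, ?_⟩, ?_, ?_, nonempty_homeomorph_sigmaSupport_sphere hA.isCompact
    hA.convex hA.zero_mem_interior⟩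
  · refine ((S.powerset ×ˢ T.powerset).finite_toSet.image productCell).subset fun c hc => ?_
    obtain ⟨x, hx, rfl⟩ := (hcell c).1 hc
    refine mem_image_of_mem _ (Finset.mem_coe.2 (Finset.mem_product.2
      ⟨Finset.mem_powerset.2 hx.fst_subset, Finset.mem_powerset.2 hx.snd_subset⟩))
  · intro c hc
    obtain ⟨x, hx, rfl⟩ := (hcell c).1 hc
    exact productCell_nonempty hx
  · intro c hc
    obtain ⟨x, hx, rfl⟩ := (hcell c).1 hc
    rw [productCell_eq_convexHull]
    exact ⟨(x.1 ×ˢ x.2).image _, by rw [Finset.coe_image]⟩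
  · intro c hc F hF hexp
    obtain ⟨x, hx, rfl⟩ := (hcell c).1 hc
    exact (hcell F).2 (exists_productCell_eq_of_isExposed hx hF hexp)
  · intro c hc c' hc'
    obtain ⟨x, hx, rfl⟩ := (hcell c).1 hc
    obtain ⟨y, hy, rfl⟩ := (hcell c').1 hc'
    exact isExposed_productCell_inter hS hT hx hy
  · refine subset_antisymm (sUnion_subset fun c hc => ?_) fun p hp => ?_
    · obtain ⟨-, -, -, -, -, hsub⟩ := hc
      exact hsub
    · obtain ⟨x, hx, hpx⟩ := exists_mem_productCell hS hT hSQ hp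
      exact ⟨_, (hcell _).2 ⟨x, hx, rfl⟩, hpx⟩
  · obtain ⟨e⟩ := hiso
    rcases subsingleton_or_nontrivial (Fin d → ℝ) with hd | hd
    -- In dimension 0 the pairing is never 1, so there are no cells, and the one-point polytope has
    -- no nonempty proper faces.
    · have hempty : IsEmpty {x // IsCompatiblePair S T x} := by
        refine ⟨fun x => ?_⟩
        obtain ⟨σ, hσ⟩ := x.2.fst_nonempty
        obtain ⟨τ, hτ⟩ := x.2.snd_nonempty
        obtain ⟨m, hm⟩ := hS.nonempty σ (x.2.fst_subset hσ)
        obtain ⟨n, hn⟩ := hT.nonempty τ (x.2.snd_subset hτ)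
        have h1 := x.2.pairing σ hσ τ hτ m hm n hn
        rw [Subsingleton.elim m 0, zero_dotProduct] at h1
        exact zero_ne_one h1
      have hempty' : IsEmpty (boundaryComplex (univ : Set (Fin d → ℝ))) :=
        ⟨fun ⟨F, hF, hne, _⟩ => hne (Subsingleton.eq_univ_of_nonempty hF)⟩
      have := e.symm.toEquiv.isEmpty
      exact ⟨univ, ⟨{0}, (Subsingleton.eq_univ_of_nonempty (by simp)).symm⟩, by simp,
        ⟨OrderIso.ofIsEmpty _ _⟩⟩
    · obtain ⟨P, hP, hPi, ⟨e'⟩⟩ := exists_orderIso_boundaryComplex hS hT hSQ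
      exact ⟨P, hP, hPi, ⟨e.symm.trans e'⟩⟩
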